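/- \textbf{Definitions.} Let $\mathcal E$ be a category. A \emph{nested sequence} in $\mathcal E$ is a functor $\omega\to\mathcal E$ (where $\omega$ is the ordered set of natural numbers) sending every morphism of $\omega$ to a monomorphism. The category $\mathcal E$ is \emph{suitable} if: (C1) $\mathcal E$ has all finite limits; (C2) $\mathcal E$ has finite coproducts; their coprojections are monic; for all $A,B$ the square $0\to A\to A+B$, $0\to B\to A+B$ is a pullback; and finite coproducts (including the empty one) are stable under pullback; (C3) every nested sequence in $\mathcal E$ has a colimit, the coprojections of such a colimit are monic, and colimits of nested sequences commute with pullbacks, i.e. for all natural transformations $A\to C\leftarrow B$ between nested sequences, the canonical map $\operatorname{colim}_n (A_n\times_{C_n}B_n)\to \operatorname{colim} A\times_{\operatorname{colim} C}\operatorname{colim} B$ is an isomorphism. A monad $(T,\eta,\mu)$ on $\mathcal E$ is \emph{suitable} if: (M1) $T$ preserves pullbacks and all naturality squares of $\eta$ and of $\mu$ are pullbacks; (M2) $T$ preserves colimits of nested sequences. The pair $(\mathcal E,T)$ is \emph{suitable} if $\mathcal E$ is a suitable category and $T$ is a suitable monad on it. For such a pair let $\mathrm{Span}(\mathcal E,T)$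 be the bicategory whose objects are those of $\mathcal E$, whose 1-cells $A\to B$ are diagrams $TA\xleftarrow{d}P\xrightarrow{c}B$, and whose 2-cells are the maps of apexes commuting with both legs; the composite of $TA\leftarrow P\to B$ and $TB\leftarrow Q\to C$ has apex $TP\times_{TB}Q$ and legs $TP\times_{TB}Q\to TP\to T^2A\xrightarrow{\mu_A} TA$ and $TP\times_{TB}Q\to Q\to C$, and the identity on $A$ is $TA\xleftarrow{\eta_A}A\xrightarrow{1}A$. A \emph{$T$-graph} is an object $X_0$ together with a 1-cell $TX_0\leftarrow X_1\to X_0$; a map of $T$-graphs $X\to Y$ is a pair $X_0\to Y_0$, $X_1\to Y_1$ commuting with the legs. A \emph{$T$-multicategory} is a monad in $\mathrm{Span}(\mathcal E,T)$, i.e. a $T$-graph $C$ with 2-cells $\mathrm{comp}:C_1\circ C_1\to C_1$ and $\mathrm{ids}:C_0\to C_1$ satisfying the associativity and unit laws; a map of $T$-multicategories is a map of the underlying $T$-graphs preserving $\mathrm{comp}$ and $\mathrm{ids}$. \textbf{Theorem.} Let $(\mathcal E,T)$ be suitable. Then the forgetful functor $U:T\text{-}\mathbf{Multicat}\to \mathcal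 E'=T\text{-}\mathbf{Graph}$ has a left adjoint; the adjunction is monadic, i.e. the comparison functor from $T\text{-}\mathbf{Multicat}$ to the category of algebras of the induced monad $T'$ on $\mathcal E'$ is an equivalence of categories; and $(\mathcal E',T')$ is again suitable. -/

import Mathlib

open CategoryTheory CategoryTheory.Limits

universe v u

noncomputable section

/-! ### Suitable categories and suitable monads -/

/-- A nested sequence: a functor `ω ⥤ E` sending every morphism of `ω` to a monomorphism. -/
def IsNested {E : Type u} [Category.{v} E] (D : ℕ ⥤ E) : Prop :=
  ∀ ⦃m n : ℕ⦄ (f : m ⟶ n), Mono (D.map f)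

/-- A suitable category. -/
class IsSuitableCategory (E : Type u) [Category.{v} E] : Prop where
  /-- `E` has finite limits. -/
  hasFiniteLimits : HasFiniteLimits E
  /-- `E` has finite coproducts. -/
  hasFiniteCoproducts : HasFiniteCoproducts E
  /-- The coprojections of finite coproducts are monic. -/
  mono_coprojection : ∀ (J : Type) [Finite J] (X : J → E) (j : J), Mono (Sigma.ι X j)
  /-- The intersection of the two summands of `A ⨿ B` is initial. -/
  disjoint : ∀ A B : E,
    IsPullback (initial.to A) (initial.to B) (coprod.inl : A ⟶ A ⨿ B) (coprod.inr : B ⟶ A ⨿ B)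
  /-- Finite coproducts (including the empty one) are stable under pullback. -/
  stable : ∀ (J : Type) [Finite J] (X : Discrete J ⥤ E) (c : Cocone X),
    IsColimit c → IsUniversalColimit c
  /-- Nested sequences have colimits. -/
  hasColimit_nested : ∀ D : ℕ ⥤ E, IsNested D → HasColimit D
  /-- Colimits of nested sequences commute with pullbacks: if `P` is the pullback of `A ⟶ C ⟵ B`
  in the category of sequences, with `A`, `B`, `C` nested, then `colim P` is the pullback of
  `colim A ⟶ colim C ⟵ colim B`. -/
  isPullback_colimit_nested : ∀ {P A B C : ℕ ⥤ E} (p : P ⟶ A) (q : P ⟶ B) (f : A ⟶ C) (g : B ⟶ C),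
    IsNested A → IsNested B → IsNested C → IsPullback p q f g →
    ∀ (cP : Cocone P) (cA : Cocone A) (cB : Cocone B) (cC : Cocone C)
      (hP : IsColimit cP) (hA : IsColimit cA) (hB : IsColimit cB) (_ : IsColimit cC),
      IsPullback (hP.map cA p) (hP.map cB q) (hA.map cC f) (hB.map cC g)
  /-- The coprojections of a colimit of a nested sequence are monic. -/
  mono_coprojection_nested : ∀ (D : ℕ ⥤ E), IsNested D →
    ∀ (c : Cocone D), IsColimit c → ∀ n : ℕ, Mono (c.ι.app n)

attribute [instance] IsSuitableCategory.hasFiniteLimits IsSuitableCategory.hasFiniteCoproducts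

/-- A suitable monad: a cartesian monad that preserves colimits of nested sequences. -/
class IsSuitableMonad {E : Type u} [Category.{v} E] (T : Monad E) : Prop where
  /-- `T` preserves pullbacks. -/
  preservesPullbacks : PreservesLimitsOfShape WalkingCospan T.toFunctor
  /-- The naturality squares of the unit are pullbacks. -/
  isPullback_η : ∀ {A B : E} (f : A ⟶ B), IsPullback f (T.η.app A) (T.η.app B) (T.map f)
  /-- The naturality squares of the multiplication are pullbacks. -/
  isPullback_μ : ∀ {A B : E} (f : A ⟶ B),
    IsPullback (T.map (T.map f)) (T.μ.app A) (T.μ.app B) (T.map f)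
  /-- `T` preserves colimits of nested sequences. -/
  preservesColimit_nested : ∀ D : ℕ ⥤ E, IsNested D → PreservesColimit D T.toFunctor

variable {E : Type u} [Category.{v} E]

/-! ### The 1-cells and 2-cells of the bicategory of `T`-spans -/

/-- A `T`-span from `A` to `B`: a diagram `T A ⟵ X ⟶ B`. These are the 1-cells `A ⟶ B`. -/
structure TSpan (T : Monad E) (A B : E) where
  /-- the apex -/
  apex : E
  /-- the left leg -/
  dom : apex ⟶ T.obj A
  /-- the right leg -/
  cod : apex ⟶ B

namespace TSpan

variable {T : Monad E} {A B C D : E}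

/-- A 2-cell between `T`-spans: a map of apexes commuting with both legs. -/
@[ext]
structure Hom (P Q : TSpan T A B) where
  /-- the map of apexes -/
  map : P.apex ⟶ Q.apex
  map_dom : map ≫ Q.dom = P.dom
  map_cod : map ≫ Q.cod = P.cod

attribute [simp] Hom.map_dom Hom.map_cod

@[simp] lemma Hom.map_dom_assoc {P Q : TSpan T A B} (f : Hom P Q) {Z : E} (h : T.obj A ⟶ Z) :
    f.map ≫ Q.dom ≫ h = P.dom ≫ h := by
  rw [← Category.assoc, f.map_dom]

@[simp] lemma Hom.map_cod_assoc {P Q : TSpan T A B} (f : Hom P Q) {Z : E} (h : B ⟶ Z) :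
    f.map ≫ Q.cod ≫ h = P.cod ≫ h := by
  rw [← Category.assoc, f.map_cod]

instance : Category (TSpan T A B) where
  Hom := Hom
  id P := ⟨𝟙 P.apex, by simp, by simp⟩
  comp f g := ⟨f.map ≫ g.map, by simp, by simp⟩

@[simp] lemma id_map (P : TSpan T A B) : Hom.map (𝟙 P) = 𝟙 P.apex := rfl

@[simp] lemma comp_map {P Q R : TSpan T A B} (f : P ⟶ Q) (g : Q ⟶ R) :
    (f ≫ g).map = f.map ≫ g.map := rfl

@[ext] lemma hom_ext {P Q : TSpan T A B} {f g : P ⟶ Q} (h : f.map = g.map) : f = g :=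
  Hom.ext h

/-- The identity 1-cell `T A ⟵ A ⟶ A`, with legs the unit of `T` and the identity. -/
abbrev unit (T : Monad E) (A : E) : TSpan T A A where
  apex := A
  dom := T.η.app A
  cod := 𝟙 A

variable [HasPullbacks E]

/-- The composite 1-cell `Q ∘ P` of `P : A ⟶ B` and `Q : B ⟶ C`: its apex is the pullback of
`T P ⟶ T B ⟵ Q`, its left leg is `T P ⟶ T (T A) ⟶ T A` after the first projection, and its right
leg is `Q ⟶ C` after the second projection. -/
def of (Q : TSpan T B C) (P : TSpan T A B) : TSpan T A C where
  apex := pullback (T.map P.cod) Q.dom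
  dom := pullback.fst (T.map P.cod) Q.dom ≫ T.map P.dom ≫ T.μ.app A
  cod := pullback.snd (T.map P.cod) Q.dom ≫ Q.cod

/-- The first projection of the pullback `Q ∘ P`. -/
def fst (Q : TSpan T B C) (P : TSpan T A B) : (Q.of P).apex ⟶ T.obj P.apex :=
  pullback.fst (T.map P.cod) Q.dom

/-- The second projection of the pullback `Q ∘ P`. -/
def snd (Q : TSpan T B C) (P : TSpan T A B) : (Q.of P).apex ⟶ Q.apex :=
  pullback.snd (T.map P.cod) Q.dom

lemma isPullback_of (Q : TSpan T B C) (P : TSpan T A B) :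
    IsPullback (fst Q P) (snd Q P) (T.map P.cod) Q.dom :=
  IsPullback.of_hasPullback _ _

lemma fst_cod (Q : TSpan T B C) (P : TSpan T A B) :
    fst Q P ≫ T.map P.cod = snd Q P ≫ Q.dom :=
  pullback.condition

@[simp] lemma of_dom (Q : TSpan T B C) (P : TSpan T A B) :
    (Q.of P).dom = fst Q P ≫ T.map P.dom ≫ T.μ.app A := rfl

@[simp] lemma of_cod (Q : TSpan T B C) (P : TSpan T A B) :
    (Q.of P).cod = snd Q P ≫ Q.cod := rfl

/-- The map into the pullback `Q ∘ P` with given components. -/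
def lift (Q : TSpan T B C) (P : TSpan T A B) {W : E} (x : W ⟶ T.obj P.apex) (y : W ⟶ Q.apex)
    (h : x ≫ T.map P.cod = y ≫ Q.dom) : W ⟶ (Q.of P).apex :=
  pullback.lift x y h

@[simp] lemma lift_fst (Q : TSpan T B C) (P : TSpan T A B) {W : E} (x : W ⟶ T.obj P.apex)
    (y : W ⟶ Q.apex) (h : x ≫ T.map P.cod = y ≫ Q.dom) : lift Q P x y h ≫ fst Q P = x :=
  pullback.lift_fst _ _ _

@[simp] lemma lift_snd (Q : TSpan T B C) (P : TSpan T A B) {W : E} (x : W ⟶ T.obj P.apex)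
    (y : W ⟶ Q.apex) (h : x ≫ T.map P.cod = y ≫ Q.dom) : lift Q P x y h ≫ snd Q P = y :=
  pullback.lift_snd _ _ _

lemma of_hom_ext {Q : TSpan T B C} {P : TSpan T A B} {W : E} {x y : W ⟶ (Q.of P).apex}
    (h₁ : x ≫ fst Q P = y ≫ fst Q P) (h₂ : x ≫ snd Q P = y ≫ snd Q P) : x = y :=
  pullback.hom_ext h₁ h₂

/-- The horizontal composite `g * f : Q ∘ P ⟶ Q' ∘ P'` of 2-cells. -/
def hcomp {Q Q' : TSpan T B C} {P P' : TSpan T A B} (g : Q ⟶ Q') (f : P ⟶ P') :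
    Q.of P ⟶ Q'.of P' where
  map := lift Q' P' (fst Q P ≫ T.map f.map) (snd Q P ≫ g.map) (by
    simp [← Functor.map_comp, fst_cod])
  map_dom := by
    simp only [of_dom, reassoc_of% lift_fst, Category.assoc]
    simp only [← Functor.map_comp_assoc, Hom.map_dom]
  map_cod := by simp [reassoc_of% lift_snd]

/-- The associativity 2-cell `R ∘ (Q ∘ P) ⟶ (R ∘ Q) ∘ P`. It is invertible when `T` is
cartesian. -/
def assoc (R : TSpan T C D) (Q : TSpan T B C) (P : TSpan T A B) :
    R.of (Q.of P) ⟶ (R.of Q).of P where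
  map := lift (R.of Q) P
    (fst R (Q.of P) ≫ T.map (fst Q P) ≫ T.μ.app P.apex)
    (lift R Q (fst R (Q.of P) ≫ T.map (snd Q P)) (snd R (Q.of P)) (by
      simp only [Category.assoc, ← Functor.map_comp, ← of_cod, fst_cod]))
    (by
      have h : T.map (T.map P.cod) ≫ T.μ.app B = T.μ.app P.apex ≫ T.map P.cod :=
        T.μ.naturality P.cod
      simp only [of_dom, reassoc_of% lift_fst, Category.assoc, ← h]
      simp only [← Functor.map_comp_assoc, fst_cod])
  map_dom := by
    have h : T.map (T.map P.dom) ≫ T.μ.app (T.obj A) = T.μ.app P.apex ≫ T.map P.dom :=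
      T.μ.naturality P.dom
    simp only [of_dom, reassoc_of% lift_fst, Category.assoc, Functor.map_comp, T.assoc,
      reassoc_of% h]
  map_cod := by simp [reassoc_of% lift_snd]

/-- The unit 2-cell `P ⟶ 1 ∘ P`. It is invertible when `T` is cartesian. -/
def leftUnit (P : TSpan T A B) : P ⟶ (unit T B).of P where
  map := lift (unit T B) P (T.η.app P.apex) P.cod (T.η.naturality P.cod).symm
  map_dom := by
    have h : P.dom ≫ T.η.app (T.obj A) = T.η.app P.apex ≫ T.map P.dom := T.η.naturality P.dom
    simp [reassoc_of% lift_fst, ← reassoc_of% h]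
  map_cod := by
    rw [of_cod, reassoc_of% lift_snd]
    exact Category.comp_id P.cod

/-- The unit 2-cell `P ⟶ P ∘ 1`. It is always invertible. -/
def rightUnit (P : TSpan T A B) : P ⟶ P.of (unit T A) where
  map := lift P (unit T A) P.dom (𝟙 P.apex)
    ((congrArg (P.dom ≫ ·) (T.map_id A)).trans (by simp))
  map_dom := by
    rw [of_dom, reassoc_of% lift_fst]
    exact (congrArg (P.dom ≫ ·) (T.right_unit A)).trans (Category.comp_id P.dom)
  map_cod := by simp [reassoc_of% lift_snd]

end TSpan

/-! ### `T`-graphs -/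

/-- A `T`-graph: an object `X₀` with a `T`-span `T X₀ ⟵ X₁ ⟶ X₀`. -/
structure TGraph (T : Monad E) where
  /-- the object of objects -/
  obj : E
  /-- the span of arrows -/
  arr : TSpan T obj obj

namespace TGraph

variable {T : Monad E}

/-- A map of `T`-graphs. -/
@[ext]
structure Hom (X Y : TGraph T) where
  /-- the map on objects -/
  onObj : X.obj ⟶ Y.obj
  /-- the map on arrows -/
  onArr : X.arr.apex ⟶ Y.arr.apex
  onArr_dom : onArr ≫ Y.arr.dom = X.arr.dom ≫ T.map onObj
  onArr_cod : onArr ≫ Y.arr.cod = X.arr.cod ≫ onObj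

instance : Category (TGraph T) where
  Hom := Hom
  id X := ⟨𝟙 X.obj, 𝟙 X.arr.apex, by simp, by simp⟩
  comp f g := ⟨f.onObj ≫ g.onObj, f.onArr ≫ g.onArr,
    by simp [g.onArr_dom, reassoc_of% f.onArr_dom],
    by simp [g.onArr_cod, reassoc_of% f.onArr_cod]⟩

@[simp] lemma id_onObj (X : TGraph T) : Hom.onObj (𝟙 X) = 𝟙 X.obj := rfl
@[simp] lemma id_onArr (X : TGraph T) : Hom.onArr (𝟙 X) = 𝟙 X.arr.apex := rfl
@[simp] lemma comp_onObj {X Y Z : TGraph T} (f : X ⟶ Y) (g : Y ⟶ Z) :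
    (f ≫ g).onObj = f.onObj ≫ g.onObj := rfl
@[simp] lemma comp_onArr {X Y Z : TGraph T} (f : X ⟶ Y) (g : Y ⟶ Z) :
    (f ≫ g).onArr = f.onArr ≫ g.onArr := rfl

@[ext] lemma hom_ext {X Y : TGraph T} {f g : X ⟶ Y} (h₀ : f.onObj = g.onObj)
    (h₁ : f.onArr = g.onArr) : f = g :=
  Hom.ext h₀ h₁

/-- The map `X₁ ∘ X₁ ⟶ Y₁ ∘ Y₁` induced by a map `X ⟶ Y` of `T`-graphs. -/
def onPairs [HasPullbacks E] {X Y : TGraph T} (f : X ⟶ Y) :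
    (X.arr.of X.arr).apex ⟶ (Y.arr.of Y.arr).apex :=
  TSpan.lift Y.arr Y.arr (TSpan.fst X.arr X.arr ≫ T.map f.onArr)
    (TSpan.snd X.arr X.arr ≫ f.onArr) (by
      simp only [Category.assoc, ← Functor.map_comp, f.onArr_cod, f.onArr_dom]
      rw [Functor.map_comp, reassoc_of% TSpan.fst_cod])

@[simp] lemma onPairs_fst [HasPullbacks E] {X Y : TGraph T} (f : X ⟶ Y) :
    onPairs f ≫ TSpan.fst Y.arr Y.arr = TSpan.fst X.arr X.arr ≫ T.map f.onArr :=
  TSpan.lift_fst _ _ _ _ _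

@[simp] lemma onPairs_snd [HasPullbacks E] {X Y : TGraph T} (f : X ⟶ Y) :
    onPairs f ≫ TSpan.snd Y.arr Y.arr = TSpan.snd X.arr X.arr ≫ f.onArr :=
  TSpan.lift_snd _ _ _ _ _

end TGraph

/-! ### `T`-multicategories -/

/-- A `T`-multicategory: a monad in the bicategory of `T`-spans, that is, a `T`-graph `C` with
2-cells `ids : 1 ⟶ C₁` and `comp : C₁ ∘ C₁ ⟶ C₁` satisfying the associativity and unit laws. -/
structure TMulticategory (T : Monad E) [HasPullbacks E] extends TGraph T where
  /-- composition -/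
  comp : arr.of arr ⟶ arr
  /-- identities -/
  ids : TSpan.unit T obj ⟶ arr
  assoc : TSpan.hcomp (𝟙 arr) comp ≫ comp =
    TSpan.assoc arr arr arr ≫ TSpan.hcomp comp (𝟙 arr) ≫ comp
  ids_comp : TSpan.leftUnit arr ≫ TSpan.hcomp ids (𝟙 arr) ≫ comp = 𝟙 arr
  comp_ids : TSpan.rightUnit arr ≫ TSpan.hcomp (𝟙 arr) ids ≫ comp = 𝟙 arr

namespace TMulticategory

variable {T : Monad E} [HasPullbacks E]

/-- A map of `T`-multicategories: a map of `T`-graphs preserving identities and composition. -/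
@[ext]
structure Hom (C D : TMulticategory T) where
  /-- the underlying map of `T`-graphs -/
  toGraphHom : C.toTGraph ⟶ D.toTGraph
  map_ids : C.ids.map ≫ toGraphHom.onArr = toGraphHom.onObj ≫ D.ids.map
  map_comp : C.comp.map ≫ toGraphHom.onArr = TGraph.onPairs toGraphHom ≫ D.comp.map

instance : Category (TMulticategory T) where
  Hom := Hom
  id C := ⟨𝟙 C.toTGraph,
    (Category.comp_id C.ids.map).trans (Category.id_comp C.ids.map).symm, by
    have h : TGraph.onPairs (𝟙 C.toTGraph) = 𝟙 _ := by
      apply TSpan.of_hom_ext <;> simp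
    rw [h]
    exact (Category.comp_id _).trans (Category.id_comp _).symm⟩
  comp {C D K} f g := ⟨f.toGraphHom ≫ g.toGraphHom, by
      rw [TGraph.comp_onArr, reassoc_of% f.map_ids, g.map_ids, TGraph.comp_onObj]
      exact (Category.assoc _ _ _).symm, by
      have h : TGraph.onPairs (f.toGraphHom ≫ g.toGraphHom) =
          TGraph.onPairs f.toGraphHom ≫ TGraph.onPairs g.toGraphHom := by
        apply TSpan.of_hom_ext
        · simp [reassoc_of% TGraph.onPairs_fst]
        · simp [reassoc_of% TGraph.onPairs_snd]
      rw [h, TGraph.comp_onArr, reassoc_of% f.map_comp, g.map_comp, Category.assoc]⟩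

/-- The forgetful functor from `T`-multicategories to `T`-graphs. -/
@[simps] def forget (T : Monad E) : TMulticategory T ⥤ TGraph T where
  obj C := C.toTGraph
  map f := f.toGraphHom

end TMulticategory

end

variable {E : Type u} [Category.{v} E]

/-! ### Extensivity and nested colimits in a suitable category -/

section BinaryCoproduct

variable {Y₁ Y₂ Y Z : E} {j₁ : Y₁ ⟶ Y} {j₂ : Y₂ ⟶ Y} (h : IsColimit (BinaryCofan.mk j₁ j₂))

/-- The copairing of two maps out of a binary coproduct given by its coprojections. -/
def copair (a : Y₁ ⟶ Z) (b : Y₂ ⟶ Z) : Y ⟶ Z := h.desc (BinaryCofan.mk a b)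

@[simp]
lemma inl_copair (a : Y₁ ⟶ Z) (b : Y₂ ⟶ Z) : j₁ ≫ copair h a b = a :=
  h.fac (BinaryCofan.mk a b) ⟨.left⟩

@[simp]
lemma inr_copair (a : Y₁ ⟶ Z) (b : Y₂ ⟶ Z) : j₂ ≫ copair h a b = b :=
  h.fac (BinaryCofan.mk a b) ⟨.right⟩

include h in
lemma copair_hom_ext {a b : Y ⟶ Z} (h₁ : j₁ ≫ a = j₁ ≫ b) (h₂ : j₂ ≫ a = j₂ ≫ b) : a = b :=
  BinaryCofan.IsColimit.hom_ext h h₁ h₂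

end BinaryCoproduct

lemma isNested_const (X : E) : IsNested ((Functor.const ℕ).obj X) :=
  fun _ _ _ => inferInstanceAs (Mono (𝟙 X))

namespace IsSuitableCategory

variable [IsSuitableCategory E]

/-- Stability is applied to `0 = 0 + 0` with identity coprojections. Pulling back along `A ⟶ 0`
exhibits `A` as `A + A` with identity coprojections, so parallel maps out of `A` are equal and `A`
is initial. -/
instance hasStrictInitialObjects : HasStrictInitialObjects E :=
  hasStrictInitial_of_isUniversal <| stable WalkingPair _ _ <|
    ((BinaryCofan.isColimit_iff_isIso_inr initialIsInitial _).mpr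
      (inferInstanceAs (IsIso (𝟙 (⊥_ E))))).some

lemma isColimit_binaryCofan_of_isPullback {X₁ X₂ X Y₁ Y₂ Y : E} {i₁ : X₁ ⟶ X} {i₂ : X₂ ⟶ X}
    {f₁ : X₁ ⟶ Y₁} {f₂ : X₂ ⟶ Y₂} {f : X ⟶ Y} {j₁ : Y₁ ⟶ Y} {j₂ : Y₂ ⟶ Y}
    (h : IsColimit (BinaryCofan.mk j₁ j₂))
    (h₁ : IsPullback i₁ f₁ f j₁) (h₂ : IsPullback i₂ f₂ f j₂) :
    Nonempty (IsColimit (BinaryCofan.mk i₁ i₂)) := by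
  refine stable WalkingPair _ _ h (BinaryCofan.mk i₁ i₂) (mapPair f₁ f₂) f ?_
    (.of_discrete _) ?_
  · ext ⟨⟨⟩⟩
    · exact h₁.w.symm
    · exact h₂.w.symm
  · rintro ⟨⟨⟩⟩
    · exact h₁
    · exact h₂

lemma isPullback_initial {Y₁ Y₂ Y : E} {j₁ : Y₁ ⟶ Y} {j₂ : Y₂ ⟶ Y}
    (h : IsColimit (BinaryCofan.mk j₁ j₂)) :
    IsPullback (initial.to Y₁) (initial.to Y₂) j₁ j₂ := by
  let e : Y ≅ Y₁ ⨿ Y₂ :=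
    h.coconePointUniqueUpToIso (colimit.isColimit (pair Y₁ Y₂))
  have h₁ : j₁ ≫ e.hom = coprod.inl :=
    h.comp_coconePointUniqueUpToIso_hom (colimit.isColimit (pair Y₁ Y₂)) ⟨WalkingPair.left⟩
  have h₂ : j₂ ≫ e.hom = coprod.inr :=
    h.comp_coconePointUniqueUpToIso_hom (colimit.isColimit (pair Y₁ Y₂)) ⟨WalkingPair.right⟩
  exact (disjoint Y₁ Y₂).of_iso (Iso.refl _) (Iso.refl _) (Iso.refl _) e.symm
    (by simp) (by simp) (by simp [← h₁]) (by simp [← h₂])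

lemma mono_inl {Y₁ Y₂ Y : E} {j₁ : Y₁ ⟶ Y} {j₂ : Y₂ ⟶ Y}
    (h : IsColimit (BinaryCofan.mk j₁ j₂)) : Mono j₁ := by
  let X : WalkingPair → E := fun j => WalkingPair.casesOn j Y₁ Y₂
  have hm := mono_coprojection WalkingPair X .left
  let s : Y ⟶ ∐ X := h.desc (BinaryCofan.mk (Sigma.ι X .left) (Sigma.ι X .right))
  have h₁ : j₁ ≫ s = Sigma.ι X .left :=
    h.fac (BinaryCofan.mk (Sigma.ι X .left) (Sigma.ι X .right)) ⟨.left⟩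
  exact mono_of_mono_fac h₁

/-- Decompose the pullback of `Y₁` along `f` according to `X = X₁ + X₂`. Its part over `X₁` is `X₁`,
since `j₁` is monic; its part over `X₂` maps to both `Y₁` and `Y₂` compatibly, so it is initial by
disjointness and strictness. Hence the comparison from `X₁` is invertible. -/
lemma isPullback_inl {X₁ X₂ X Y₁ Y₂ Y : E} {i₁ : X₁ ⟶ X} {i₂ : X₂ ⟶ X}
    {f₁ : X₁ ⟶ Y₁} {f₂ : X₂ ⟶ Y₂} {f : X ⟶ Y} {j₁ : Y₁ ⟶ Y} {j₂ : Y₂ ⟶ Y}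
    (hX : IsColimit (BinaryCofan.mk i₁ i₂)) (hY : IsColimit (BinaryCofan.mk j₁ j₂))
    (h₁ : i₁ ≫ f = f₁ ≫ j₁) (h₂ : i₂ ≫ f = f₂ ≫ j₂) : IsPullback i₁ f₁ f j₁ := by
  have hm := mono_inl hY
  let e : X₁ ⟶ pullback f j₁ := pullback.lift i₁ f₁ h₁
  have e₁ : e ≫ pullback.fst f j₁ = i₁ := pullback.lift_fst _ _ _
  have e₂ : e ≫ pullback.snd f j₁ = f₁ := pullback.lift_snd _ _ _
  have p₁ : IsPullback e (𝟙 X₁) (pullback.fst f j₁) i₁ := by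
    refine ⟨⟨by rw [e₁, Category.id_comp]⟩, ⟨PullbackCone.IsLimit.mk _ (fun s => s.snd) (fun s => ?_)
      (fun s => by simp) (fun s m _ h => by simpa using h)⟩⟩
    apply pullback.hom_ext
    · rw [Category.assoc, e₁, s.condition]
    · rw [← cancel_mono j₁, Category.assoc, Category.assoc, Category.assoc, ← pullback.condition,
        reassoc_of% e₁, reassoc_of% s.condition]
  have p₂ : IsPullback (initial.to _) (initial.to _) (pullback.fst f j₁) i₂ := by
    refine IsPullback.mk ⟨initial.hom_ext _ _⟩ ⟨PullbackCone.IsLimit.mk _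
      (fun s => (isPullback_initial hY).lift (s.fst ≫ pullback.snd f j₁) (s.snd ≫ f₂) ?_)
      (fun s => ?_) (fun s => ?_) (fun s m _ _ => ?_)⟩
    · rw [Category.assoc, ← pullback.condition, reassoc_of% s.condition, h₂, Category.assoc]
    all_goals
      have hs := initialIsInitial.isIso_to
        ((isPullback_initial hY).lift (s.fst ≫ pullback.snd f j₁) (s.snd ≫ f₂) (by
          rw [Category.assoc, ← pullback.condition, reassoc_of% s.condition, h₂, Category.assoc]))
      exact (initialIsInitial.ofIso (asIso ((isPullback_initial hY).lift
        (s.fst ≫ pullback.snd f j₁) (s.snd ≫ f₂) _)).symm).hom_ext _ _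
  have he : IsIso e := (BinaryCofan.isColimit_iff_isIso_inl initialIsInitial _).mp
    (isColimit_binaryCofan_of_isPullback hX p₁ p₂)
  exact (IsPullback.of_hasPullback f j₁).of_iso (asIso e).symm (Iso.refl _) (Iso.refl _)
    (Iso.refl _) (by simp [← e₁]) (by simp [← e₂]) (by simp) (by simp)

lemma isPullback_inr {X₁ X₂ X Y₁ Y₂ Y : E} {i₁ : X₁ ⟶ X} {i₂ : X₂ ⟶ X}
    {f₁ : X₁ ⟶ Y₁} {f₂ : X₂ ⟶ Y₂} {f : X ⟶ Y} {j₁ : Y₁ ⟶ Y} {j₂ : Y₂ ⟶ Y}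
    (hX : IsColimit (BinaryCofan.mk i₁ i₂)) (hY : IsColimit (BinaryCofan.mk j₁ j₂))
    (h₁ : i₁ ≫ f = f₁ ≫ j₁) (h₂ : i₂ ≫ f = f₂ ≫ j₂) : IsPullback i₂ f₂ f j₂ :=
  isPullback_inl (BinaryCofan.isColimitFlip hX) (BinaryCofan.isColimitFlip hY) h₂ h₁

/-- A map between coproducts induced by monomorphisms on the summands is a monomorphism. -/
lemma mono_of_isColimit_binaryCofan {X₁ X₂ X Y₁ Y₂ Y : E} {i₁ : X₁ ⟶ X} {i₂ : X₂ ⟶ X}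
    {f₁ : X₁ ⟶ Y₁} {f₂ : X₂ ⟶ Y₂} {f : X ⟶ Y} {j₁ : Y₁ ⟶ Y} {j₂ : Y₂ ⟶ Y}
    (hX : IsColimit (BinaryCofan.mk i₁ i₂)) (hY : IsColimit (BinaryCofan.mk j₁ j₂))
    (h₁ : i₁ ≫ f = f₁ ≫ j₁) (h₂ : i₂ ≫ f = f₂ ≫ j₂) [Mono f₁] [Mono f₂] : Mono f := by
  have p₁ := isPullback_inl hX hY h₁ h₂
  have p₂ := isPullback_inr hX hY h₁ h₂
  refine ⟨fun {S} x y hxy => ?_⟩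
  -- The test object is split along `x`. On the part over `X₁` the map `y` also lands in `X₁`,
  -- because `y ≫ f = x ≫ f` lands in `Y₁` and the square `p₁` is a pullback; there `f₁` can be
  -- cancelled. The other part is symmetric.
  obtain ⟨hS⟩ := isColimit_binaryCofan_of_isPullback hX (IsPullback.of_hasPullback x i₁)
    (IsPullback.of_hasPullback x i₂)
  apply BinaryCofan.IsColimit.hom_ext hS
  · have w : (pullback.fst x i₁ ≫ y) ≫ f = (pullback.snd x i₁ ≫ f₁) ≫ j₁ := by
      rw [Category.assoc, ← hxy, pullback.condition_assoc, h₁, Category.assoc]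
    have e : p₁.lift _ _ w = pullback.snd x i₁ := by
      rw [← cancel_mono f₁, p₁.lift_snd]
    exact pullback.condition.trans ((congrArg (· ≫ i₁) e).symm.trans (p₁.lift_fst _ _ w))
  · have w : (pullback.fst x i₂ ≫ y) ≫ f = (pullback.snd x i₂ ≫ f₂) ≫ j₂ := by
      rw [Category.assoc, ← hxy, pullback.condition_assoc, h₂, Category.assoc]
    have e : p₂.lift _ _ w = pullback.snd x i₂ := by
      rw [← cancel_mono f₂, p₂.lift_snd]
    exact pullback.condition.trans ((congrArg (· ≫ i₂) e).symm.trans (p₂.lift_fst _ _ w))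

/-- The criterion by which a cocone on a pullback of nested sequences is recognised as a
colimit. -/
lemma nonempty_isColimit_of_isPullback {P A B C : ℕ ⥤ E} {p : P ⟶ A} {q : P ⟶ B} {f : A ⟶ C}
    {g : B ⟶ C} (hAn : IsNested A) (hBn : IsNested B) (hCn : IsNested C)
    (hpb : ∀ n, IsPullback (p.app n) (q.app n) (f.app n) (g.app n))
    {cP : Cocone P} {cA : Cocone A} {cB : Cocone B} {cC : Cocone C}
    (hA : IsColimit cA) (hB : IsColimit cB) (hC : IsColimit cC)
    {p' : cP.pt ⟶ cA.pt} {q' : cP.pt ⟶ cB.pt} {f' : cA.pt ⟶ cC.pt} {g' : cB.pt ⟶ cC.pt}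
    (h : IsPullback p' q' f' g')
    (hp : ∀ n, cP.ι.app n ≫ p' = p.app n ≫ cA.ι.app n)
    (hq : ∀ n, cP.ι.app n ≫ q' = q.app n ≫ cB.ι.app n)
    (hf : ∀ n, cA.ι.app n ≫ f' = f.app n ≫ cC.ι.app n)
    (hg : ∀ n, cB.ι.app n ≫ g' = g.app n ≫ cC.ι.app n) : Nonempty (IsColimit cP) := by
  have hPn : IsNested P := fun m n k => by
    have := hAn k
    have := hBn k
    refine ⟨fun x y hxy => (hpb m).hom_ext ?_ ?_⟩
    · rw [← cancel_mono (A.map k)]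
      simpa using hxy =≫ p.app n
    · rw [← cancel_mono (B.map k)]
      simpa using hxy =≫ q.app n
  have := hasColimit_nested P hPn
  have key := isPullback_colimit_nested p q f g hAn hBn hCn
    (IsPullback.of_forall_isPullback_app hpb) _ cA cB cC (colimit.isColimit P) hA hB hC
  have ef : hA.map cC f = f' := hA.hom_ext fun n => by simp [hf]
  have eg : hB.map cC g = g' := hB.hom_ext fun n => by simp [hg]
  rw [ef, eg] at key
  have e₁ : colimit.desc P cP ≫ p' = (colimit.isColimit P).map cA p :=
    (colimit.isColimit P).hom_ext fun n => by
      rw [IsColimit.ι_map, ← hp]; exact colimit.ι_desc_assoc _ _ _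
  have e₂ : colimit.desc P cP ≫ q' = (colimit.isColimit P).map cB q :=
    (colimit.isColimit P).hom_ext fun n => by
      rw [IsColimit.ι_map, ← hq]; exact colimit.ι_desc_assoc _ _ _
  -- Both `colimit P` and `cP.pt` are pullbacks of the same cospan, and the comparison is compatible
  -- with the projections.
  have : IsIso (colimit.desc P cP) := by
    have : colimit.desc P cP = (key.isoIsPullback _ _ h).hom :=
      h.hom_ext (by simp [e₁]) (by simp [e₂])
    rw [this]
    infer_instance
  exact ⟨IsColimit.ofPointIso (colimit.isColimit P) (i := this)⟩

/-- Colimits of nested sequences are stable under pullback. -/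
lemma nonempty_isColimit_of_isPullback_const {D D' : ℕ ⥤ E} (hD : IsNested D) {c : Cocone D}
    (hc : IsColimit c) {c' : Cocone D'} (α : D' ⟶ D) (f : c'.pt ⟶ c.pt)
    (h : ∀ n, IsPullback (c'.ι.app n) (α.app n) f (c.ι.app n)) : Nonempty (IsColimit c') := by
  -- `D'` is the levelwise pullback of `D` and a constant sequence over a constant sequence;
  -- constant sequences are nested and have the evident colimits.
  exact nonempty_isColimit_of_isPullback (p := c'.ι) (q := α)
    (f := (Functor.const ℕ).map f) (g := c.ι) (isNested_const _) hD (isNested_const _) h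
    (isColimitConstCocone ℕ _) hc (isColimitConstCocone ℕ _) (p' := 𝟙 _) (q' := f) (f' := f)
    (g' := 𝟙 _) IsPullback.of_id_fst (fun n => rfl) (fun n => (h n).w)
    (fun n => (Category.id_comp _).trans (Category.comp_id _).symm) (fun n => rfl)

end IsSuitableCategory

/-! ### Labelled arrows of a graph: the construction `act` -/

noncomputable section

variable {T : Monad E}

namespace TGraph

section Basic

variable [HasPullbacks E]

/-- The object of pairs consisting of a family of elements of `W`, indexed by the domain of an
arrow of `X`, and that arrow. -/
def act (X : TGraph T) {W : E} (w : W ⟶ X.obj) : E := pullback (T.map w) X.arr.dom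

variable (X : TGraph T) {W : E} (w : W ⟶ X.obj)

/-- The first projection of `X.act w`. -/
def actFst : X.act w ⟶ T.obj W := pullback.fst (T.map w) X.arr.dom

/-- The second projection of `X.act w`. -/
def actSnd : X.act w ⟶ X.arr.apex := pullback.snd (T.map w) X.arr.dom

lemma isPullback_actFst_actSnd : IsPullback (X.actFst w) (X.actSnd w) (T.map w) X.arr.dom :=
  IsPullback.of_hasPullback _ _

lemma act_condition : X.actFst w ≫ T.map w = X.actSnd w ≫ X.arr.dom := pullback.condition

lemma act_condition_assoc {S : E} (h : T.obj X.obj ⟶ S) :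
    X.actFst w ≫ T.map w ≫ h = X.actSnd w ≫ X.arr.dom ≫ h := pullback.condition_assoc _

variable {X w}

lemma act_hom_ext {S : E} {a b : S ⟶ X.act w} (h₁ : a ≫ X.actFst w = b ≫ X.actFst w)
    (h₂ : a ≫ X.actSnd w = b ≫ X.actSnd w) : a = b :=
  pullback.hom_ext h₁ h₂

/-- The map into `X.act w` with given components. -/
def actLift {S : E} (x : S ⟶ T.obj W) (y : S ⟶ X.arr.apex) (h : x ≫ T.map w = y ≫ X.arr.dom) :
    S ⟶ X.act w :=
  pullback.lift x y h

@[simp]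
lemma actLift_actFst {S : E} (x : S ⟶ T.obj W) (y : S ⟶ X.arr.apex)
    (h : x ≫ T.map w = y ≫ X.arr.dom) : actLift x y h ≫ X.actFst w = x :=
  pullback.lift_fst _ _ _

@[simp]
lemma actLift_actFst_assoc {S : E} (x : S ⟶ T.obj W) (y : S ⟶ X.arr.apex)
    (h : x ≫ T.map w = y ≫ X.arr.dom) {R : E} (k : T.obj W ⟶ R) :
    actLift x y h ≫ X.actFst w ≫ k = x ≫ k :=
  pullback.lift_fst_assoc _ _ _ _

@[simp]
lemma actLift_actSnd {S : E} (x : S ⟶ T.obj W) (y : S ⟶ X.arr.apex)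
    (h : x ≫ T.map w = y ≫ X.arr.dom) : actLift x y h ≫ X.actSnd w = y :=
  pullback.lift_snd _ _ _

@[simp]
lemma actLift_actSnd_assoc {S : E} (x : S ⟶ T.obj W) (y : S ⟶ X.arr.apex)
    (h : x ≫ T.map w = y ≫ X.arr.dom) {R : E} (k : X.arr.apex ⟶ R) :
    actLift x y h ≫ X.actSnd w ≫ k = y ≫ k :=
  pullback.lift_snd_assoc _ _ _ _

/-- The functoriality of `act`. -/
def actMap {X Y : TGraph T} (f : X ⟶ Y) {W Z : E} {w : W ⟶ X.obj} {z : Z ⟶ Y.obj} (h : W ⟶ Z)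
    (hh : h ≫ z = w ≫ f.onObj) : X.act w ⟶ Y.act z :=
  actLift (X.actFst w ≫ T.map h) (X.actSnd w ≫ f.onArr) (by
    rw [Category.assoc, Category.assoc, ← T.map_comp, hh, f.onArr_dom, T.map_comp,
      act_condition_assoc])

@[simp]
lemma actMap_actFst {X Y : TGraph T} (f : X ⟶ Y) {W Z : E} {w : W ⟶ X.obj} {z : Z ⟶ Y.obj}
    (h : W ⟶ Z) (hh : h ≫ z = w ≫ f.onObj) :
    actMap f h hh ≫ Y.actFst z = X.actFst w ≫ T.map h :=
  actLift_actFst _ _ _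

@[simp]
lemma actMap_actFst_assoc {X Y : TGraph T} (f : X ⟶ Y) {W Z : E} {w : W ⟶ X.obj} {z : Z ⟶ Y.obj}
    (h : W ⟶ Z) (hh : h ≫ z = w ≫ f.onObj) {R : E} (k : T.obj Z ⟶ R) :
    actMap f h hh ≫ Y.actFst z ≫ k = X.actFst w ≫ T.map h ≫ k := by
  rw [← Category.assoc, actMap_actFst, Category.assoc]

@[simp]
lemma actMap_actSnd {X Y : TGraph T} (f : X ⟶ Y) {W Z : E} {w : W ⟶ X.obj} {z : Z ⟶ Y.obj}
    (h : W ⟶ Z) (hh : h ≫ z = w ≫ f.onObj) :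
    actMap f h hh ≫ Y.actSnd z = X.actSnd w ≫ f.onArr :=
  actLift_actSnd _ _ _

@[simp]
lemma actMap_actSnd_assoc {X Y : TGraph T} (f : X ⟶ Y) {W Z : E} {w : W ⟶ X.obj} {z : Z ⟶ Y.obj}
    (h : W ⟶ Z) (hh : h ≫ z = w ≫ f.onObj) {R : E} (k : Y.arr.apex ⟶ R) :
    actMap f h hh ≫ Y.actSnd z ≫ k = X.actSnd w ≫ f.onArr ≫ k := by
  rw [← Category.assoc, actMap_actSnd, Category.assoc]

lemma actMap_id {X : TGraph T} {W : E} {w : W ⟶ X.obj} (h : 𝟙 W ≫ w = w ≫ Hom.onObj (𝟙 X)) :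
    actMap (𝟙 X) (𝟙 W) h = 𝟙 _ := by
  apply act_hom_ext <;> simp

lemma actMap_comp {X Y Z : TGraph T} (f : X ⟶ Y) (g : Y ⟶ Z) {W V U : E} {w : W ⟶ X.obj}
    {v : V ⟶ Y.obj} {u : U ⟶ Z.obj} (h : W ⟶ V) (k : V ⟶ U) (hh : h ≫ v = w ≫ f.onObj)
    (hk : k ≫ u = v ≫ g.onObj) :
    actMap f h hh ≫ actMap g k hk =
      actMap (f ≫ g) (h ≫ k) (by rw [Category.assoc, hk, reassoc_of% hh, comp_onObj]) := by
  apply act_hom_ext <;> simp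

lemma actMap_comp_assoc {X Y Z : TGraph T} (f : X ⟶ Y) (g : Y ⟶ Z) {W V U : E} {w : W ⟶ X.obj}
    {v : V ⟶ Y.obj} {u : U ⟶ Z.obj} (h : W ⟶ V) (k : V ⟶ U) (hh : h ≫ v = w ≫ f.onObj)
    (hk : k ≫ u = v ≫ g.onObj) {R : E} (l : Z.act u ⟶ R) :
    actMap f h hh ≫ actMap g k hk ≫ l =
      actMap (f ≫ g) (h ≫ k) (by rw [Category.assoc, hk, reassoc_of% hh, comp_onObj]) ≫ l := by
  rw [← Category.assoc, actMap_comp]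

/-- A square of objects and a commutative square of `T`-graphs which are (componentwise)
pullbacks induce a pullback square. -/
lemma isPullback_actMap [PreservesLimitsOfShape WalkingCospan T.toFunctor] {X Y Z V : TGraph T}
    {f : X ⟶ Y} {g : X ⟶ Z} {h : Y ⟶ V} {k : Z ⟶ V}
    (h₀ : IsPullback f.onObj g.onObj h.onObj k.onObj)
    (h₁ : IsPullback f.onArr g.onArr h.onArr k.onArr)
    {WX WY WZ WV : E} {wX : WX ⟶ X.obj} {wY : WY ⟶ Y.obj} {wZ : WZ ⟶ Z.obj} {wV : WV ⟶ V.obj}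
    {f' : WX ⟶ WY} {g' : WX ⟶ WZ} {h' : WY ⟶ WV} {k' : WZ ⟶ WV} (sq : IsPullback f' g' h' k')
    (hf : f' ≫ wY = wX ≫ f.onObj) (hg : g' ≫ wZ = wX ≫ g.onObj)
    (hh : h' ≫ wV = wY ≫ h.onObj) (hk : k' ≫ wV = wZ ≫ k.onObj) :
    IsPullback (actMap f f' hf) (actMap g g' hg) (actMap h h' hh) (actMap k k' hk) := by
  have t := sq.map T.toFunctor
  have t₀ := h₀.map T.toFunctor
  refine IsPullback.mk ⟨?_⟩ ⟨PullbackCone.IsLimit.mk _ (fun s => actLift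
    (t.lift (s.fst ≫ Y.actFst wY) (s.snd ≫ Z.actFst wZ) ?_)
    (h₁.lift (s.fst ≫ Y.actSnd wY) (s.snd ≫ Z.actSnd wZ) ?_) ?_) ?_ ?_ ?_⟩
  · apply act_hom_ext
    · simp only [Category.assoc, actMap_actFst, actMap_actFst_assoc, ← T.map_comp, sq.w]
    · simp only [Category.assoc, actMap_actSnd, actMap_actSnd_assoc, h₁.w]
  · simpa using s.condition =≫ V.actFst wV
  · simpa using s.condition =≫ V.actSnd wV
  · apply t₀.hom_ext
    · simp only [Category.assoc, ← T.map_comp, ← hf, ← f.onArr_dom]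
      rw [T.map_comp, t.lift_fst_assoc, h₁.lift_fst_assoc, Category.assoc, act_condition,
        Category.assoc]
    · simp only [Category.assoc, ← T.map_comp, ← hg, ← g.onArr_dom]
      rw [T.map_comp, t.lift_snd_assoc, h₁.lift_snd_assoc, Category.assoc, act_condition,
        Category.assoc]
  · intro s
    apply act_hom_ext
    · simp
    · simp
  · intro s
    apply act_hom_ext
    · simp
    · simp
  · intro s m hm₁ hm₂
    apply act_hom_ext
    · rw [actLift_actFst]
      apply t.hom_ext
      · rw [t.lift_fst, ← hm₁]
        simp
      · rw [t.lift_snd, ← hm₂]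
        simp
    · rw [actLift_actSnd]
      apply h₁.hom_ext
      · rw [h₁.lift_fst, ← hm₁]
        simp
      · rw [h₁.lift_snd, ← hm₂]
        simp

/-- Preserving pullbacks, `T` preserves monomorphisms, so each of the two components can be
cancelled separately. -/
lemma mono_actMap [PreservesLimitsOfShape WalkingCospan T.toFunctor] {X Y : TGraph T} (f : X ⟶ Y)
    {W Z : E} {w : W ⟶ X.obj} {z : Z ⟶ Y.obj} (h : W ⟶ Z) (hh : h ≫ z = w ≫ f.onObj)
    [Mono h] [Mono f.onArr] : Mono (actMap f h hh) := by
  refine ⟨fun a b hab => act_hom_ext ?_ ?_⟩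
  · rw [← cancel_mono (T.map h)]
    simpa using hab =≫ Y.actFst z
  · rw [← cancel_mono f.onArr]
    simpa using hab =≫ Y.actSnd z

end Basic

/-- The object of objects of a `T`-graph. -/
@[simps]
def objFunctor (T : Monad E) : TGraph T ⥤ E where
  obj X := X.obj
  map f := f.onObj

/-- The object of arrows of a `T`-graph. -/
@[simps]
def arrFunctor (T : Monad E) : TGraph T ⥤ E where
  obj X := X.arr.apex
  map f := f.onArr

section Diagram

variable [HasPullbacks E] {J : Type*} [Category* J]

/-- The diagram of the objects `(D.obj j).act (w j)`. -/
@[simps]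
def actDiagram (D : J ⥤ TGraph T) (W : J ⥤ E) (w : ∀ j, W.obj j ⟶ (D.obj j).obj)
    (hw : ∀ {i j : J} (k : i ⟶ j), W.map k ≫ w j = w i ≫ (D.map k).onObj) : J ⥤ E where
  obj j := (D.obj j).act (w j)
  map k := actMap (D.map k) (W.map k) (hw k)
  map_id j := by
    apply act_hom_ext <;> simp
  map_comp k l := by
    apply act_hom_ext <;> simp

/-- The cocone on `actDiagram` induced by cocones on its constituents. -/
@[simps]
def actCocone {D : J ⥤ TGraph T} {W : J ⥤ E} {w : ∀ j, W.obj j ⟶ (D.obj j).obj}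
    (hw : ∀ {i j : J} (k : i ⟶ j), W.map k ≫ w j = w i ≫ (D.map k).onObj) (cD : Cocone D)
    (cW : Cocone W) (v : cW.pt ⟶ cD.pt.obj)
    (hv : ∀ j, cW.ι.app j ≫ v = w j ≫ (cD.ι.app j).onObj) : Cocone (actDiagram D W w hw) where
  pt := cD.pt.act v
  ι :=
    { app := fun j => actMap (cD.ι.app j) (cW.ι.app j) (hv j)
      naturality := fun i j k => by
        refine (actMap_comp (D.map k) (cD.ι.app j) (W.map k) (cW.ι.app j) (hw k) (hv j)).trans
            (Eq.trans ?_ (Category.comp_id _).symm)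
        congr 1
        · exact cD.w k
        · exact cW.w k }

end Diagram

/-- `act` preserves colimits of nested sequences. -/
lemma nonempty_isColimit_actCocone [IsSuitableCategory E] [IsSuitableMonad T]
    {D : ℕ ⥤ TGraph T} {W : ℕ ⥤ E} {w : ∀ j, W.obj j ⟶ (D.obj j).obj}
    (hw : ∀ {i j : ℕ} (k : i ⟶ j), W.map k ≫ w j = w i ≫ (D.map k).onObj) {cD : Cocone D}
    {cW : Cocone W} (v : cW.pt ⟶ cD.pt.obj)
    (hv : ∀ j, cW.ι.app j ≫ v = w j ≫ (cD.ι.app j).onObj)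
    (hW : IsNested W) (hD₀ : IsNested (D ⋙ objFunctor T)) (hD₁ : IsNested (D ⋙ arrFunctor T))
    (hcW : IsColimit cW) (hc₀ : IsColimit ((objFunctor T).mapCocone cD))
    (hc₁ : IsColimit ((arrFunctor T).mapCocone cD)) :
    Nonempty (IsColimit (actCocone hw cD cW v hv)) := by
  have := IsSuitableMonad.preservesPullbacks (T := T)
  have := IsSuitableMonad.preservesColimit_nested (T := T) W hW
  have := IsSuitableMonad.preservesColimit_nested (T := T) _ hD₀
  have hT {F : ℕ ⥤ E} (hF : IsNested F) : IsNested (F ⋙ T.toFunctor) := fun _ _ k => by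
    have := hF k
    exact inferInstanceAs (Mono (T.map (F.map k)))
  -- Levelwise, `act` is the pullback of `T W ⟶ T D₀ ⟵ D₁`. The three sequences are nested and `T`
  -- preserves the colimits of `W` and `D₀`.
  refine IsSuitableCategory.nonempty_isColimit_of_isPullback
    (A := W ⋙ T.toFunctor) (B := D ⋙ arrFunctor T) (C := (D ⋙ objFunctor T) ⋙ T.toFunctor)
    (p := { app := fun j => (D.obj j).actFst (w j),
            naturality := fun _ _ k => actMap_actFst _ _ (hw k) })
    (q := { app := fun j => (D.obj j).actSnd (w j),
            naturality := fun _ _ k => actMap_actSnd _ _ (hw k) })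
    (f := Functor.whiskerRight (G := W) (H := D ⋙ objFunctor T)
      { app := w, naturality := fun _ _ k => hw k } T.toFunctor)
    (g := { app := fun j => (D.obj j).arr.dom, naturality := fun _ _ k => (D.map k).onArr_dom })
    (hT hW) hD₁ (hT hD₀) (fun n => isPullback_actFst_actSnd _ _)
    (isColimitOfPreserves T.toFunctor hcW) hc₁ (isColimitOfPreserves T.toFunctor hc₀)
    (isPullback_actFst_actSnd cD.pt v) (fun n => ?_) (fun n => ?_) (fun n => ?_) (fun n => ?_)
  · exact actMap_actFst _ _ (hv n)
  · exact actMap_actSnd _ _ (hv n)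
  · exact (T.map_comp _ _).symm.trans ((congrArg T.map (hv n)).trans (T.map_comp _ _))
  · exact (cD.ι.app n).onArr_dom

end TGraph

end

/-! ### Exhausted algebras: induction and recursion -/

noncomputable section

variable {T : Monad E}

namespace TGraph

/-- An algebra for the endofunctor `act` of the slice over the objects of a `T`-graph `X`,
together with a family `β` of elements indexed by `B`. -/
structure Alg [HasPullbacks E] (X : TGraph T) (B : E) where
  /-- the underlying object -/
  pt : E
  /-- the structure map of the slice category -/
  p : pt ⟶ X.obj
  /-- the family of elements -/
  β : B ⟶ pt
  /-- the action -/
  σ : X.act p ⟶ pt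
  σ_p : σ ≫ p = X.actSnd p ≫ X.arr.cod

/-- Maps of algebras over a map of `T`-graphs and a map of the indexing objects. -/
structure IsAlgMap [HasPullbacks E] {X Y : TGraph T} (f : X ⟶ Y) {B C : E} (k : B ⟶ C)
    (W : Alg X B) (Z : Alg Y C) (h : W.pt ⟶ Z.pt) : Prop where
  p : h ≫ Z.p = W.p ≫ f.onObj
  β : W.β ≫ h = k ≫ Z.β
  σ : W.σ ≫ h = actMap f h p ≫ Z.σ

section

variable [HasPullbacks E]

lemma IsAlgMap.id {X : TGraph T} {B : E} (W : Alg X B) : IsAlgMap (𝟙 X) (𝟙 B) W W (𝟙 _) where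
  p := by simp
  β := by simp
  σ := by simp [actMap_id]

lemma IsAlgMap.comp {X Y V : TGraph T} {f : X ⟶ Y} {g : Y ⟶ V} {B C D : E} {k : B ⟶ C}
    {l : C ⟶ D} {W : Alg X B} {Z : Alg Y C} {U : Alg V D} {h : W.pt ⟶ Z.pt} {h' : Z.pt ⟶ U.pt}
    (H : IsAlgMap f k W Z h) (H' : IsAlgMap g l Z U h') :
    IsAlgMap (f ≫ g) (k ≫ l) W U (h ≫ h') where
  p := by rw [Category.assoc, H'.p, reassoc_of% H.p, comp_onObj]
  β := by rw [reassoc_of% H.β, H'.β, Category.assoc]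
  σ := by rw [reassoc_of% H.σ, H'.σ, ← actMap_comp f g h h' H.p H'.p, Category.assoc]

/-- The part of an algebra over a subobject `S`. -/
abbrev actIncl {X : TGraph T} {S W : E} (i : S ⟶ W) (w : W ⟶ X.obj) : X.act (i ≫ w) ⟶ X.act w :=
  actMap (𝟙 X) i (Category.comp_id _).symm

/-- An algebra is exhausted if it is the colimit of a nested sequence of objects, each of which is
freely obtained from the previous one by one application of the operations. -/
structure Exhaustion {X : TGraph T} {B : E} (W : Alg X B) where
  /-- the sequence -/
  seq : ℕ ⥤ E
  nested : IsNested seq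
  /-- the coprojections -/
  ι : ∀ n, seq.obj n ⟶ W.pt
  w : ∀ {m n : ℕ} (k : m ⟶ n), seq.map k ≫ ι n = ι m
  /-- the sequence exhausts the algebra -/
  isColimit : IsColimit (Cocone.mk (F := seq) W.pt
    ⟨ι, fun _ _ k => (w k).trans (Category.comp_id (ι _)).symm⟩)
  /-- the sequence starts with the initial object -/
  isInitial : IsInitial (seq.obj 0)
  /-- the elements of the family -/
  b : ∀ n, B ⟶ seq.obj (n + 1)
  /-- the operation applied to the preceding stage -/
  s : ∀ n, X.act (ι n ≫ W.p) ⟶ seq.obj (n + 1)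
  b_ι : ∀ n, b n ≫ ι (n + 1) = W.β
  s_ι : ∀ n, s n ≫ ι (n + 1) = actIncl (ι n) W.p ≫ W.σ
  /-- every stage is a coproduct -/
  isColimit_succ : ∀ n, IsColimit (BinaryCofan.mk (b n) (s n))

end

lemma isNested_of_mono_succ {D : ℕ ⥤ E}
    (h : ∀ n : ℕ, Mono (D.map (homOfLE (Nat.le_add_right n 1)))) : IsNested D := by
  intro m n k
  obtain ⟨j, rfl⟩ := Nat.exists_eq_add_of_le (leOfHom k)
  obtain rfl := Subsingleton.elim (homOfLE (Nat.le_add_right m j)) k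
  induction j with
  | zero =>
    have e : homOfLE (Nat.le_add_right m 0) = 𝟙 m := Subsingleton.elim _ _
    rw [e, D.map_id]
    infer_instance
  | succ j ih =>
    have e : homOfLE (Nat.le_add_right m (j + 1)) =
      homOfLE (Nat.le_add_right m j) ≫ homOfLE (Nat.le_add_right (m + j) 1) :=
        Subsingleton.elim _ _
    have := h (m + j)
    rw [e, D.map_comp]
    exact mono_comp _ _

namespace Exhaustion

variable [IsSuitableCategory E] {X Y : TGraph T} {B C : E} {W : Alg X B}
  (e : Exhaustion W)

include e

lemma mono_ι (n : ℕ) : Mono (e.ι n) :=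
  IsSuitableCategory.mono_coprojection_nested e.seq e.nested _ e.isColimit n

/-- Proof by induction over the stages. -/
lemma hom_ext {Z : E} {a b : W.pt ⟶ Z} (hβ : W.β ≫ a = W.β ≫ b)
    (hσ : ∀ {S : E} (i : S ⟶ W.pt), i ≫ a = i ≫ b →
      actIncl i W.p ≫ W.σ ≫ a = actIncl i W.p ≫ W.σ ≫ b) : a = b := by
  refine e.isColimit.hom_ext fun n => ?_
  change e.ι n ≫ a = e.ι n ≫ b
  induction n with
  | zero => exact e.isInitial.hom_ext _ _
  | succ n ih =>
    apply copair_hom_ext (e.isColimit_succ n)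
    · exact (reassoc_of% e.b_ι n) a |>.trans (hβ.trans ((reassoc_of% e.b_ι n) b).symm)
    · exact (reassoc_of% e.s_ι n) a |>.trans ((hσ _ ih).trans ((reassoc_of% e.s_ι n) b).symm)

/-- Induction over the stages: the value of an algebra map on an operation depends only on its
values on the labels, so agreement on one stage passes to the next. -/
lemma algMap_unique {f : X ⟶ Y} {k : B ⟶ C} {Z : Alg Y C} {h h' : W.pt ⟶ Z.pt}
    (H : IsAlgMap f k W Z h) (H' : IsAlgMap f k W Z h') : h = h' := by
  refine e.hom_ext (H.β.trans H'.β.symm) fun i hi => ?_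
  rw [H.σ, H'.σ, ← Category.assoc, ← Category.assoc, actMap_comp, actMap_comp]
  simp only [hi]

/-- Compatibility of the transition maps with the summands, here and in `s_map`, need not be part of
the data of an exhaustion: it holds in the algebra, and the coprojections are monic. -/
lemma b_map (n : ℕ) : e.b n ≫ e.seq.map (homOfLE (Nat.le_add_right (n + 1) 1)) = e.b (n + 1) := by
  have := e.mono_ι (n + 1 + 1)
  rw [← cancel_mono (e.ι (n + 1 + 1)), Category.assoc, e.w, e.b_ι, e.b_ι]

lemma s_map (n : ℕ) : e.s n ≫ e.seq.map (homOfLE (Nat.le_add_right (n + 1) 1)) =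
    actMap (𝟙 X) (e.seq.map (homOfLE (Nat.le_add_right n 1)))
      (by rw [← Category.assoc, e.w]; simp) ≫ e.s (n + 1) := by
  have := e.mono_ι (n + 1 + 1)
  rw [← cancel_mono (e.ι (n + 1 + 1)), Category.assoc, e.w, e.s_ι, Category.assoc, e.s_ι,
    ← Category.assoc, actMap_comp]
  simp only [e.w, Category.comp_id]

/-- Applying the operations commutes with the exhaustion. -/
lemma act_hom_ext [IsSuitableMonad T] {Z : E} {a b : X.act W.p ⟶ Z}
    (h : ∀ n, actIncl (e.ι n) W.p ≫ a = actIncl (e.ι n) W.p ≫ b) : a = b := by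
  obtain ⟨hc⟩ := nonempty_isColimit_actCocone (D := (Functor.const ℕ).obj X)
    (w := fun n => e.ι n ≫ W.p) (fun k => by
      rw [← Category.assoc, e.w]; exact (Category.comp_id _).symm)
    (cD := constCocone ℕ X) (cW := ⟨W.pt, ⟨e.ι, fun _ _ k =>
      (e.w k).trans (Category.comp_id (e.ι _)).symm⟩⟩) W.p
    (fun n => (Category.comp_id _).symm) e.nested (isNested_const _) (isNested_const _)
    e.isColimit (isColimitConstCocone ℕ X.obj) (isColimitConstCocone ℕ X.arr.apex)
  exact hc.hom_ext h

/-- Definition of maps by recursion over the stages. -/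
lemma exists_algMap [IsSuitableMonad T] (f : X ⟶ Y) (k : B ⟶ C) (Z : Alg Y C)
    (hk : W.β ≫ W.p ≫ f.onObj = k ≫ Z.β ≫ Z.p) : ∃ h, IsAlgMap f k W Z h := by
  -- The recursion has to carry compatibility with the projections, since `actMap f h` makes sense
  -- only for such `h`.
  let stage (n : ℕ) : Type v := {h : e.seq.obj n ⟶ Z.pt // h ≫ Z.p = (e.ι n ≫ W.p) ≫ f.onObj}
  have hs (n : ℕ) (h : stage n) : copair (e.isColimit_succ n) (k ≫ Z.β)
      (actMap f h.1 h.2 ≫ Z.σ) ≫ Z.p = (e.ι (n + 1) ≫ W.p) ≫ f.onObj := by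
    apply copair_hom_ext (e.isColimit_succ n)
    · rw [reassoc_of% inl_copair, Category.assoc, ← hk, Category.assoc, reassoc_of% e.b_ι]
    · rw [reassoc_of% inr_copair, Category.assoc, Z.σ_p, actMap_actSnd_assoc, f.onArr_cod,
        Category.assoc, reassoc_of% e.s_ι, reassoc_of% W.σ_p, actMap_actSnd_assoc, id_onArr,
        Category.id_comp]
  let F : ∀ n, stage n := fun n => Nat.rec ⟨e.isInitial.to _, e.isInitial.hom_ext _ _⟩
    (fun n h => ⟨_, hs n h⟩) n
  have hF₁ (n : ℕ) : e.b n ≫ (F (n + 1)).1 = k ≫ Z.β :=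
    inl_copair (e.isColimit_succ n) _ _
  have hF₂ (n : ℕ) : e.s n ≫ (F (n + 1)).1 = actMap f (F n).1 (F n).2 ≫ Z.σ :=
    inr_copair (e.isColimit_succ n) _ _
  -- The partial maps agree with each other: on the summand of operations this follows from
  -- agreement one stage earlier.
  have hF (n : ℕ) : e.seq.map (homOfLE (Nat.le_add_right n 1)) ≫ (F (n + 1)).1 = (F n).1 := by
    induction n with
    | zero => exact e.isInitial.hom_ext _ _
    | succ n ih =>
      apply copair_hom_ext (e.isColimit_succ n)
      · exact ((reassoc_of% e.b_map n) _).trans ((hF₁ _).trans (hF₁ _).symm)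
      · refine ((reassoc_of% e.s_map n) _).trans (Eq.trans ?_ (hF₂ _).symm)
        rw [hF₂, ← Category.assoc, actMap_comp]
        simp only [ih, Category.id_comp]
  let c : Cocone e.seq := ⟨Z.pt, NatTrans.ofSequence (fun n => (F n).1) fun n =>
    (hF n).trans (Category.comp_id _).symm⟩
  have hc (n : ℕ) : e.ι n ≫ e.isColimit.desc c = (F n).1 := e.isColimit.fac c n
  have hp : e.isColimit.desc c ≫ Z.p = W.p ≫ f.onObj := by
    refine e.isColimit.hom_ext fun n => ?_
    exact ((reassoc_of% hc n) Z.p).trans ((F n).2.trans (Category.assoc _ _ _))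
  refine ⟨e.isColimit.desc c, hp, ?_, ?_⟩
  · rw [← e.b_ι 0, Category.assoc, hc, hF₁]
  · refine e.act_hom_ext fun n => ?_
    rw [← Category.assoc, ← e.s_ι, Category.assoc, hc, hF₂, ← Category.assoc, actMap_comp]
    simp only [hc, Category.id_comp]

/-- The underlying object of an exhausted algebra is a coproduct. -/
lemma nonempty_isColimit [IsSuitableMonad T] : Nonempty (IsColimit (BinaryCofan.mk W.β W.σ)) := by
  have hu {Z : E} (a b : W.pt ⟶ Z) (h₁ : W.β ≫ a = W.β ≫ b) (h₂ : W.σ ≫ a = W.σ ≫ b) : a = b :=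
    e.hom_ext h₁ fun i _ => by rw [h₂]
  have hex {Z : E} (a : B ⟶ Z) (b : X.act W.p ⟶ Z) :
      ∃ h : W.pt ⟶ Z, W.β ≫ h = a ∧ W.σ ≫ h = b := by
    -- No recursion is needed: on stage `n + 1` the map is prescribed by `a` on the family and by
    -- the restriction of `b` to operations on stage `n`.
    let F : ∀ n, e.seq.obj n ⟶ Z := fun n => match n with
      | 0 => e.isInitial.to _
      | n + 1 => copair (e.isColimit_succ n) a (actIncl (e.ι n) W.p ≫ b)
    have hF₁ (n : ℕ) : e.b n ≫ F (n + 1) = a :=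
      inl_copair (e.isColimit_succ n) _ _
    have hF₂ (n : ℕ) : e.s n ≫ F (n + 1) = actIncl (e.ι n) W.p ≫ b :=
      inr_copair (e.isColimit_succ n) _ _
    have hF (n : ℕ) : e.seq.map (homOfLE (Nat.le_add_right n 1)) ≫ F (n + 1) = F n := by
      cases n with
      | zero => exact e.isInitial.hom_ext _ _
      | succ n =>
        apply copair_hom_ext (e.isColimit_succ n)
        · exact ((reassoc_of% e.b_map n) _).trans ((hF₁ _).trans (hF₁ _).symm)
        · refine ((reassoc_of% e.s_map n) _).trans (Eq.trans ?_ (hF₂ _).symm)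
          rw [hF₂, ← Category.assoc, actMap_comp]
          simp only [e.w, Category.id_comp]
    let c : Cocone e.seq := ⟨Z, NatTrans.ofSequence F fun n =>
      (hF n).trans (Category.comp_id _).symm⟩
    have hc (n : ℕ) : e.ι n ≫ e.isColimit.desc c = F n := e.isColimit.fac c n
    refine ⟨e.isColimit.desc c, ?_, e.act_hom_ext fun n => ?_⟩
    · rw [← e.b_ι 0, Category.assoc, hc, hF₁]
    · rw [← Category.assoc, ← e.s_ι, Category.assoc, hc, hF₂]
  choose d hd₁ hd₂ using @hex
  exact ⟨BinaryCofan.IsColimit.mk _ d hd₁ hd₂ fun f g m h₁ h₂ =>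
    hu _ _ (h₁.trans (hd₁ f g).symm) (h₂.trans (hd₂ f g).symm)⟩

/-- An inverse is obtained by recursion on `W'`; both composites are identities by uniqueness. -/
lemma isIso_of_isAlgMap [IsSuitableMonad T] {W' : Alg X B} (e' : Exhaustion W') {h : W.pt ⟶ W'.pt}
    (H : IsAlgMap (𝟙 X) (𝟙 B) W W' h) : IsIso h := by
  obtain ⟨g, hg⟩ := e'.exists_algMap (𝟙 X) (𝟙 B) W (by
    have := H.β
    have hp := H.p
    simp only [Category.id_comp, id_onObj, Category.comp_id] at this hp ⊢
    rw [← this, Category.assoc, hp])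
  exact ⟨g, e.algMap_unique (by simpa using H.comp hg) (IsAlgMap.id W),
    e'.algMap_unique (by simpa using hg.comp H) (IsAlgMap.id W')⟩

end Exhaustion

end TGraph

end

/-! ### Pulling back exhaustions and existence of free algebras -/

noncomputable section

variable {T : Monad E} [IsSuitableCategory E]

namespace TGraph

attribute [instance] IsSuitableMonad.preservesPullbacks

/-- An algebra over an exhausted algebra is exhausted if both of its structure maps are pullbacks
of those of the latter. -/
lemma Exhaustion.nonempty_of_isPullback [IsSuitableMonad T] {X Y : TGraph T} {B C : E}
    {P : Alg X B} {W : Alg Y C} (e : Exhaustion W) {f : X ⟶ Y} {k : B ⟶ C} {h : P.pt ⟶ W.pt}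
    (H : IsAlgMap f k P W h) (hβ : IsPullback P.β k h W.β)
    (hσ : IsPullback P.σ (actMap f h H.p) h W.σ) : Nonempty (Exhaustion P) := by
  -- The stages of `P` are the pullbacks along `h` of the stages of `W`, formed at once in the
  -- category of sequences.
  obtain ⟨D, u, v, hD₁, hD₂, hι⟩ : ∃ (D : ℕ ⥤ E) (u : ∀ n, D.obj n ⟶ P.pt)
      (v : ∀ n, D.obj n ⟶ e.seq.obj n), (∀ {m n : ℕ} (k : m ⟶ n), D.map k ≫ u n = u m) ∧
      (∀ {m n : ℕ} (k : m ⟶ n), D.map k ≫ v n = v m ≫ e.seq.map k) ∧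
      ∀ n, IsPullback (u n) (v n) h (e.ι n) := by
    let α : (Functor.const ℕ).obj P.pt ⟶ (Functor.const ℕ).obj W.pt := (Functor.const ℕ).map h
    let γ : e.seq ⟶ (Functor.const ℕ).obj W.pt :=
      ⟨e.ι, fun _ _ k => (e.w k).trans (Category.comp_id (e.ι _)).symm⟩
    exact ⟨pullback α γ, (pullback.fst α γ).app, (pullback.snd α γ).app,
      fun k => ((pullback.fst α γ).naturality k).trans (Category.comp_id _),
      fun k => (pullback.snd α γ).naturality k, (IsPullback.of_hasPullback α γ).app⟩
  have hιm (n : ℕ) : Mono (u n) := by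
    have := e.mono_ι n
    exact (hι n).mono_fst_of_mono
  have hn : IsNested D := fun m n k => by
    have := hιm m
    exact mono_of_mono_fac (hD₁ k)
  -- Stability of nested colimits shows that the pulled back stages exhaust `P`.
  obtain ⟨hc⟩ := IsSuitableCategory.nonempty_isColimit_of_isPullback_const e.nested e.isColimit
    (c' := ⟨P.pt, ⟨fun n => u n,
      fun _ _ k => (hD₁ k).trans (Category.comp_id (u _)).symm⟩⟩)
    (D' := D) ⟨fun n => v n, fun _ _ k => hD₂ k⟩ h hι
  let b (n : ℕ) : B ⟶ D.obj (n + 1) :=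
    (hι _).lift P.β (k ≫ e.b n) (by rw [Category.assoc, e.b_ι, H.β])
  have hb₁ (n : ℕ) : b n ≫ u (n + 1) = P.β := (hι _).lift_fst _ _ _
  have hb₂ (n : ℕ) : b n ≫ v (n + 1) = k ≫ e.b n := (hι _).lift_snd _ _ _
  have hp (n : ℕ) : v n ≫ e.ι n ≫ W.p =
      (u n ≫ P.p) ≫ f.onObj := by
    rw [← (hι n).w_assoc, H.p, Category.assoc]
  have hs (n : ℕ) : (actIncl (u n) P.p ≫ P.σ) ≫ h =
      (actMap f (v n) (hp n) ≫ e.s n) ≫ e.ι (n + 1) := by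
    rw [Category.assoc, H.σ, ← Category.assoc, actMap_comp]
    simp only [Category.assoc, e.s_ι, (hι n).w, Category.id_comp]
    rw [actMap_comp_assoc]
    simp only [Category.comp_id]
  let s (n : ℕ) : X.act (u n ≫ P.p) ⟶ D.obj (n + 1) :=
    (hι _).lift _ _ (hs n)
  have hs₁ (n : ℕ) : s n ≫ u (n + 1) =
    actIncl (u n) P.p ≫ P.σ := (hι _).lift_fst _ _ _
  have hs₂ (n : ℕ) : s n ≫ v (n + 1) =
    actMap f (v n) (hp n) ≫ e.s n := (hι _).lift_snd _ _ _
  -- The decomposition of stage `n + 1` is pulled back from that of `W`. Cancelling the pullback `hι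
  -- (n + 1)` reduces the two squares to `hβ` and, for operations, to `hσ` pasted with `act` applied
  -- to the pullback `hι n`.
  have hcoprod (n : ℕ) : Nonempty (IsColimit (BinaryCofan.mk (b n) (s n))) := by
    refine IsSuitableCategory.isColimit_binaryCofan_of_isPullback (e.isColimit_succ n)
      (f := v (n + 1)) (f₁ := k)
      (f₂ := actMap f (v n) (hp n)) ?_ ?_
    · refine IsPullback.of_right ?_ (hb₂ n) (hι (n + 1))
      rw [hb₁, e.b_ι]
      exact hβ
    · refine IsPullback.of_right ?_ (hs₂ n) (hι (n + 1))
      rw [hs₁, e.s_ι]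
      refine IsPullback.paste_horiz ?_ hσ
      exact isPullback_actMap (IsPullback.id_horiz f.onObj)
        (IsPullback.id_horiz f.onArr) (hι n) _ _ _ _
  exact ⟨
    { seq := D
      nested := hn
      ι := fun n => u n
      w := hD₁
      isColimit := hc
      isInitial := by
        -- Stage `0` maps to an initial object, so it is initial by strictness.
        have := e.isInitial.isIso_to (v 0)
        exact e.isInitial.ofIso (asIso (v 0)).symm
      b := b
      s := s
      b_ι := hb₁
      s_ι := hs₁
      isColimit_succ := fun n => (hcoprod n).some }⟩

section Free

variable [IsSuitableMonad T] (X : TGraph T) {B : E} {b : B ⟶ X.obj}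

/-- The algebra lives on the colimit of the sequence. Since `act` preserves this colimit, the
inclusions of operations on stage `n` into stage `n + 1` induce its action. -/
lemma exists_exhaustion_of_functor {D : ℕ ⥤ E} {w : ∀ n, D.obj n ⟶ X.obj}
    (hw : ∀ {m n : ℕ} (k : m ⟶ n), D.map k ≫ w n = w m) (h₀ : IsInitial (D.obj 0))
    {inl : ∀ n, B ⟶ D.obj (n + 1)} {inr : ∀ n, X.act (w n) ⟶ D.obj (n + 1)}
    (hcop : ∀ n, IsColimit (BinaryCofan.mk (inl n) (inr n)))
    (hinl : ∀ n, inl n ≫ D.map (homOfLE (Nat.le_add_right (n + 1) 1)) = inl (n + 1))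
    (hinr : ∀ n, inr n ≫ D.map (homOfLE (Nat.le_add_right (n + 1) 1)) =
      actMap (𝟙 X) (D.map (homOfLE (Nat.le_add_right n 1)))
        ((hw _).trans (Category.comp_id _).symm) ≫ inr (n + 1))
    (hinlp : ∀ n, inl n ≫ w (n + 1) = b)
    (hinrp : ∀ n, inr n ≫ w (n + 1) = X.actSnd (w n) ≫ X.arr.cod) :
    ∃ W : Alg X B, W.β ≫ W.p = b ∧ Nonempty (Exhaustion W) := by
  -- Monicity propagates through the stages: each transition is the coproduct of an identity and
  -- `act` of the previous one. The first has initial source, and that is monic by strictness.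
  have hN : IsNested D := isNested_of_mono_succ fun n => by
    induction n with
    | zero =>
      refine ⟨fun {Z} f g _ => ?_⟩
      have := h₀.isIso_to f
      exact (h₀.ofIso (asIso f).symm).hom_ext _ _
    | succ n ih =>
      have : Mono (Hom.onArr (𝟙 X)) := inferInstanceAs (Mono (𝟙 _))
      have : Mono (actMap (𝟙 X) (D.map (homOfLE (Nat.le_add_right n 1)))
        ((hw _).trans (Category.comp_id (w n)).symm)) := mono_actMap _ _ _
      exact IsSuitableCategory.mono_of_isColimit_binaryCofan (hcop n) (hcop (n + 1))
        ((hinl n).trans (Category.id_comp _).symm) (hinr n)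
  have := IsSuitableCategory.hasColimit_nested _ hN
  obtain ⟨A, ι, hι, ⟨hc⟩⟩ : ∃ (A : E) (ι : ∀ n, D.obj n ⟶ A)
      (hι : ∀ {m n : ℕ} (k : m ⟶ n), D.map k ≫ ι n = ι m),
      Nonempty (IsColimit (Cocone.mk (F := D) A
        ⟨ι, fun _ _ k => (hι k).trans (Category.comp_id (ι _)).symm⟩)) :=
    ⟨colimit D, colimit.ι D, fun k => colimit.w D k, ⟨colimit.isColimit D⟩⟩
  obtain ⟨p, hp⟩ : ∃ p : A ⟶ X.obj, ∀ n, ι n ≫ p = w n :=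
    ⟨hc.desc ⟨X.obj, ⟨w, fun _ _ k => (hw k).trans (Category.comp_id (w _)).symm⟩⟩,
      fun n => hc.fac _ n⟩
  -- Replacing `w` by the composites through the colimit gives `inr` the exact type required by an
  -- exhaustion and avoids transport along `hp`.
  obtain rfl : (fun n => ι n ≫ p) = w := funext hp
  obtain ⟨ha⟩ := nonempty_isColimit_actCocone (D := (Functor.const ℕ).obj X)
    (w := fun n => ι n ≫ p) (fun k => (hw k).trans (Category.comp_id _).symm)
    (cD := constCocone ℕ X) (cW := Cocone.mk (F := D) A
        ⟨ι, fun _ _ k => (hι k).trans (Category.comp_id (ι _)).symm⟩) p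
    (fun n => (Category.comp_id _).symm) hN (isNested_const _) (isNested_const _)
    hc (isColimitConstCocone ℕ X.obj) (isColimitConstCocone ℕ X.arr.apex)
  obtain ⟨σ, hσ⟩ : ∃ σ : X.act p ⟶ A, ∀ n, actIncl (ι n) p ≫ σ = inr n ≫ ι (n + 1) :=
    ⟨ha.desc ⟨A, NatTrans.ofSequence (fun n => inr n ≫ ι (n + 1)) (fun n => by
      refine ((reassoc_of% (hinr n)) (ι (n + 1 + 1))).symm.trans ?_
      rw [hι]
      exact (Category.comp_id _).symm)⟩, fun n => ha.fac _ n⟩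
  have σ_p : σ ≫ p = X.actSnd p ≫ X.arr.cod := ha.hom_ext fun n => by
    change actIncl (ι n) p ≫ σ ≫ p = actIncl (ι n) p ≫ X.actSnd p ≫ X.arr.cod
    rw [reassoc_of% hσ, hinrp, actMap_actSnd_assoc, id_onArr, Category.id_comp]
  -- The family first occurs in stage `1`; its image in the colimit does not depend on the stage, as
  -- the induction below checks.
  refine ⟨⟨A, p, inl 0 ≫ ι 1, σ, σ_p⟩, (Category.assoc _ _ _).trans (hinlp 0),
    ⟨⟨D, hN, ι, hι, hc, h₀, inl, inr, fun n => ?_, fun n => (hσ n).symm, hcop⟩⟩⟩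
  induction n with
  | zero => rfl
  | succ n ih => rw [← ih, ← hι (homOfLE (Nat.le_add_right (n + 1) 1)), reassoc_of% hinl]

variable (b)

/-- The stages of the construction of the free algebra. -/
def stage (n : ℕ) : Over X.obj :=
  Nat.rec (Over.mk (initial.to X.obj))
    (fun _ W => Over.mk (coprod.desc b (X.actSnd W.hom ≫ X.arr.cod))) n

/-- Every object over the objects of a `T`-graph generates a free algebra. -/
lemma exists_exhaustion : ∃ W : Alg X B, W.β ≫ W.p = b ∧ Nonempty (Exhaustion W) := by
  -- Only the universal properties of the stages are kept, so that the recursor in `stage` is not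
  -- unfolded later.
  obtain ⟨S, w, inl, inr, ⟨h₀⟩, hc, hinlp, hinrp⟩ : ∃ (S : ℕ → E) (w : ∀ n, S n ⟶ X.obj)
      (inl : ∀ n, B ⟶ S (n + 1)) (inr : ∀ n, X.act (w n) ⟶ S (n + 1)),
      Nonempty (IsInitial (S 0)) ∧ (∀ n, Nonempty (IsColimit (BinaryCofan.mk (inl n) (inr n)))) ∧
      (∀ n, inl n ≫ w (n + 1) = b) ∧
      ∀ n, inr n ≫ w (n + 1) = X.actSnd (w n) ≫ X.arr.cod :=
    ⟨fun n => (X.stage b n).left, fun n => (X.stage b n).hom, fun n => coprod.inl,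
      fun n => coprod.inr, ⟨initialIsInitial⟩, fun n => ⟨coprodIsCoprod _ _⟩,
      fun n => coprod.inl_desc _ _, fun n => coprod.inr_desc _ _⟩
  replace hc := fun n => (hc n).some
  have hnext (n : ℕ) (t : {t : S n ⟶ S (n + 1) // t ≫ w (n + 1) = w n}) :
      copair (hc n) (inl (n + 1))
        (actMap (𝟙 X) t.1 (t.2.trans (Category.comp_id _).symm) ≫ inr (n + 1)) ≫ w (n + 1 + 1) =
      w (n + 1) := by
    apply copair_hom_ext (hc n)
    · rw [reassoc_of% inl_copair, hinlp, hinlp]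
    · rw [reassoc_of% inr_copair, Category.assoc, hinrp, hinrp, actMap_actSnd_assoc, id_onArr,
        Category.id_comp]
  -- The transitions are again recursive: the map from `0`, followed by the identity on the family
  -- and `act` of the previous transition on operations.
  let t : ∀ n, {t : S n ⟶ S (n + 1) // t ≫ w (n + 1) = w n} := fun n =>
    Nat.rec ⟨h₀.to _, h₀.hom_ext _ _⟩ (fun n t => ⟨_, hnext n t⟩) n
  have hinl (n : ℕ) : inl n ≫ (t (n + 1)).1 = inl (n + 1) := inl_copair (hc n) _ _
  have hinr (n : ℕ) : inr n ≫ (t (n + 1)).1 =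
      actMap (𝟙 X) (t n).1 ((t n).2.trans (Category.comp_id _).symm) ≫ inr (n + 1) :=
    inr_copair (hc n) _ _
  let F : ℕ ⥤ E := Functor.ofSequence fun n => (t n).1
  have hF (n : ℕ) : F.map (homOfLE (Nat.le_add_right n 1)) = (t n).1 :=
    Functor.ofSequence_map_homOfLE_succ (fun n => (t n).1) n
  let α : F ⟶ (Functor.const ℕ).obj X.obj := NatTrans.ofSequence w fun n => by
    rw [hF]
    exact (t n).2.trans (Category.comp_id _).symm
  refine X.exists_exhaustion_of_functor (D := F) (w := w) (fun {m n} k => ?_) h₀ (inl := inl)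
    (inr := inr) hc (fun n => ?_) (fun n => ?_) hinlp hinrp
  · exact (α.naturality k).trans (Category.comp_id _)
  · exact (congrArg (inl n ≫ ·) (hF (n + 1))).trans (hinl n)
  · refine (congrArg (inr n ≫ ·) (hF (n + 1))).trans ((hinr n).trans ?_)
    simp only [hF]
    rfl

end Free

end TGraph

end

/-! ### Multicategories expressed through `act` -/

noncomputable section

variable {T : Monad E}

namespace TMulticategory

open TGraph

section

variable [HasPullbacks E]

/-- A family of families of arrows of a `T`-graph, reassociated. -/
def actAssoc (G : TGraph T) {m : G.act G.arr.cod ⟶ G.arr.apex} {B : E} {b : B ⟶ G.obj}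
    (hd : m ≫ G.arr.dom = G.actFst G.arr.cod ≫ T.map G.arr.dom ≫ T.μ.app G.obj) :
    G.act (G.actSnd b ≫ G.arr.cod) ⟶ G.act b :=
  actLift (G.actFst _ ≫ T.map (G.actFst b) ≫ T.μ.app B)
    (actMap (𝟙 G) (G.actSnd b) (Category.comp_id _).symm ≫ m) (by
      have h : T.map (T.map b) ≫ T.μ.app G.obj = T.μ.app B ≫ T.map b := T.μ.naturality b
      rw [Category.assoc, Category.assoc, ← h, Category.assoc, hd, actMap_actFst_assoc,
        ← T.map_comp_assoc, ← T.map_comp_assoc, act_condition])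

section

variable (G : TGraph T) {m : G.act G.arr.cod ⟶ G.arr.apex} {B : E} {b : B ⟶ G.obj}
  (hd : m ≫ G.arr.dom = G.actFst G.arr.cod ≫ T.map G.arr.dom ≫ T.μ.app G.obj)

@[simp]
lemma actAssoc_actFst : actAssoc (b := b) G hd ≫ G.actFst b =
    G.actFst _ ≫ T.map (G.actFst b) ≫ T.μ.app B := actLift_actFst _ _ _

@[simp]
lemma actAssoc_actSnd : actAssoc (b := b) G hd ≫ G.actSnd b =
    actMap (𝟙 G) (G.actSnd b) (Category.comp_id _).symm ≫ m := actLift_actSnd _ _ _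

end

section

variable {G : TGraph T} (comp : G.arr.of G.arr ⟶ G.arr) (ids : TSpan.unit T G.obj ⟶ G.arr)

/-- The object `act` at the right leg of a graph is definitionally the apex of its composite with
itself. This and the next two lemmas translate the laws of a monad in spans, with their coherence
2-cells, into equations between maps of such objects. -/
lemma assoc_comp_hcomp_map :
    (TSpan.assoc G.arr G.arr G.arr ≫ TSpan.hcomp comp (𝟙 G.arr)).map =
      actAssoc (b := G.arr.cod) G comp.map_dom := by
  refine TSpan.of_hom_ext ?_ ?_
  · refine Eq.trans ?_ (actLift_actFst _ _ _).symm
    change (TSpan.lift _ _ _ _ _ ≫ TSpan.lift _ _ _ _ _) ≫ TSpan.fst _ _ = _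
    rw [Category.assoc, TSpan.lift_fst, reassoc_of% TSpan.lift_fst, TSpan.id_map, T.map_id,
      Category.comp_id]
    rfl
  · refine Eq.trans ?_ (actLift_actSnd _ _ _).symm
    change (TSpan.lift _ _ _ _ _ ≫ TSpan.lift _ _ _ _ _) ≫ TSpan.snd _ _ = _
    rw [Category.assoc, TSpan.lift_snd, reassoc_of% TSpan.lift_snd]
    refine congrArg (· ≫ comp.map) (TSpan.of_hom_ext ?_ ?_)
    · rw [TSpan.lift_fst]
      exact (actMap_actFst (𝟙 G) _ _).symm
    · rw [TSpan.lift_snd]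
      exact ((actMap_actSnd (𝟙 G) _ _).trans (Category.comp_id _)).symm

lemma leftUnit_comp_hcomp_map : (TSpan.leftUnit G.arr ≫ TSpan.hcomp ids (𝟙 G.arr)).map =
    actLift (X := G) (w := G.arr.cod) (T.η.app G.arr.apex) (G.arr.cod ≫ ids.map) (by
      rw [Category.assoc, ids.map_dom]; exact (T.η.naturality _).symm) := by
  refine TSpan.of_hom_ext ?_ ?_
  · refine Eq.trans ?_ (actLift_actFst _ _ _).symm
    change (TSpan.lift _ _ _ _ _ ≫ TSpan.lift _ _ _ _ _) ≫ TSpan.fst _ _ = _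
    rw [Category.assoc, TSpan.lift_fst, reassoc_of% TSpan.lift_fst, TSpan.id_map, T.map_id,
      Category.comp_id]
  · refine Eq.trans ?_ (actLift_actSnd _ _ _).symm
    change (TSpan.lift _ _ _ _ _ ≫ TSpan.lift _ _ _ _ _) ≫ TSpan.snd _ _ = _
    rw [Category.assoc, TSpan.lift_snd, reassoc_of% TSpan.lift_snd]

lemma rightUnit_comp_hcomp_map : (TSpan.rightUnit G.arr ≫ TSpan.hcomp (𝟙 G.arr) ids).map =
    actLift (X := G) (w := G.arr.cod) (G.arr.dom ≫ T.map ids.map) (𝟙 _) (by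
      rw [Category.assoc, ← T.map_comp, ids.map_cod]; simp) := by
  refine TSpan.of_hom_ext ?_ ?_
  · refine Eq.trans ?_ (actLift_actFst _ _ _).symm
    change (TSpan.lift _ _ _ _ _ ≫ TSpan.lift _ _ _ _ _) ≫ TSpan.fst _ _ = _
    rw [Category.assoc, TSpan.lift_fst, reassoc_of% TSpan.lift_fst]
  · refine Eq.trans ?_ (actLift_actSnd _ _ _).symm
    change (TSpan.lift _ _ _ _ _ ≫ TSpan.lift _ _ _ _ _) ≫ TSpan.snd _ _ = _
    rw [Category.assoc, TSpan.lift_snd, reassoc_of% TSpan.lift_snd, TSpan.id_map,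
      Category.comp_id]

end

/-- The construction of a `T`-multicategory from its data and laws in terms of `act`. -/
abbrev ofAct (G : TGraph T) (m : G.act G.arr.cod ⟶ G.arr.apex) (i : G.obj ⟶ G.arr.apex)
    (hd : m ≫ G.arr.dom = G.actFst G.arr.cod ≫ T.map G.arr.dom ≫ T.μ.app G.obj)
    (hc : m ≫ G.arr.cod = G.actSnd G.arr.cod ≫ G.arr.cod)
    (id : i ≫ G.arr.dom = T.η.app G.obj) (ic : i ≫ G.arr.cod = 𝟙 _)
    (assoc : actMap (𝟙 G) m (hc.trans (Category.comp_id _).symm) ≫ m = actAssoc G hd ≫ m)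
    (unit_left : actLift (T.η.app G.arr.apex) (G.arr.cod ≫ i) (by
      rw [Category.assoc, id]; exact (T.η.naturality _).symm) ≫ m = 𝟙 _)
    (unit_right : actLift (G.arr.dom ≫ T.map i) (𝟙 _) (by
      rw [Category.assoc, ← T.map_comp, ic]; simp) ≫ m = 𝟙 _) : TMulticategory T where
  toTGraph := G
  comp := ⟨m, hd, hc⟩
  ids := ⟨i, id, ic⟩
  assoc := TSpan.hom_ext <| assoc.trans <|
    (congrArg (· ≫ m) (assoc_comp_hcomp_map ⟨m, hd, hc⟩).symm).trans (Category.assoc _ _ _)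
  ids_comp := TSpan.hom_ext <| (Category.assoc _ _ _).symm.trans <|
    (congrArg (· ≫ m) (leftUnit_comp_hcomp_map ⟨i, id, ic⟩)).trans unit_left
  comp_ids := TSpan.hom_ext <| (Category.assoc _ _ _).symm.trans <|
    (congrArg (· ≫ m) (rightUnit_comp_hcomp_map ⟨i, id, ic⟩)).trans unit_right

variable (C : TMulticategory T)

/-- The composition of a `T`-multicategory. -/
def m : C.act C.arr.cod ⟶ C.arr.apex := C.comp.map

/-- The identities of a `T`-multicategory. -/
def i : C.obj ⟶ C.arr.apex := C.ids.map

lemma m_dom : C.m ≫ C.arr.dom = C.actFst C.arr.cod ≫ T.map C.arr.dom ≫ T.μ.app C.obj :=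
  C.comp.map_dom

lemma m_cod : C.m ≫ C.arr.cod = C.actSnd C.arr.cod ≫ C.arr.cod := C.comp.map_cod

lemma i_dom : C.i ≫ C.arr.dom = T.η.app C.obj := C.ids.map_dom

lemma i_cod : C.i ≫ C.arr.cod = 𝟙 _ := C.ids.map_cod

lemma m_assoc : actMap (𝟙 C.toTGraph) C.m (C.m_cod.trans (Category.comp_id _).symm) ≫ C.m =
    actAssoc C.toTGraph C.m_dom ≫ C.m :=
  (congrArg TSpan.Hom.map C.assoc).trans <|
    (Category.assoc _ _ _).symm.trans (congrArg (· ≫ C.m) (assoc_comp_hcomp_map C.comp))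

lemma unit_left : actLift (T.η.app C.arr.apex) (C.arr.cod ≫ C.i) (by
      rw [Category.assoc, i_dom]; exact (T.η.naturality _).symm) ≫ C.m = 𝟙 _ :=
  (congrArg (· ≫ C.m) (leftUnit_comp_hcomp_map C.ids)).symm.trans <|
    (Category.assoc _ _ _).trans (congrArg TSpan.Hom.map C.ids_comp)

lemma unit_right : actLift (C.arr.dom ≫ T.map C.i) (𝟙 _) (by
      rw [Category.assoc, ← T.map_comp, i_cod]; simp) ≫ C.m = 𝟙 _ :=
  (congrArg (· ≫ C.m) (rightUnit_comp_hcomp_map C.ids)).symm.trans <|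
    (Category.assoc _ _ _).trans (congrArg TSpan.Hom.map C.comp_ids)

end

end TMulticategory

end

/-! ### Construction of the free multicategory -/

noncomputable section

variable {T : Monad E}

namespace TGraph

section

variable [HasPullbacks E]

/-- The same algebra with another family of elements. -/
abbrev Alg.reindex {X : TGraph T} {B C : E} (W : Alg X B) (k : C ⟶ W.pt) : Alg X C where
  pt := W.pt
  p := W.p
  β := k
  σ := W.σ
  σ_p := W.σ_p

lemma IsAlgMap.reindex {X Y : TGraph T} {f : X ⟶ Y} {B C B' C' : E} {k : B ⟶ C}
    {W : Alg X B} {Z : Alg Y C} {h : W.pt ⟶ Z.pt} (H : IsAlgMap f k W Z h) {l : B' ⟶ W.pt}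
    {l' : C' ⟶ Z.pt} {k' : B' ⟶ C'} (hl : l ≫ h = k' ≫ l') :
    IsAlgMap f k' (W.reindex l) (Z.reindex l') h where
  p := H.p
  β := hl
  σ := H.σ

lemma IsAlgMap.reindex_right {X Y : TGraph T} {f : X ⟶ Y} {B C C' : E} {k : B ⟶ C}
    {W : Alg X B} {Z : Alg Y C} {h : W.pt ⟶ Z.pt} (H : IsAlgMap f k W Z h) {l : C' ⟶ Z.pt}
    {k' : B ⟶ C'} (hl : k ≫ Z.β = k' ≫ l) : IsAlgMap f k' W (Z.reindex l) h where
  p := H.p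
  β := H.β.trans hl
  σ := H.σ

/-- Both `act` objects are pullbacks along the left leg of `X`, so the pasting law applies. -/
lemma isPullback_actFst_actIncl {X : TGraph T} {S W : E} (i : S ⟶ W) (w : W ⟶ X.obj) :
    IsPullback (X.actFst (i ≫ w)) (actIncl i w) (T.map i) (X.actFst w) := by
  refine IsPullback.of_bot ?_ (actMap_actFst _ _ _).symm (isPullback_actFst_actSnd _ w)
  rw [actMap_actSnd, id_onArr, Category.comp_id, ← T.map_comp]
  exact isPullback_actFst_actSnd _ _

end

variable [IsSuitableCategory E] [IsSuitableMonad T] (X : TGraph T)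

/-- The free algebra on the identity. -/
def freeAlg : Alg X X.obj := (X.exists_exhaustion (𝟙 _)).choose

lemma freeAlg_β_p : X.freeAlg.β ≫ X.freeAlg.p = 𝟙 _ := (X.exists_exhaustion (𝟙 _)).choose_spec.1

/-- The free algebra is exhausted. -/
def freeExhaustion : Exhaustion X.freeAlg := (X.exists_exhaustion (𝟙 _)).choose_spec.2.some

/-- The list of inputs of a tree is defined by recursion: `η` for an identity, and `μ` of the lists
of inputs of the branches otherwise. Targets of recursion must lie over `X₀`, whence the product `T
X₀ ⨯ X₀` in place of `T X₀`. -/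
lemma exists_dom : ∃ d : X.freeAlg.pt ⟶ T.obj X.obj, X.freeAlg.β ≫ d = T.η.app X.obj ∧
    X.freeAlg.σ ≫ d = X.actFst X.freeAlg.p ≫ T.map d ≫ T.μ.app X.obj := by
  let Z : Alg X X.obj :=
    { pt := T.obj X.obj ⨯ X.obj
      p := prod.snd
      β := prod.lift (T.η.app X.obj) (𝟙 _)
      σ := prod.lift (X.actFst _ ≫ T.map prod.fst ≫ T.μ.app X.obj) (X.actSnd _ ≫ X.arr.cod)
      σ_p := prod.lift_snd _ _ }
  obtain ⟨h, H⟩ := X.freeExhaustion.exists_algMap (𝟙 X) (𝟙 _) Z (by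
    rw [id_onObj, Category.comp_id, freeAlg_β_p, Category.id_comp]
    exact (prod.lift_snd _ _).symm)
  have hβ : (prod.lift (T.η.app X.obj) (𝟙 X.obj) : X.obj ⟶ T.obj X.obj ⨯ X.obj) ≫ prod.fst =
    T.η.app X.obj := prod.lift_fst _ _
  refine ⟨h ≫ prod.fst, ?_, ?_⟩
  · rw [reassoc_of% H.β]
    exact hβ
  · rw [reassoc_of% H.σ, T.map_comp, Category.assoc, ← actMap_actFst_assoc (𝟙 X) h H.p]
    exact congrArg (actMap (𝟙 X) h H.p ≫ ·) (prod.lift_fst _ _)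

/-- The left leg of the span of arrows of the free `T`-multicategory. -/
def freeDom : X.freeAlg.pt ⟶ T.obj X.obj := X.exists_dom.choose

lemma β_freeDom : X.freeAlg.β ≫ X.freeDom = T.η.app X.obj := X.exists_dom.choose_spec.1

lemma σ_freeDom : X.freeAlg.σ ≫ X.freeDom =
    X.actFst X.freeAlg.p ≫ T.map X.freeDom ≫ T.μ.app X.obj := X.exists_dom.choose_spec.2

/-- The underlying `T`-graph of the free `T`-multicategory. -/
abbrev freeGraph : TGraph T where
  obj := X.obj
  arr := ⟨X.freeAlg.pt, X.freeDom, X.freeAlg.p⟩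

variable {B : E} (b : B ⟶ X.obj)

/-- The family of unary families with an identity arrow. -/
def compβ : B ⟶ X.freeGraph.act b :=
  actLift (T.η.app B) (b ≫ X.freeAlg.β) (by
    rw [Category.assoc, β_freeDom]; exact (T.η.naturality b).symm)

/-- The action of arrows of `X` on families indexed by the domains of arrows of the free
`T`-multicategory. -/
def compσ : X.act (X.freeGraph.actSnd b ≫ X.freeAlg.p) ⟶ X.freeGraph.act b :=
  actLift (X.actFst _ ≫ T.map (X.freeGraph.actFst b) ≫ T.μ.app B)
    (actIncl (X.freeGraph.actSnd b) X.freeAlg.p ≫ X.freeAlg.σ) (by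
      have h : T.map (T.map b) ≫ T.μ.app X.obj = T.μ.app B ≫ T.map b := T.μ.naturality b
      rw [Category.assoc, Category.assoc, ← h, Category.assoc, σ_freeDom, actMap_actFst_assoc,
        ← T.map_comp_assoc, ← T.map_comp_assoc, act_condition])

@[simp]
lemma compβ_actFst : X.compβ b ≫ X.freeGraph.actFst b = T.η.app B := actLift_actFst _ _ _

@[simp]
lemma compβ_actSnd : X.compβ b ≫ X.freeGraph.actSnd b = b ≫ X.freeAlg.β := actLift_actSnd _ _ _

@[simp]
lemma compσ_actFst : X.compσ b ≫ X.freeGraph.actFst b =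
    X.actFst _ ≫ T.map (X.freeGraph.actFst b) ≫ T.μ.app B := actLift_actFst _ _ _

@[simp]
lemma compσ_actSnd : X.compσ b ≫ X.freeGraph.actSnd b =
    actIncl (X.freeGraph.actSnd b) X.freeAlg.p ≫ X.freeAlg.σ := actLift_actSnd _ _ _

/-- The algebra of families of elements of `B` indexed by the domain of an arrow of the free
`T`-multicategory, together with that arrow. -/
abbrev compAlg : Alg X B where
  pt := X.freeGraph.act b
  p := X.freeGraph.actSnd b ≫ X.freeAlg.p
  β := X.compβ b
  σ := X.compσ b
  σ_p := by
    rw [reassoc_of% compσ_actSnd, X.freeAlg.σ_p, actMap_actSnd_assoc, id_onArr,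
      Category.id_comp]

lemma isAlgMap_actSnd : IsAlgMap (𝟙 X) b (X.compAlg b) X.freeAlg (X.freeGraph.actSnd b) where
  p := (Category.comp_id _).symm
  β := X.compβ_actSnd b
  σ := X.compσ_actSnd b

/-- Labelled trees lie over trees, and this projection has cartesian structure squares: the one for
`β` because `η` is cartesian, the one for `σ` because `μ` is cartesian and `T` preserves pullbacks.
So the exhaustion of the free algebra pulls back, and recursion over labelled trees becomes
available. -/
lemma nonempty_exhaustion_compAlg : Nonempty (Exhaustion (X.compAlg b)) := by
  refine X.freeExhaustion.nonempty_of_isPullback (X.isAlgMap_actSnd b) ?_ ?_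
  · refine IsPullback.of_right ?_ (X.compβ_actSnd b) (isPullback_actFst_actSnd X.freeGraph b)
    rw [compβ_actFst, β_freeDom]
    exact (IsSuitableMonad.isPullback_η b).flip
  · refine IsPullback.of_right ?_ (X.compσ_actSnd b) (isPullback_actFst_actSnd X.freeGraph b)
    rw [compσ_actFst, σ_freeDom]
    exact (isPullback_actFst_actIncl _ _).paste_horiz
      (((isPullback_actFst_actSnd X.freeGraph b).map T.toFunctor).paste_horiz
        (IsSuitableMonad.isPullback_μ b).flip)

/-- The algebra of composable pairs of arrows is exhausted. -/
def compExhaustion : Exhaustion (X.compAlg b) := (X.nonempty_exhaustion_compAlg b).some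

/-- Grafting is defined by recursion on the outer tree. An identity labelled by a tree is sent to
that tree, hence the reindexing of the free algebra by its own identity. -/
lemma exists_freeMul : ∃ m : X.freeGraph.act X.freeAlg.p ⟶ X.freeAlg.pt,
    IsAlgMap (𝟙 X) (𝟙 _) (X.compAlg X.freeAlg.p) (X.freeAlg.reindex (𝟙 _)) m :=
  (X.compExhaustion X.freeAlg.p).exists_algMap (𝟙 X) (𝟙 _) (X.freeAlg.reindex (𝟙 _)) (by
    simp [reassoc_of% compβ_actSnd, freeAlg_β_p])

/-- The composition of the free `T`-multicategory. -/
def freeMul : X.freeGraph.act X.freeAlg.p ⟶ X.freeAlg.pt := X.exists_freeMul.choose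

lemma isAlgMap_freeMul :
    IsAlgMap (𝟙 X) (𝟙 _) (X.compAlg X.freeAlg.p) (X.freeAlg.reindex (𝟙 _)) X.freeMul :=
  X.exists_freeMul.choose_spec

lemma freeMul_p : X.freeMul ≫ X.freeAlg.p = X.freeGraph.actSnd X.freeAlg.p ≫ X.freeAlg.p :=
  X.isAlgMap_freeMul.p.trans (Category.comp_id _)

lemma freeMul_β : X.compβ X.freeAlg.p ≫ X.freeMul = 𝟙 _ :=
  X.isAlgMap_freeMul.β.trans (Category.comp_id _)

lemma freeMul_σ : X.compσ X.freeAlg.p ≫ X.freeMul =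
    actMap (𝟙 X) X.freeMul X.isAlgMap_freeMul.p ≫ X.freeAlg.σ :=
  X.isAlgMap_freeMul.σ

lemma freeMul_dom : X.freeMul ≫ X.freeDom =
    X.freeGraph.actFst X.freeAlg.p ≫ T.map X.freeDom ≫ T.μ.app X.obj := by
  refine (X.compExhaustion X.freeAlg.p).hom_ext ?_ fun i hi => ?_
  · rw [reassoc_of% freeMul_β, reassoc_of% compβ_actFst]
    have h : X.freeDom ≫ T.η.app (T.obj X.obj) = T.η.app _ ≫ T.map X.freeDom :=
      T.η.naturality X.freeDom
    rw [← reassoc_of% h, T.left_unit]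
    exact (Category.comp_id _).symm
  · rw [reassoc_of% freeMul_σ, σ_freeDom, actMap_comp_assoc, actMap_actFst_assoc,
      ← T.map_comp_assoc, Category.assoc, hi, reassoc_of% compσ_actFst]
    have h : T.map (T.map X.freeDom) ≫ T.μ.app (T.obj X.obj) = T.μ.app _ ≫ T.map X.freeDom :=
      T.μ.naturality X.freeDom
    simp only [Category.assoc, actMap_actFst_assoc, ← reassoc_of% h, T.map_comp, T.assoc]

/-- The functoriality of the objects of families. -/
lemma isAlgMap_compMap {C : E} {c : C ⟶ X.obj} (k : B ⟶ C) (hk : k ≫ c = b) :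
    IsAlgMap (𝟙 X) k (X.compAlg b) (X.compAlg c)
      (actMap (𝟙 X.freeGraph) k (hk.trans (Category.comp_id _).symm)) where
  p := by simp
  β := by
    apply act_hom_ext
    · simp only [Category.assoc, actMap_actFst, reassoc_of% compβ_actFst, compβ_actFst]
      exact (T.η.naturality k).symm
    · simp [reassoc_of% hk]
  σ := by
    have h : T.map (T.map k) ≫ T.μ.app C = T.μ.app B ≫ T.map k := T.μ.naturality k
    apply act_hom_ext
    · simp only [Category.assoc, actMap_actFst, reassoc_of% compσ_actFst, compσ_actFst,
        actMap_actFst_assoc, ← h, ← T.map_comp_assoc]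
    · simp [actMap_comp_assoc]

/-- The algebra structure is checked on the two components of a labelled tree: the labels use the
monad laws of `T`, the tree uses the recursion equations of `freeMul`. -/
lemma isAlgMap_actAssoc : IsAlgMap (𝟙 X) (𝟙 _) ((X.compAlg (X.freeGraph.actSnd b ≫ X.freeAlg.p)))
    ((X.compAlg b).reindex (𝟙 _))
    (TMulticategory.actAssoc (b := b) X.freeGraph X.freeMul_dom) where
  p := by
    simp [reassoc_of% TMulticategory.actAssoc_actSnd, freeMul_p]
  β := by
    have hβ := (X.isAlgMap_compMap _ (c := X.freeAlg.p) (X.freeGraph.actSnd b) rfl).β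
    have h : X.freeGraph.actFst b ≫ T.η.app (T.obj B) = T.η.app _ ≫ T.map (X.freeGraph.actFst b) :=
      T.η.naturality _
    apply act_hom_ext
    · rw [Category.assoc, TMulticategory.actAssoc_actFst, reassoc_of% compβ_actFst,
        ← reassoc_of% h, T.left_unit]
      simp
    · rw [Category.assoc, TMulticategory.actAssoc_actSnd, reassoc_of% hβ, freeMul_β]
      simp
  σ := by
    have hσ := (X.isAlgMap_compMap _ (c := X.freeAlg.p) (X.freeGraph.actSnd b) rfl).σ
    have h : T.map (T.map (X.freeGraph.actFst b)) ≫ T.μ.app (T.obj B) =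
      T.μ.app _ ≫ T.map (X.freeGraph.actFst b) := T.μ.naturality _
    apply act_hom_ext
    · rw [Category.assoc, TMulticategory.actAssoc_actFst, reassoc_of% compσ_actFst,
        ← reassoc_of% h, Category.assoc, compσ_actFst, actMap_actFst_assoc]
      simp only [← T.map_comp_assoc, TMulticategory.actAssoc_actFst]
      simp only [T.map_comp, Category.assoc, T.assoc]
    · rw [Category.assoc, TMulticategory.actAssoc_actSnd, reassoc_of% hσ, freeMul_σ]
      simp only [Category.assoc, compσ_actSnd]
      rw [actMap_comp_assoc, actMap_comp_assoc]
      simp only [TMulticategory.actAssoc_actSnd, Category.comp_id]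

/-- Both sides are algebra maps from the exhausted algebra of composable triples to the free algebra
with family `freeMul`, so they coincide. -/
lemma freeMul_assoc : actMap (𝟙 X.freeGraph) X.freeMul
      (X.freeMul_p.trans (Category.comp_id _).symm) ≫ X.freeMul =
    TMulticategory.actAssoc (b := X.freeAlg.p) X.freeGraph X.freeMul_dom ≫ X.freeMul := by
  have h₁ := ((X.isAlgMap_compMap _ X.freeMul X.freeMul_p).comp X.isAlgMap_freeMul).reindex_right
    (k' := 𝟙 _) (l := X.freeMul) (by simp)
  have h₂ := (X.isAlgMap_actAssoc X.freeAlg.p).comp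
    (X.isAlgMap_freeMul.reindex (k' := 𝟙 _) (l := 𝟙 _) (l' := X.freeMul) (by simp))
  rw [Category.comp_id] at h₁ h₂
  rw [Category.comp_id] at h₂
  exact (X.compExhaustion _).algMap_unique (Z := X.freeAlg.reindex X.freeMul) h₁ h₂

/-- Grafting identities onto all inputs is an algebra endomorphism of the free algebra, hence the
identity. The other unit law is the base case `freeMul_β` of the recursion. -/
lemma freeMul_unit_right : actLift (X := X.freeGraph) (w := X.freeAlg.p)
      (X.freeDom ≫ T.map X.freeAlg.β) (𝟙 _) (by
        rw [Category.assoc, ← T.map_comp, freeAlg_β_p]; simp) ≫ X.freeMul = 𝟙 _ := by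
  have H : IsAlgMap (𝟙 X) X.freeAlg.β X.freeAlg (X.compAlg X.freeAlg.p)
      (actLift (X.freeDom ≫ T.map X.freeAlg.β) (𝟙 _) (by
        rw [Category.assoc, ← T.map_comp, freeAlg_β_p]; simp)) :=
    { p := by simp
      β := by
        apply act_hom_ext
        · rw [Category.assoc, actLift_actFst, reassoc_of% X.β_freeDom, Category.assoc,
            compβ_actFst]
          exact (T.η.naturality _).symm
        · rw [Category.assoc, actLift_actSnd, Category.assoc, compβ_actSnd,
            reassoc_of% X.freeAlg_β_p]
          exact Category.comp_id _
      σ := by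
        have h : T.map (T.map X.freeAlg.β) ≫ T.μ.app _ = T.μ.app _ ≫ T.map X.freeAlg.β :=
          T.μ.naturality _
        apply act_hom_ext
        · rw [Category.assoc, actLift_actFst, reassoc_of% X.σ_freeDom, Category.assoc,
            compσ_actFst, actMap_actFst_assoc, ← T.map_comp_assoc, actLift_actFst,
            T.map_comp_assoc, h]
        · rw [Category.assoc, actLift_actSnd, Category.assoc, compσ_actSnd, actMap_comp_assoc]
          simp only [actLift_actSnd, Category.comp_id, actMap_id, Category.id_comp] }
  have h₁ := (H.comp X.isAlgMap_freeMul).reindex_right (k' := 𝟙 _) (l := X.freeAlg.β) (by simp)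
  rw [Category.comp_id] at h₁
  exact X.freeExhaustion.algMap_unique h₁ (IsAlgMap.id _)

/-- The free `T`-multicategory. -/
abbrev free : TMulticategory T :=
  TMulticategory.ofAct X.freeGraph X.freeMul X.freeAlg.β X.freeMul_dom X.freeMul_p X.β_freeDom
    X.freeAlg_β_p X.freeMul_assoc X.freeMul_β X.freeMul_unit_right

end TGraph

end

/-! ### Universal property of the free multicategory -/

noncomputable section

variable {T : Monad E}

namespace TMulticategory

open TGraph

section

variable [HasPullbacks E]

lemma Hom.onArr_i {C D : TMulticategory T} (g : C ⟶ D) :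
    C.i ≫ g.toGraphHom.onArr = g.toGraphHom.onObj ≫ D.i := g.map_ids

lemma Hom.onArr_m {C D : TMulticategory T} (g : C ⟶ D) : C.m ≫ g.toGraphHom.onArr =
    actMap g.toGraphHom g.toGraphHom.onArr g.toGraphHom.onArr_cod ≫ D.m := g.map_comp

@[ext]
lemma hom_ext {C D : TMulticategory T} {g h : C ⟶ D} (H : g.toGraphHom = h.toGraphHom) : g = h :=
  Hom.ext H

/-- The construction of maps of `T`-multicategories in terms of `act`. -/
def homMk {C D : TMulticategory T} (g : C.toTGraph ⟶ D.toTGraph)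
    (hi : C.i ≫ g.onArr = g.onObj ≫ D.i)
    (hm : C.m ≫ g.onArr = actMap g g.onArr g.onArr_cod ≫ D.m) : C ⟶ D :=
  ⟨g, hi, hm⟩

/-- The algebra of arrows of a `T`-multicategory. -/
abbrev toAlg (C : TMulticategory T) : Alg C.toTGraph C.obj where
  pt := C.arr.apex
  p := C.arr.cod
  β := C.i
  σ := C.m
  σ_p := C.m_cod

end

end TMulticategory

namespace TGraph

open TMulticategory

variable [IsSuitableCategory E] [IsSuitableMonad T] (X : TGraph T)

/-- The inclusion of the generators into the arrows of the free `T`-multicategory. -/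
def generator : X.arr.apex ⟶ X.freeAlg.pt :=
  actLift (X.arr.dom ≫ T.map X.freeAlg.β) (𝟙 _) (by
    rw [Category.assoc, ← T.map_comp, freeAlg_β_p]; simp) ≫ X.freeAlg.σ

/-- The inclusion of the generators into the free `T`-multicategory. -/
@[simps]
def freeUnit : X ⟶ X.freeGraph where
  onObj := 𝟙 _
  onArr := X.generator
  onArr_dom := by
    rw [generator, Category.assoc, σ_freeDom, actLift_actFst_assoc, Category.assoc,
      ← T.map_comp_assoc, β_freeDom]
    exact (congrArg (X.arr.dom ≫ ·) (T.right_unit X.obj)).trans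
      (congrArg (X.arr.dom ≫ ·) (T.map_id X.obj).symm)
  onArr_cod := by
    rw [generator, Category.assoc, X.freeAlg.σ_p, actLift_actSnd_assoc]
    exact (Category.id_comp _).trans (Category.comp_id _).symm

/-- Acting by an arrow of `X` is composing with the corresponding generator. A generator is `σ`
applied to identities, so one step of the recursion for `freeMul` followed by its base case computes
the composite. Consequently maps out of the free multicategory are algebra maps. -/
lemma actMap_freeUnit_freeMul : actMap X.freeUnit (𝟙 X.freeAlg.pt) (z := X.freeAlg.p)
    ((Category.id_comp _).trans (Category.comp_id X.freeAlg.p).symm) ≫ X.freeMul =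
      X.freeAlg.σ := by
  have e : actMap X.freeUnit (𝟙 X.freeAlg.pt) (z := X.freeAlg.p)
      ((Category.id_comp _).trans (Category.comp_id X.freeAlg.p).symm) =
      actMap (𝟙 X) (X.compβ X.freeAlg.p) (by
        rw [reassoc_of% compβ_actSnd, freeAlg_β_p]; rfl) ≫ X.compσ X.freeAlg.p := by
    have h : X.generator = actLift (X.arr.dom ≫ T.map X.freeAlg.β) (𝟙 _) (by
      rw [Category.assoc, ← T.map_comp, freeAlg_β_p]; simp) ≫ X.freeAlg.σ := rfl
    apply act_hom_ext
    · rw [actMap_actFst, Category.assoc, compσ_actFst, actMap_actFst_assoc, ← T.map_comp_assoc,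
        compβ_actFst, T.right_unit, T.map_id]
      rfl
    · rw [actMap_actSnd, Category.assoc, compσ_actSnd, actMap_comp_assoc, freeUnit_onArr, h,
        ← Category.assoc]
      refine congrArg (· ≫ X.freeAlg.σ) ?_
      apply act_hom_ext
      · rw [Category.assoc, actLift_actFst, actMap_actFst, compβ_actSnd, T.map_comp,
          act_condition_assoc]
      · rw [Category.assoc, actLift_actSnd, actMap_actSnd]
        simp
  rw [e, Category.assoc, freeMul_σ, actMap_comp_assoc]
  simp only [freeMul_β, Category.comp_id]
  rw [actMap_id, Category.id_comp]

variable {X} {C : TMulticategory T}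

lemma exists_freeLift (f : X ⟶ C.toTGraph) :
    ∃ h : X.freeAlg.pt ⟶ C.arr.apex, IsAlgMap f f.onObj X.freeAlg C.toAlg h :=
  X.freeExhaustion.exists_algMap f f.onObj C.toAlg (by
    rw [reassoc_of% freeAlg_β_p, i_cod]
    exact (Category.comp_id _).symm)

/-- Algebra maps respect the right leg by definition; the left leg needs its own induction. -/
lemma IsAlgMap.freeLift_dom {f : X ⟶ C.toTGraph} {h : X.freeAlg.pt ⟶ C.arr.apex}
    (H : IsAlgMap f f.onObj X.freeAlg C.toAlg h) :
    h ≫ C.arr.dom = X.freeDom ≫ T.map f.onObj := by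
  have Hβ : X.freeAlg.β ≫ h = f.onObj ≫ C.i := H.β
  have Hσ : X.freeAlg.σ ≫ h = actMap f h H.p ≫ C.m := H.σ
  refine X.freeExhaustion.hom_ext ?_ fun i hi => ?_
  · rw [reassoc_of% Hβ, i_dom, reassoc_of% X.β_freeDom]
    exact T.η.naturality _
  · have hμ : T.map (T.map f.onObj) ≫ T.μ.app C.obj = T.μ.app X.obj ≫ T.map f.onObj :=
      T.μ.naturality _
    rw [reassoc_of% Hσ, m_dom, actMap_comp_assoc, reassoc_of% X.σ_freeDom, actMap_actFst_assoc,
      actMap_actFst_assoc, ← hμ, ← T.map_comp_assoc, ← T.map_comp_assoc, ← T.map_comp_assoc,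
      Category.assoc, hi, Category.assoc]

/-- The map of graphs out of the free `T`-multicategory given by a map of algebras. -/
abbrev freeLiftGraph {f : X ⟶ C.toTGraph} {h : X.freeAlg.pt ⟶ C.arr.apex}
    (H : IsAlgMap f f.onObj X.freeAlg C.toAlg h) : X.freeGraph ⟶ C.toTGraph where
  onObj := f.onObj
  onArr := h
  onArr_dom := H.freeLift_dom
  onArr_cod := H.p

/-- Preservation of composition: both sides are algebra maps out of the exhausted algebra of
composable pairs. For the right-hand side, compatibility with `β` is the left unit law of `C` and
compatibility with `σ` is its associativity. -/
lemma IsAlgMap.freeMul_freeLift {f : X ⟶ C.toTGraph} {h : X.freeAlg.pt ⟶ C.arr.apex}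
    (H : IsAlgMap f f.onObj X.freeAlg C.toAlg h) :
    X.freeMul ≫ h = actMap (w := X.freeAlg.p) (z := C.arr.cod) (freeLiftGraph H) h H.p ≫ C.m := by
  have Hp : h ≫ C.arr.cod = X.freeAlg.p ≫ f.onObj := H.p
  have Hβ : X.freeAlg.β ≫ h = f.onObj ≫ C.i := H.β
  have Hσ : X.freeAlg.σ ≫ h = actMap f h H.p ≫ C.m := H.σ
  have h₁ := X.isAlgMap_freeMul.comp (H.reindex (l := 𝟙 _) (l' := h) (k' := 𝟙 _) (by simp))
  rw [Category.id_comp, Category.id_comp] at h₁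
  refine (X.compExhaustion _).algMap_unique (Z := C.toAlg.reindex h) h₁
    { p := ?_, β := ?_, σ := ?_ }
  · simp [m_cod, Hp]
  · have hu := C.unit_left
    refine Eq.trans ?_ ((congrArg (h ≫ ·) hu).trans
      ((Category.comp_id _).trans (Category.id_comp _).symm))
    rw [← Category.assoc, ← Category.assoc]
    refine congrArg (· ≫ C.m) ?_
    apply act_hom_ext
    · simp only [Category.assoc, actMap_actFst, actLift_actFst, reassoc_of% compβ_actFst]
      exact (T.η.naturality h).symm
    · simp only [Category.assoc, actMap_actSnd, actLift_actSnd, reassoc_of% compβ_actSnd,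
        Hβ, reassoc_of% Hp]
  · have ha := C.m_assoc
    have e : actMap (w := X.freeGraph.actSnd X.freeAlg.p ≫ X.freeAlg.p) (z := C.arr.cod) f
        (actMap (w := X.freeAlg.p) (z := C.arr.cod) (freeLiftGraph H) h H.p ≫ C.m)
          (by simp [m_cod, Hp]) ≫ C.m =
        actMap (w := X.freeGraph.actSnd X.freeAlg.p ≫ X.freeAlg.p)
          (z := C.actSnd C.arr.cod ≫ C.arr.cod) f
          (actMap (w := X.freeAlg.p) (z := C.arr.cod) (freeLiftGraph H) h H.p) (by simp [Hp]) ≫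
          actMap (𝟙 C.toTGraph) C.m (C.m_cod.trans (Category.comp_id _).symm) ≫ C.m := by
      rw [actMap_comp_assoc]
      simp only [Category.comp_id]
    refine Eq.trans ?_ e.symm
    rw [ha, ← Category.assoc, ← Category.assoc]
    refine congrArg (· ≫ C.m) ?_
    have hμ : T.map (T.map h) ≫ T.μ.app _ = T.μ.app _ ≫ T.map h := T.μ.naturality _
    apply act_hom_ext
    · simp only [Category.assoc, actMap_actFst, actAssoc_actFst, reassoc_of% compσ_actFst,
        actMap_actFst_assoc, ← hμ, ← T.map_comp_assoc]
    · simp only [Category.assoc, actMap_actSnd, actAssoc_actSnd, reassoc_of% compσ_actSnd,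
        Hσ]
      rw [actMap_comp_assoc, actMap_comp_assoc]
      simp only [actMap_actSnd, Category.comp_id, Category.id_comp]

/-- The map out of the free `T`-multicategory given by a map of algebras. -/
def freeLift {f : X ⟶ C.toTGraph} {h : X.freeAlg.pt ⟶ C.arr.apex}
    (H : IsAlgMap f f.onObj X.freeAlg C.toAlg h) : X.free ⟶ C :=
  homMk (freeLiftGraph H) H.β H.freeMul_freeLift

/-- A generator is sent to `f` of it composed with identities; the right unit law of `C` removes
these. -/
lemma IsAlgMap.generator_freeLift {f : X ⟶ C.toTGraph} {h : X.freeAlg.pt ⟶ C.arr.apex}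
    (H : IsAlgMap f f.onObj X.freeAlg C.toAlg h) : X.generator ≫ h = f.onArr := by
  have Hβ : X.freeAlg.β ≫ h = f.onObj ≫ C.i := H.β
  have Hσ : X.freeAlg.σ ≫ h = actMap f h H.p ≫ C.m := H.σ
  refine Eq.trans ?_ ((congrArg (f.onArr ≫ ·) C.unit_right).trans (Category.comp_id _))
  rw [generator, Category.assoc, Hσ, ← Category.assoc, ← Category.assoc]
  refine congrArg (· ≫ C.m) ?_
  apply act_hom_ext
  · simp only [Category.assoc, actMap_actFst, actLift_actFst, actLift_actFst_assoc,
      ← T.map_comp, Hβ]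
    rw [T.map_comp, reassoc_of% f.onArr_dom]
  · simp only [Category.assoc, actMap_actSnd, actLift_actSnd, actLift_actSnd_assoc,
      Category.comp_id, Category.id_comp]

lemma isAlgMap_of_hom (g : X.freeGraph ⟶ C.toTGraph)
    (hi : X.freeAlg.β ≫ g.onArr = g.onObj ≫ C.i)
    (hm : X.freeMul ≫ g.onArr =
      actMap (w := X.freeAlg.p) (z := C.arr.cod) g g.onArr g.onArr_cod ≫ C.m) :
    IsAlgMap (X.freeUnit ≫ g) (X.freeUnit ≫ g).onObj X.freeAlg C.toAlg g.onArr where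
  p := g.onArr_cod.trans (by simp)
  β := hi.trans (by simp)
  σ := by
    rw [← actMap_freeUnit_freeMul, Category.assoc, hm, actMap_comp_assoc]
    simp only [Category.id_comp]

variable (X C) in
/-- The universal property of the free `T`-multicategory. -/
def freeHomEquiv : (X.free ⟶ C) ≃ (X ⟶ C.toTGraph) where
  toFun g := X.freeUnit ≫ (show X.freeGraph ⟶ C.toTGraph from g.toGraphHom)
  invFun f := freeLift (exists_freeLift f).choose_spec
  left_inv g := by
    let g' : X.freeGraph ⟶ C.toTGraph := g.toGraphHom
    have h₁ := isAlgMap_of_hom g' g.onArr_i g.onArr_m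
    have h₂ := (exists_freeLift (X.freeUnit ≫ g')).choose_spec
    refine TMulticategory.hom_ext (TGraph.hom_ext ?_ ?_)
    · exact Category.id_comp _
    · exact X.freeExhaustion.algMap_unique h₂ h₁
  right_inv f :=
    TGraph.hom_ext (Category.id_comp _) (exists_freeLift f).choose_spec.generator_freeLift

variable (T) in
/-- The free `T`-multicategory functor. -/
def freeFunctor : TGraph T ⥤ TMulticategory T :=
  Adjunction.leftAdjointOfEquiv (G := forget T) freeHomEquiv
    (fun X _ _ g h => (Category.assoc X.freeUnit h.toGraphHom g.toGraphHom).symm)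

variable (T) in
/-- The free `T`-multicategory functor is left adjoint to the forgetful functor. -/
def freeAdjunction : freeFunctor T ⊣ forget T :=
  Adjunction.adjunctionOfEquivLeft _ _

end TGraph

end

/-! ### Componentwise limits and colimits of graphs -/

noncomputable section

variable {T : Monad E}

namespace TGraph

/-- Pullbacks of `T`-graphs are computed componentwise. -/
lemma isPullback_of_components [PreservesLimitsOfShape WalkingCospan T.toFunctor]
    {X Y Z V : TGraph T} {f : X ⟶ Y} {g : X ⟶ Z} {h : Y ⟶ V} {k : Z ⟶ V}
    (h₀ : IsPullback f.onObj g.onObj h.onObj k.onObj)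
    (h₁ : IsPullback f.onArr g.onArr h.onArr k.onArr) : IsPullback f g h k := by
  refine ⟨⟨TGraph.hom_ext h₀.w h₁.w⟩, ⟨PullbackCone.IsLimit.mk _ (fun s =>
    { onObj := h₀.lift s.fst.onObj s.snd.onObj (congrArg Hom.onObj s.condition)
      onArr := h₁.lift s.fst.onArr s.snd.onArr (congrArg Hom.onArr s.condition)
      onArr_dom := (h₀.map T.toFunctor).hom_ext ?_ ?_
      onArr_cod := h₀.hom_ext ?_ ?_ }) (fun s => ?_) (fun s => ?_) (fun s m hm₁ hm₂ => ?_)⟩⟩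
  · simp only [Category.assoc, ← T.map_comp, IsPullback.lift_fst, ← f.onArr_dom,
      IsPullback.lift_fst_assoc, s.fst.onArr_dom]
  · simp only [Category.assoc, ← T.map_comp, IsPullback.lift_snd, ← g.onArr_dom,
      IsPullback.lift_snd_assoc, s.snd.onArr_dom]
  · simp only [Category.assoc, IsPullback.lift_fst, ← f.onArr_cod,
      IsPullback.lift_fst_assoc, s.fst.onArr_cod]
  · simp only [Category.assoc, IsPullback.lift_snd, ← g.onArr_cod,
      IsPullback.lift_snd_assoc, s.snd.onArr_cod]
  · exact TGraph.hom_ext (h₀.lift_fst _ _ _) (h₁.lift_fst _ _ _)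
  · exact TGraph.hom_ext (h₀.lift_snd _ _ _) (h₁.lift_snd _ _ _)
  · refine TGraph.hom_ext (h₀.hom_ext ?_ ?_) (h₁.hom_ext ?_ ?_)
    · exact (congrArg Hom.onObj hm₁).trans (h₀.lift_fst _ _ _).symm
    · exact (congrArg Hom.onObj hm₂).trans (h₀.lift_snd _ _ _).symm
    · exact (congrArg Hom.onArr hm₁).trans (h₁.lift_fst _ _ _).symm
    · exact (congrArg Hom.onArr hm₂).trans (h₁.lift_snd _ _ _).symm

section Pullbacks

variable [HasPullbacks E] [PreservesLimitsOfShape WalkingCospan T.toFunctor]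

/-- The left leg of the componentwise pullback exists because `T` of the pullback of objects is
again a pullback. -/
lemma exists_isPullback {Y Z V : TGraph T} (h : Y ⟶ V) (k : Z ⟶ V) :
    ∃ (X : TGraph T) (f : X ⟶ Y) (g : X ⟶ Z), IsPullback f.onObj g.onObj h.onObj k.onObj ∧
      IsPullback f.onArr g.onArr h.onArr k.onArr := by
  have h₀ := IsPullback.of_hasPullback h.onObj k.onObj
  have h₁ := IsPullback.of_hasPullback h.onArr k.onArr
  have hT := h₀.map T.toFunctor
  have ed : (pullback.fst h.onArr k.onArr ≫ Y.arr.dom) ≫ T.map h.onObj =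
      (pullback.snd h.onArr k.onArr ≫ Z.arr.dom) ≫ T.map k.onObj := by
    rw [Category.assoc, Category.assoc, ← h.onArr_dom, ← k.onArr_dom, pullback.condition_assoc]
  have ec : (pullback.fst h.onArr k.onArr ≫ Y.arr.cod) ≫ h.onObj =
      (pullback.snd h.onArr k.onArr ≫ Z.arr.cod) ≫ k.onObj := by
    rw [Category.assoc, Category.assoc, ← h.onArr_cod, ← k.onArr_cod, pullback.condition_assoc]
  exact ⟨⟨pullback h.onObj k.onObj, pullback h.onArr k.onArr, hT.lift _ _ ed, h₀.lift _ _ ec⟩,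
    ⟨pullback.fst _ _, pullback.fst _ _, (hT.lift_fst _ _ ed).symm, (h₀.lift_fst _ _ ec).symm⟩,
    ⟨pullback.snd _ _, pullback.snd _ _, (hT.lift_snd _ _ ed).symm, (h₀.lift_snd _ _ ec).symm⟩,
    h₀, h₁⟩

instance hasPullbacks : HasPullbacks (TGraph T) :=
  have (Y Z V : TGraph T) (h : Y ⟶ V) (k : Z ⟶ V) : HasLimit (cospan h k) := by
    obtain ⟨X, f, g, h₀, h₁⟩ := exists_isPullback h k
    exact (isPullback_of_components h₀ h₁).hasPullback
  hasPullbacks_of_hasLimit_cospan _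

instance preservesPullbacks_objFunctor :
    PreservesLimitsOfShape WalkingCospan (objFunctor T) :=
  preservesLimitsOfShape_walkingCospan_of_forall_isPullback fun _ _ _ h k _ => by
    obtain ⟨X, f, g, h₀, h₁⟩ := exists_isPullback h k
    exact ⟨X, f, g, isPullback_of_components h₀ h₁, h₀⟩

instance preservesPullbacks_arrFunctor :
    PreservesLimitsOfShape WalkingCospan (arrFunctor T) :=
  preservesLimitsOfShape_walkingCospan_of_forall_isPullback fun _ _ _ h k _ => by
    obtain ⟨X, f, g, h₀, h₁⟩ := exists_isPullback h k
    exact ⟨X, f, g, isPullback_of_components h₀ h₁, h₁⟩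

end Pullbacks

/-- The terminal graph has arrows `T 1` with identity left leg, so a map into it is forced on arrows
by the left leg of its source. -/
instance hasTerminal [HasTerminal E] : HasTerminal (TGraph T) :=
  (IsTerminal.ofUniqueHom (Y := (⟨⊤_ E, T.obj (⊤_ E), 𝟙 _, terminal.from _⟩ : TGraph T))
    (fun X => Hom.mk (terminal.from _) (X.arr.dom ≫ T.map (terminal.from _)) (Category.comp_id _)
      (terminal.hom_ext _ _))
    (fun X f => TGraph.hom_ext (terminal.hom_ext _ _) (by
      have h : f.onArr ≫ 𝟙 _ = X.arr.dom ≫ T.map f.onObj := f.onArr_dom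
      rw [Category.comp_id] at h
      rw [h]
      congr 2
      exact terminal.hom_ext _ _))).hasTerminal

lemma mono_of_components {X Y : TGraph T} (f : X ⟶ Y) [Mono f.onObj] [Mono f.onArr] : Mono f := by
  refine ⟨fun g h w => TGraph.hom_ext ?_ ?_⟩
  · rw [← cancel_mono f.onObj]
    exact congrArg Hom.onObj w
  · rw [← cancel_mono f.onArr]
    exact congrArg Hom.onArr w

section Colimits

variable {J : Type*} [Category* J] {D : J ⥤ TGraph T}

lemma comp_legs_of_fac {X Y : TGraph T} {x : ∀ j, D.obj j ⟶ X} {y : ∀ j, D.obj j ⟶ Y}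
    (hx : ∀ {Z : E} {a b : X.arr.apex ⟶ Z}, (∀ j, (x j).onArr ≫ a = (x j).onArr ≫ b) → a = b)
    {d₀ : X.obj ⟶ Y.obj} {d₁ : X.arr.apex ⟶ Y.arr.apex}
    (h₀ : ∀ j, (x j).onObj ≫ d₀ = (y j).onObj) (h₁ : ∀ j, (x j).onArr ≫ d₁ = (y j).onArr) :
    d₁ ≫ Y.arr.dom = X.arr.dom ≫ T.map d₀ ∧ d₁ ≫ Y.arr.cod = X.arr.cod ≫ d₀ := by
  refine ⟨hx fun j => ?_, hx fun j => ?_⟩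
  · rw [reassoc_of% h₁, reassoc_of% (x j).onArr_dom, ← T.map_comp, h₀, (y j).onArr_dom]
  · rw [reassoc_of% h₁, reassoc_of% (x j).onArr_cod, h₀, (y j).onArr_cod]

/-- Colimits of `T`-graphs are computed componentwise. -/
def isColimitOfComponents {c : Cocone D} (h₀ : IsColimit ((objFunctor T).mapCocone c))
    (h₁ : IsColimit ((arrFunctor T).mapCocone c)) : IsColimit c where
  desc s :=
    have H := comp_legs_of_fac (x := c.ι.app) (y := s.ι.app) h₁.hom_ext
      (d₀ := h₀.desc ((objFunctor T).mapCocone s)) (d₁ := h₁.desc ((arrFunctor T).mapCocone s))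
      (h₀.fac _) (h₁.fac _)
    ⟨h₀.desc ((objFunctor T).mapCocone s), h₁.desc ((arrFunctor T).mapCocone s), H.1, H.2⟩
  fac _ j := TGraph.hom_ext (h₀.fac _ j) (h₁.fac _ j)
  uniq s m hm := TGraph.hom_ext (h₀.uniq ((objFunctor T).mapCocone s) m.onObj
      fun j => congrArg Hom.onObj (hm j))
    (h₁.uniq ((arrFunctor T).mapCocone s) m.onArr fun j => congrArg Hom.onArr (hm j))

/-- The legs are maps out of the colimit of arrows, so `T` need not preserve anything. -/
lemma exists_isColimit [HasColimit (D ⋙ objFunctor T)] [HasColimit (D ⋙ arrFunctor T)] :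
    ∃ c : Cocone D, Nonempty (IsColimit ((objFunctor T).mapCocone c)) ∧
      Nonempty (IsColimit ((arrFunctor T).mapCocone c)) := by
  have hc₀ := colimit.isColimit (D ⋙ objFunctor T)
  have hc₁ := colimit.isColimit (D ⋙ arrFunctor T)
  let ι₀ (j : J) : (D.obj j).obj ⟶ colimit (D ⋙ objFunctor T) := colimit.ι (D ⋙ objFunctor T) j
  let ι₁ (j : J) : (D.obj j).arr.apex ⟶ colimit (D ⋙ arrFunctor T) :=
    colimit.ι (D ⋙ arrFunctor T) j
  have w₀ {i j : J} (k : i ⟶ j) : (D.map k).onObj ≫ ι₀ j = ι₀ i := colimit.w (D ⋙ objFunctor T) k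
  have w₁ {i j : J} (k : i ⟶ j) : (D.map k).onArr ≫ ι₁ j = ι₁ i := colimit.w (D ⋙ arrFunctor T) k
  obtain ⟨d, hd⟩ : ∃ d : colimit (D ⋙ arrFunctor T) ⟶ T.obj (colimit (D ⋙ objFunctor T)),
      ∀ j, ι₁ j ≫ d = (D.obj j).arr.dom ≫ T.map (ι₀ j) :=
    ⟨hc₁.desc ⟨_, ⟨fun j => (D.obj j).arr.dom ≫ T.map (ι₀ j), fun i j k => by
      refine Eq.trans ?_ (Category.comp_id _).symm
      refine ((reassoc_of% (D.map k).onArr_dom) _).trans ?_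
      rw [← T.map_comp, w₀]
      rfl⟩⟩, fun j => hc₁.fac _ j⟩
  obtain ⟨e, he⟩ : ∃ e : colimit (D ⋙ arrFunctor T) ⟶ colimit (D ⋙ objFunctor T),
      ∀ j, ι₁ j ≫ e = (D.obj j).arr.cod ≫ ι₀ j :=
    ⟨hc₁.desc ⟨_, ⟨fun j => (D.obj j).arr.cod ≫ ι₀ j, fun i j k => by
      refine Eq.trans ?_ (Category.comp_id _).symm
      refine ((reassoc_of% (D.map k).onArr_cod) _).trans ?_
      rw [w₀]
      rfl⟩⟩, fun j => hc₁.fac _ j⟩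
  exact ⟨⟨⟨colimit (D ⋙ objFunctor T), colimit (D ⋙ arrFunctor T), d, e⟩,
    ⟨fun j => ⟨ι₀ j, ι₁ j, hd j, he j⟩, fun i j k =>
      TGraph.hom_ext ((w₀ k).trans (Category.comp_id _).symm)
        ((w₁ k).trans (Category.comp_id _).symm)⟩⟩, ⟨hc₀⟩, ⟨hc₁⟩⟩

variable [HasColimit (D ⋙ objFunctor T)] [HasColimit (D ⋙ arrFunctor T)]

lemma hasColimit_of_components : HasColimit D := by
  obtain ⟨c, ⟨h₀⟩, ⟨h₁⟩⟩ := exists_isColimit (D := D)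
  exact ⟨⟨c, isColimitOfComponents h₀ h₁⟩⟩

instance preservesColimit_objFunctor : PreservesColimit D (objFunctor T) := by
  obtain ⟨c, ⟨h₀⟩, ⟨h₁⟩⟩ := exists_isColimit (D := D)
  exact preservesColimit_of_preserves_colimit_cocone (isColimitOfComponents h₀ h₁) h₀

instance preservesColimit_arrFunctor : PreservesColimit D (arrFunctor T) := by
  obtain ⟨c, ⟨h₀⟩, ⟨h₁⟩⟩ := exists_isColimit (D := D)
  exact preservesColimit_of_preserves_colimit_cocone (isColimitOfComponents h₀ h₁) h₁

end Colimits

end TGraph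

end

/-! ### Suitability of the category of graphs -/

noncomputable section

variable {T : Monad E}

namespace IsSuitableCategory

variable [IsSuitableCategory E]

lemma mono_of_isColimit_discrete {J : Type} [Finite J] {F : Discrete J ⥤ E} {c : Cocone F}
    (hc : IsColimit c) (j : J) : Mono (c.ι.app ⟨j⟩) := by
  have := mono_coprojection J (fun j => F.obj ⟨j⟩) j
  let s : Cocone F := ⟨∐ fun j => F.obj ⟨j⟩, Discrete.natTrans fun j =>
    Sigma.ι (fun j => F.obj ⟨j⟩) j.as⟩
  have h : c.ι.app ⟨j⟩ ≫ hc.desc s = Sigma.ι (fun j => F.obj ⟨j⟩) j := hc.fac s ⟨j⟩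
  exact mono_of_mono_fac h

lemma isPullback_of_isInitial {I Y₁ Y₂ Y : E} {j₁ : Y₁ ⟶ Y} {j₂ : Y₂ ⟶ Y}
    (h : IsColimit (BinaryCofan.mk j₁ j₂)) (hI : IsInitial I) (a : I ⟶ Y₁) (b : I ⟶ Y₂) :
    IsPullback a b j₁ j₂ :=
  (isPullback_initial h).of_iso (initialIsInitial.uniqueUpToIso hI) (Iso.refl _) (Iso.refl _)
    (Iso.refl _) (initialIsInitial.hom_ext _ _) (initialIsInitial.hom_ext _ _) (by simp) (by simp)

end IsSuitableCategory

namespace TGraph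

section

variable [HasPullbacks E] [PreservesLimitsOfShape WalkingCospan T.toFunctor]

lemma isNested_comp_objFunctor {D : ℕ ⥤ TGraph T} (hD : IsNested D) :
    IsNested (D ⋙ objFunctor T) := fun _ _ k => by
  have := hD k
  exact inferInstanceAs (Mono ((objFunctor T).map (D.map k)))

lemma isNested_comp_arrFunctor {D : ℕ ⥤ TGraph T} (hD : IsNested D) :
    IsNested (D ⋙ arrFunctor T) := fun _ _ k => by
  have := hD k
  exact inferInstanceAs (Mono ((arrFunctor T).map (D.map k)))

end

variable [IsSuitableCategory E] [IsSuitableMonad T]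

lemma nonempty_isColimit_of_isNested {D : ℕ ⥤ TGraph T} (hD : IsNested D) {c : Cocone D}
    (hc : IsColimit c) : Nonempty (IsColimit ((objFunctor T).mapCocone c)) ∧
      Nonempty (IsColimit ((arrFunctor T).mapCocone c)) := by
  have := IsSuitableCategory.hasColimit_nested _ (isNested_comp_objFunctor hD)
  have := IsSuitableCategory.hasColimit_nested _ (isNested_comp_arrFunctor hD)
  exact ⟨⟨isColimitOfPreserves _ hc⟩, ⟨isColimitOfPreserves _ hc⟩⟩

lemma isPullback_colimit_of_components {P A B C : ℕ ⥤ TGraph T} {p : P ⟶ A} {q : P ⟶ B}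
    {f : A ⟶ C} {g : B ⟶ C} (hA : IsNested A) (hB : IsNested B) (hC : IsNested C)
    (h : IsPullback p q f g) {cP : Cocone P} {cA : Cocone A} {cB : Cocone B} {cC : Cocone C}
    (hcP : IsColimit cP) (hcA : IsColimit cA) (hcB : IsColimit cB) (hcC : IsColimit cC)
    (G : TGraph T ⥤ E) [PreservesLimitsOfShape WalkingCospan G]
    (hG : ∀ {D : ℕ ⥤ TGraph T}, IsNested D → ∀ {c : Cocone D}, IsColimit c →
      Nonempty (IsColimit (G.mapCocone c))) :
    IsPullback (G.map (hcP.map cA p)) (G.map (hcP.map cB q)) (G.map (hcA.map cC f))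
      (G.map (hcB.map cC g)) := by
  have hN {D : ℕ ⥤ TGraph T} (hD : IsNested D) : IsNested (D ⋙ G) := fun _ _ k => by
    have := hD k
    exact inferInstanceAs (Mono (G.map (D.map k)))
  have hP : IsNested P := fun m n k => by
    have := hA k
    have := hB k
    refine ⟨fun x y hxy => (h.app m).hom_ext ?_ ?_⟩
    · rw [← cancel_mono (A.map k)]
      simpa using hxy =≫ p.app n
    · rw [← cancel_mono (B.map k)]
      simpa using hxy =≫ q.app n
  obtain ⟨gP⟩ := hG hP hcP
  obtain ⟨gA⟩ := hG hA hcA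
  obtain ⟨gB⟩ := hG hB hcB
  obtain ⟨gC⟩ := hG hC hcC
  have key := IsSuitableCategory.isPullback_colimit_nested (Functor.whiskerRight p G)
    (Functor.whiskerRight q G) (Functor.whiskerRight f G) (Functor.whiskerRight g G)
    (hN hA) (hN hB) (hN hC) (IsPullback.of_forall_isPullback_app fun n => (h.app n).map G)
    (G.mapCocone cP) (G.mapCocone cA) (G.mapCocone cB) (G.mapCocone cC) gP gA gB gC
  have e {D D' : ℕ ⥤ TGraph T} {c : Cocone D} {c' : Cocone D'} (hc : IsColimit c)
      (gc : IsColimit (G.mapCocone c)) (r : D ⟶ D') :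
      gc.map (G.mapCocone c') (Functor.whiskerRight r G) = G.map (hc.map c' r) :=
    gc.hom_ext fun n => by
      rw [IsColimit.ι_map]
      refine Eq.trans ?_ ((congrArg G.map (hc.ι_map c' r n)).symm.trans (G.map_comp _ _))
      exact (G.map_comp _ _).symm
  rwa [e hcP, e hcP, e hcA, e hcB] at key

variable (T) in
/-- The category of `T`-graphs is suitable. -/
lemma isSuitableCategory : IsSuitableCategory (TGraph T) where
  hasFiniteLimits := hasFiniteLimits_of_hasTerminal_and_pullbacks
  hasFiniteCoproducts := ⟨fun n => ⟨fun _ => hasColimit_of_components⟩⟩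
  mono_coprojection J _ X j := by
    have : HasColimit (Discrete.functor X) := hasColimit_of_components
    have h := colimit.isColimit (Discrete.functor X)
    have m₀ : Mono (Sigma.ι X j).onObj := IsSuitableCategory.mono_of_isColimit_discrete
      (isColimitOfPreserves (objFunctor T) h) j
    have m₁ : Mono (Sigma.ι X j).onArr := IsSuitableCategory.mono_of_isColimit_discrete
      (isColimitOfPreserves (arrFunctor T) h) j
    exact mono_of_components (Sigma.ι X j)
  disjoint A B := by
    have : HasColimit (pair A B) := hasColimit_of_components
    have : HasInitial (TGraph T) := ⟨fun _ => hasColimit_of_components⟩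
    exact isPullback_of_components
      (IsSuitableCategory.isPullback_of_isInitial
        (mapIsColimitOfPreservesOfIsColimit (objFunctor T) _ _ (coprodIsCoprod A B))
        (initialIsInitial.isInitialObj (objFunctor T)) _ _)
      (IsSuitableCategory.isPullback_of_isInitial
        (mapIsColimitOfPreservesOfIsColimit (arrFunctor T) _ _ (coprodIsCoprod A B))
        (initialIsInitial.isInitialObj (arrFunctor T)) _ _)
  stable J _ X c hc X' c' α f hα _ H := by
    obtain ⟨h₀⟩ := IsSuitableCategory.stable J _ _ (isColimitOfPreserves (objFunctor T) hc)
      ((objFunctor T).mapCocone c') (Functor.whiskerRight α (objFunctor T)) f.onObj (by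
        ext j; exact congrArg Hom.onObj (NatTrans.congr_app hα j)) (.of_discrete _)
      (fun j => (H j).map (objFunctor T))
    obtain ⟨h₁⟩ := IsSuitableCategory.stable J _ _ (isColimitOfPreserves (arrFunctor T) hc)
      ((arrFunctor T).mapCocone c') (Functor.whiskerRight α (arrFunctor T)) f.onArr (by
        ext j; exact congrArg Hom.onArr (NatTrans.congr_app hα j)) (.of_discrete _)
      (fun j => (H j).map (arrFunctor T))
    exact ⟨isColimitOfComponents h₀ h₁⟩
  hasColimit_nested D hD := by
    have := IsSuitableCategory.hasColimit_nested _ (isNested_comp_objFunctor hD)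
    have := IsSuitableCategory.hasColimit_nested _ (isNested_comp_arrFunctor hD)
    exact hasColimit_of_components
  isPullback_colimit_nested p q f g hA hB hC h cP cA cB cC hcP hcA hcB hcC :=
    isPullback_of_components
      (isPullback_colimit_of_components hA hB hC h hcP hcA hcB hcC (objFunctor T)
        fun hD _ hc => (nonempty_isColimit_of_isNested hD hc).1)
      (isPullback_colimit_of_components hA hB hC h hcP hcA hcB hcC (arrFunctor T)
        fun hD _ hc => (nonempty_isColimit_of_isNested hD hc).2)
  mono_coprojection_nested D hD c hc n := by
    obtain ⟨⟨h₀⟩, ⟨h₁⟩⟩ := nonempty_isColimit_of_isNested hD hc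
    have m₀ : Mono (c.ι.app n).onObj :=
      IsSuitableCategory.mono_coprojection_nested _ (isNested_comp_objFunctor hD) _ h₀ n
    have m₁ : Mono (c.ι.app n).onArr :=
      IsSuitableCategory.mono_coprojection_nested _ (isNested_comp_arrFunctor hD) _ h₁ n
    exact mono_of_components (c.ι.app n)

end TGraph

end

/-! ### Creation of colimits by the forgetful functor -/

noncomputable section

variable {T : Monad E}

namespace TMulticategory

open TGraph

section

variable [HasPullbacks E]

section Glue

variable {ι : Type*} {C : ι → TMulticategory T} {G : TGraph T} {x : ∀ j, (C j).toTGraph ⟶ G}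
  {m : G.act G.arr.cod ⟶ G.arr.apex} {i : G.obj ⟶ G.arr.apex}
  (hm : ∀ j, (C j).m ≫ (x j).onArr =
    actMap (w := (C j).arr.cod) (z := G.arr.cod) (x j) (x j).onArr (x j).onArr_cod ≫ m)
  (hi : ∀ j, (C j).i ≫ (x j).onArr = (x j).onObj ≫ i)
  (epi₀ : ∀ {Z : E} {a b : G.obj ⟶ Z}, (∀ j, (x j).onObj ≫ a = (x j).onObj ≫ b) → a = b)
  (epi₁ : ∀ {Z : E} {a b : G.arr.apex ⟶ Z}, (∀ j, (x j).onArr ≫ a = (x j).onArr ≫ b) → a = b)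
  (epi₂ : ∀ {Z : E} {a b : G.act G.arr.cod ⟶ Z},
    (∀ j, actMap (w := (C j).arr.cod) (z := G.arr.cod) (x j) (x j).onArr (x j).onArr_cod ≫ a =
      actMap (w := (C j).arr.cod) (z := G.arr.cod) (x j) (x j).onArr (x j).onArr_cod ≫ b) → a = b)
  (epi₃ : ∀ {Z : E} {a b : G.act (G.actSnd G.arr.cod ≫ G.arr.cod) ⟶ Z},
    (∀ j, actMap (w := (C j).actSnd (C j).arr.cod ≫ (C j).arr.cod)
        (z := G.actSnd G.arr.cod ≫ G.arr.cod) (x j) (actMap (x j) (x j).onArr (x j).onArr_cod)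
        (by simp [(x j).onArr_cod]) ≫ a =
      actMap (w := (C j).actSnd (C j).arr.cod ≫ (C j).arr.cod)
        (z := G.actSnd G.arr.cod ≫ G.arr.cod) (x j) (actMap (x j) (x j).onArr (x j).onArr_cod)
        (by simp [(x j).onArr_cod]) ≫ b) → a = b)

-- Every law to be proved for `G`, here and in the lemmas below, equates two maps out of its
-- objects, arrows, pairs or triples. Precomposed with the jointly epic family of maps from the `C
-- j`, it reduces to the same law in `C j`.
include hm epi₂ in
lemma glue_m_dom : m ≫ G.arr.dom = G.actFst G.arr.cod ≫ T.map G.arr.dom ≫ T.μ.app G.obj := by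
  refine epi₂ fun j => ?_
  have hμ : T.map (T.map (x j).onObj) ≫ T.μ.app G.obj = T.μ.app (C j).obj ≫ T.map (x j).onObj :=
    T.μ.naturality _
  rw [← reassoc_of% hm, (x j).onArr_dom, reassoc_of% m_dom, actMap_actFst_assoc,
    ← T.map_comp_assoc, (x j).onArr_dom, T.map_comp_assoc, hμ]

include hm epi₂ in
lemma glue_m_cod : m ≫ G.arr.cod = G.actSnd G.arr.cod ≫ G.arr.cod := by
  refine epi₂ fun j => ?_
  rw [← reassoc_of% hm, (x j).onArr_cod, reassoc_of% m_cod, actMap_actSnd_assoc, (x j).onArr_cod]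

include hi epi₀ in
lemma glue_i_dom : i ≫ G.arr.dom = T.η.app G.obj := by
  refine epi₀ fun j => ?_
  rw [← reassoc_of% hi, (x j).onArr_dom, reassoc_of% i_dom]
  exact (T.η.naturality _).symm

include hi epi₀ in
lemma glue_i_cod : i ≫ G.arr.cod = 𝟙 _ := by
  refine epi₀ fun j => ?_
  rw [← reassoc_of% hi, (x j).onArr_cod, reassoc_of% i_cod, Category.comp_id]

include hm epi₃ in
lemma glue_m_assoc (hd : m ≫ G.arr.dom = G.actFst G.arr.cod ≫ T.map G.arr.dom ≫ T.μ.app G.obj)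
    (hc : m ≫ G.arr.cod = G.actSnd G.arr.cod ≫ G.arr.cod) :
    actMap (𝟙 G) m (hc.trans (Category.comp_id _).symm) ≫ m = actAssoc G hd ≫ m := by
  refine epi₃ fun j => ?_
  have e : actMap (w := (C j).actSnd (C j).arr.cod ≫ (C j).arr.cod)
      (z := G.actSnd G.arr.cod ≫ G.arr.cod) (x j) (actMap (x j) (x j).onArr (x j).onArr_cod)
      (by simp [(x j).onArr_cod]) ≫ actAssoc (b := G.arr.cod) G hd =
        actAssoc (b := (C j).arr.cod) (C j).toTGraph (C j).m_dom ≫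
          actMap (w := (C j).arr.cod) (z := G.arr.cod) (x j) (x j).onArr (x j).onArr_cod := by
    have hμ : T.map (T.map (x j).onArr) ≫ T.μ.app _ = T.μ.app _ ≫ T.map (x j).onArr :=
      T.μ.naturality _
    apply act_hom_ext
    · simp only [Category.assoc, actAssoc_actFst, actMap_actFst, actMap_actFst_assoc,
        reassoc_of% actAssoc_actFst, ← hμ, ← T.map_comp_assoc]
    · simp only [Category.assoc, actAssoc_actSnd, actMap_actSnd, reassoc_of% actAssoc_actSnd, hm]
      rw [actMap_comp_assoc, actMap_comp_assoc]
      simp only [actMap_actSnd, Category.comp_id, Category.id_comp]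
  rw [reassoc_of% e, ← hm, ← reassoc_of% m_assoc, hm, actMap_comp_assoc, actMap_comp_assoc]
  simp only [← hm, Category.comp_id, Category.id_comp]

include hm hi epi₁ in
lemma glue_unit_left (id : i ≫ G.arr.dom = T.η.app G.obj) :
    actLift (T.η.app G.arr.apex) (G.arr.cod ≫ i) (by
      rw [Category.assoc, id]; exact (T.η.naturality _).symm) ≫ m = 𝟙 _ := by
  refine epi₁ fun j => ?_
  have e : (x j).onArr ≫ actLift (T.η.app G.arr.apex) (G.arr.cod ≫ i) (by
      rw [Category.assoc, id]; exact (T.η.naturality _).symm) =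
      actLift (T.η.app (C j).arr.apex) ((C j).arr.cod ≫ (C j).i) (by
        rw [Category.assoc, i_dom]; exact (T.η.naturality _).symm) ≫
      actMap (w := (C j).arr.cod) (z := G.arr.cod) (x j) (x j).onArr (x j).onArr_cod := by
    apply act_hom_ext
    · simp only [Category.assoc, actLift_actFst, actMap_actFst, actLift_actFst_assoc]
      exact T.η.naturality _
    · simp only [Category.assoc, actLift_actSnd, actMap_actSnd, actLift_actSnd_assoc, hi]
      rw [reassoc_of% (x j).onArr_cod]
  have hu := (C j).unit_left
  rw [reassoc_of% e, ← hm, reassoc_of% hu]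
  exact (Category.comp_id _).symm

include hm hi epi₁ in
lemma glue_unit_right (ic : i ≫ G.arr.cod = 𝟙 _) :
    actLift (G.arr.dom ≫ T.map i) (𝟙 _) (by
      rw [Category.assoc, ← T.map_comp, ic]; simp) ≫ m = 𝟙 _ := by
  refine epi₁ fun j => ?_
  have e : (x j).onArr ≫ actLift (G.arr.dom ≫ T.map i) (𝟙 _) (by
      rw [Category.assoc, ← T.map_comp, ic]; simp) =
      actLift ((C j).arr.dom ≫ T.map (C j).i) (𝟙 _) (by
        rw [Category.assoc, ← T.map_comp, i_cod]; simp) ≫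
      actMap (w := (C j).arr.cod) (z := G.arr.cod) (x j) (x j).onArr (x j).onArr_cod := by
    apply act_hom_ext
    · simp only [Category.assoc, actLift_actFst, actMap_actFst, actLift_actFst_assoc,
        ← T.map_comp, hi]
      rw [T.map_comp, reassoc_of% (x j).onArr_dom]
    · simp only [Category.assoc, actLift_actSnd, actMap_actSnd, actLift_actSnd_assoc,
        Category.comp_id, Category.id_comp]
  have hu := (C j).unit_right
  rw [reassoc_of% e, ← hm, reassoc_of% hu]
  exact (Category.comp_id _).symm

/-- The structure of a `T`-multicategory on a `T`-graph covered by `T`-multicategories. -/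
abbrev glue : TMulticategory T :=
  ofAct G m i (glue_m_dom hm epi₂) (glue_m_cod hm epi₂) (glue_i_dom hi epi₀) (glue_i_cod hi epi₀)
    (glue_m_assoc hm epi₃ (glue_m_dom hm epi₂) (glue_m_cod hm epi₂))
    (glue_unit_left hm hi epi₁ (glue_i_dom hi epi₀))
    (glue_unit_right hm hi epi₁ (glue_i_cod hi epi₀))

end Glue

end

end TMulticategory

namespace TGraph

variable [HasPullbacks E]

variable (T) in
/-- The object of composable pairs of arrows of a `T`-graph. -/
abbrev pairFunctor : TGraph T ⥤ E :=
  actDiagram (𝟭 (TGraph T)) (arrFunctor T) (fun X => X.arr.cod) (fun f => f.onArr_cod)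

variable (T) in
/-- The object of composable triples of arrows of a `T`-graph. -/
abbrev tripleFunctor : TGraph T ⥤ E :=
  actDiagram (𝟭 (TGraph T)) (pairFunctor T) (fun X => X.actSnd X.arr.cod ≫ X.arr.cod)
    (fun f => by
      refine (actMap_actSnd_assoc f f.onArr f.onArr_cod _).trans ?_
      rw [f.onArr_cod]
      exact (Category.assoc _ _ _).symm)

end TGraph

namespace TMulticategory

open TGraph

variable [HasPullbacks E] {J : Type*} [Category* J] {D : J ⥤ TMulticategory T}

/-- The forgetful functor creates those colimits of graphs which are preserved by the functors
assigning to a graph its objects, its arrows, and its composable pairs and triples of arrows. -/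
lemma exists_isColimit_forget {c : Cocone (D ⋙ forget T)} (hc : IsColimit c)
    (h₀ : IsColimit ((objFunctor T).mapCocone c)) (h₁ : IsColimit ((arrFunctor T).mapCocone c))
    (h₂ : IsColimit ((pairFunctor T).mapCocone c))
    (h₃ : IsColimit ((tripleFunctor T).mapCocone c)) :
    ∃ c' : Cocone D, Nonempty (IsColimit c') ∧ Nonempty (IsColimit ((forget T).mapCocone c')) := by
  let G : TGraph T := c.pt
  let x (j : J) : (D.obj j).toTGraph ⟶ G := c.ι.app j
  have hx {j k : J} (f : j ⟶ k) : (D.map f).toGraphHom ≫ x k = x j := c.w f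
  have hx₁ {j k : J} (f : j ⟶ k) : (D.map f).toGraphHom.onArr ≫ (x k).onArr = (x j).onArr :=
    congrArg Hom.onArr (hx f)
  let s₀ : Cocone ((D ⋙ forget T) ⋙ objFunctor T) :=
    ⟨G.arr.apex, ⟨fun j => (D.obj j).i ≫ (x j).onArr, fun j k f => by
      refine Eq.trans ?_ (Category.comp_id _).symm
      refine (reassoc_of% (D.map f).onArr_i) (x k).onArr |>.symm.trans ?_
      rw [hx₁ f]
      rfl⟩⟩
  -- Identities descend from the colimit of objects and, below, composition from the colimit of
  -- composable pairs. Triples serve only for associativity.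
  obtain ⟨i, hi⟩ : ∃ i : G.obj ⟶ G.arr.apex,
      ∀ j, (D.obj j).i ≫ (x j).onArr = (x j).onObj ≫ i :=
    ⟨h₀.desc s₀, fun j => (h₀.fac s₀ j).symm⟩
  let s₂ : Cocone ((D ⋙ forget T) ⋙ pairFunctor T) :=
    ⟨G.arr.apex, ⟨fun j => (D.obj j).m ≫ (x j).onArr, fun j k f => by
      refine Eq.trans ?_ (Category.comp_id _).symm
      refine (reassoc_of% (D.map f).onArr_m) (x k).onArr |>.symm.trans ?_
      rw [hx₁ f]
      rfl⟩⟩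
  obtain ⟨m, hm⟩ : ∃ m : G.act G.arr.cod ⟶ G.arr.apex, ∀ j, (D.obj j).m ≫ (x j).onArr =
      actMap (w := (D.obj j).arr.cod) (z := G.arr.cod) (x j) (x j).onArr (x j).onArr_cod ≫ m :=
    ⟨h₂.desc s₂, fun j => (h₂.fac s₂ j).symm⟩
  let K : TMulticategory T := glue (C := D.obj) (x := x) hm hi h₀.hom_ext h₁.hom_ext h₂.hom_ext
    h₃.hom_ext
  let c' : Cocone D := ⟨K, ⟨fun j => homMk (D := K) (x j) (hi j) (hm j), fun j k f =>
    TMulticategory.hom_ext ((hx f).trans (Category.comp_id _).symm)⟩⟩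
  refine ⟨c', ⟨?_⟩, ⟨hc⟩⟩
  -- The factorisation is the one of graphs; that it preserves identities and composition is tested
  -- on the colimits of objects and of pairs.
  refine
    { desc := fun s => homMk (C := K) (hc.desc ((forget T).mapCocone s)) ?_ ?_
      fac := fun s j => TMulticategory.hom_ext (hc.fac ((forget T).mapCocone s) j)
      uniq := fun s r hr => TMulticategory.hom_ext (hc.uniq ((forget T).mapCocone s) r.toGraphHom
        fun j => congrArg Hom.toGraphHom (hr j)) }
  all_goals
    obtain ⟨d, hd⟩ : ∃ d : G ⟶ s.pt.toTGraph, d = hc.desc ((forget T).mapCocone s) := ⟨_, rfl⟩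
    have hd' (j : J) : x j ≫ d = (s.ι.app j).toGraphHom := by
      rw [hd]; exact hc.fac _ j
    have hd₁ (j : J) : (x j).onArr ≫ d.onArr = (s.ι.app j).toGraphHom.onArr :=
      congrArg Hom.onArr (hd' j)
    have hd₀ (j : J) : (x j).onObj ≫ d.onObj = (s.ι.app j).toGraphHom.onObj :=
      congrArg Hom.onObj (hd' j)
    rw [← hd]
  · change i ≫ d.onArr = d.onObj ≫ s.pt.i
    refine h₀.hom_ext fun j => ?_
    change (x j).onObj ≫ i ≫ d.onArr = (x j).onObj ≫ d.onObj ≫ s.pt.i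
    rw [← reassoc_of% hi j, hd₁, reassoc_of% hd₀]
    exact (s.ι.app j).onArr_i
  · change m ≫ d.onArr = actMap (w := G.arr.cod) (z := s.pt.arr.cod) d d.onArr d.onArr_cod ≫ s.pt.m
    refine h₂.hom_ext fun j => ?_
    change actMap (w := (D.obj j).arr.cod) (z := G.arr.cod) (x j) (x j).onArr (x j).onArr_cod ≫
      m ≫ d.onArr = actMap (w := (D.obj j).arr.cod) (z := G.arr.cod) (x j) (x j).onArr
        (x j).onArr_cod ≫
        actMap (w := G.arr.cod) (z := s.pt.arr.cod) d d.onArr d.onArr_cod ≫ s.pt.m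
    rw [← reassoc_of% hm j, hd₁, actMap_comp_assoc]
    simp only [hd₁, hd']
    exact (s.ι.app j).onArr_m

instance reflectsIsomorphisms_forget : (forget T).ReflectsIsomorphisms where
  reflects {C D} g hg := by
    obtain ⟨h, e₁, e₂⟩ : ∃ h : D.toTGraph ⟶ C.toTGraph, g.toGraphHom ≫ h = 𝟙 _ ∧
      h ≫ g.toGraphHom = 𝟙 _ := hg.out
    have a₁ : g.toGraphHom.onArr ≫ h.onArr = 𝟙 _ := congrArg Hom.onArr e₁
    have b₁ : h.onObj ≫ g.toGraphHom.onObj = 𝟙 _ := congrArg Hom.onObj e₂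
    have hi : D.i ≫ h.onArr = h.onObj ≫ C.i := by
      rw [← Category.comp_id C.i, ← a₁, reassoc_of% g.onArr_i, reassoc_of% b₁]
    have hm : D.m ≫ h.onArr = actMap (w := D.arr.cod) (z := C.arr.cod) h h.onArr h.onArr_cod ≫
        C.m := by
      have b₁' : h.onArr ≫ g.toGraphHom.onArr = 𝟙 _ := congrArg Hom.onArr e₂
      rw [← Category.comp_id C.m, ← a₁, reassoc_of% g.onArr_m, actMap_comp_assoc]
      simp only [b₁', e₂]
      rw [actMap_id, Category.id_comp]
    exact ⟨homMk h hi hm, TMulticategory.hom_ext e₁, TMulticategory.hom_ext e₂⟩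

end TMulticategory

end

/-! ### Monadicity and preservation of nested colimits -/

noncomputable section

variable {T : Monad E}

namespace TMulticategory

open TGraph

section

variable [HasPullbacks E] {J : Type*} [Category* J] (D : J ⥤ TMulticategory T)
  [HasColimit (D ⋙ forget T)] [PreservesColimit (D ⋙ forget T) (objFunctor T)]
  [PreservesColimit (D ⋙ forget T) (arrFunctor T)]
  [PreservesColimit (D ⋙ forget T) (pairFunctor T)]
  [PreservesColimit (D ⋙ forget T) (tripleFunctor T)]

lemma hasColimit_of_forget : HasColimit D := by
  have hc := colimit.isColimit (D ⋙ forget T)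
  obtain ⟨c, ⟨h⟩, -⟩ := exists_isColimit_forget hc (isColimitOfPreserves _ hc)
    (isColimitOfPreserves _ hc) (isColimitOfPreserves _ hc) (isColimitOfPreserves _ hc)
  exact ⟨⟨c, h⟩⟩

lemma preservesColimit_forget : PreservesColimit D (forget T) := by
  have hc := colimit.isColimit (D ⋙ forget T)
  obtain ⟨c, ⟨h⟩, ⟨h'⟩⟩ := exists_isColimit_forget hc (isColimitOfPreserves _ hc)
    (isColimitOfPreserves _ hc) (isColimitOfPreserves _ hc) (isColimitOfPreserves _ hc)
  exact preservesColimit_of_preserves_colimit_cocone h h'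

end

section

variable [HasPullbacks E] {C D : TMulticategory T} (f g : C ⟶ D) [(forget T).IsSplitPair f g]

lemma hasColimit_parallelPair_comp_forget : HasColimit (parallelPair f g ⋙ forget T) := by
  rw [hasColimit_iff_of_iso (diagramIsoParallelPair _)]
  exact inferInstanceAs <| HasCoequalizer ((forget T).map f) ((forget T).map g)

/-- Split coequalizers are absolute, so any `H` preserves them; in particular the functors of pairs
and triples do. -/
lemma preservesColimit_parallelPair_comp_forget (H : TGraph T ⥤ E) :
    PreservesColimit (parallelPair f g ⋙ forget T) H := by
  have : PreservesColimit (parallelPair ((parallelPair f g ⋙ forget T).map .left)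
      ((parallelPair f g ⋙ forget T).map .right)) H :=
    inferInstanceAs (PreservesColimit (parallelPair ((forget T).map f) ((forget T).map g)) H)
  exact preservesColimit_of_iso_diagram H (diagramIsoParallelPair (parallelPair f g ⋙ forget T)).symm

/-- `T`-multicategories are monadic over `T`-graphs. -/
lemma isEquivalence_comparison {F : TGraph T ⥤ TMulticategory T} (adj : F ⊣ forget T) :
    (Monad.comparison adj).IsEquivalence := by
  have : Monad.HasCoequalizerOfIsSplitPair (forget T) := ⟨fun f g _ => by
    have := hasColimit_parallelPair_comp_forget f g
    have := preservesColimit_parallelPair_comp_forget f g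
    exact hasColimit_of_forget _⟩
  have : Monad.PreservesColimitOfIsSplitPair (forget T) := ⟨fun f g _ => by
    have := hasColimit_parallelPair_comp_forget f g
    have := preservesColimit_parallelPair_comp_forget f g
    exact preservesColimit_forget _⟩
  exact (Monad.monadicOfHasPreservesGSplitCoequalizersOfReflectsIsomorphisms adj).eqv

end

section

variable [IsSuitableCategory E] [IsSuitableMonad T]

lemma preservesColimit_pairFunctor {D : ℕ ⥤ TGraph T} (hD : IsNested D) :
    PreservesColimit D (pairFunctor T) where
  preserves {c} hc := by
    obtain ⟨⟨h₀⟩, ⟨h₁⟩⟩ := nonempty_isColimit_of_isNested hD hc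
    exact nonempty_isColimit_actCocone (D := D) (W := D ⋙ arrFunctor T)
      (w := fun n => (D.obj n).arr.cod) (fun k => (D.map k).onArr_cod) (cD := c)
      (cW := (arrFunctor T).mapCocone c) c.pt.arr.cod (fun n => (c.ι.app n).onArr_cod)
      (isNested_comp_arrFunctor hD) (isNested_comp_objFunctor hD) (isNested_comp_arrFunctor hD)
      h₁ h₀ h₁

lemma isNested_comp_pairFunctor {D : ℕ ⥤ TGraph T} (hD : IsNested D) :
    IsNested (D ⋙ pairFunctor T) := fun m n k => by
  have : Mono (D.map k).onArr := isNested_comp_arrFunctor hD k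
  exact mono_actMap (D.map k) (D.map k).onArr (D.map k).onArr_cod

lemma preservesColimit_tripleFunctor {D : ℕ ⥤ TGraph T} (hD : IsNested D) :
    PreservesColimit D (tripleFunctor T) where
  preserves {c} hc := by
    obtain ⟨⟨h₀⟩, ⟨h₁⟩⟩ := nonempty_isColimit_of_isNested hD hc
    have := preservesColimit_pairFunctor hD
    have hw {X Y : TGraph T} (f : X ⟶ Y) :
        actMap (w := X.arr.cod) (z := Y.arr.cod) f f.onArr f.onArr_cod ≫
          Y.actSnd Y.arr.cod ≫ Y.arr.cod = (X.actSnd X.arr.cod ≫ X.arr.cod) ≫ f.onObj := by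
      rw [actMap_actSnd_assoc, f.onArr_cod, Category.assoc]
    exact nonempty_isColimit_actCocone (D := D) (W := D ⋙ pairFunctor T)
      (w := fun n => (D.obj n).actSnd (D.obj n).arr.cod ≫ (D.obj n).arr.cod)
      (fun k => hw (D.map k)) (cD := c)
      (cW := (pairFunctor T).mapCocone c) (c.pt.actSnd c.pt.arr.cod ≫ c.pt.arr.cod)
      (fun n => hw (c.ι.app n))
      (isNested_comp_pairFunctor hD) (isNested_comp_objFunctor hD) (isNested_comp_arrFunctor hD)
      (isColimitOfPreserves _ hc) h₀ h₁

lemma preservesColimit_forget_of_isNested {D : ℕ ⥤ TMulticategory T}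
    (hD : IsNested (D ⋙ forget T)) : PreservesColimit D (forget T) := by
  have := TGraph.isSuitableCategory T
  have := IsSuitableCategory.hasColimit_nested _ hD
  have := preservesColimit_pairFunctor hD
  have := preservesColimit_tripleFunctor hD
  have : PreservesColimit (D ⋙ forget T) (objFunctor T) :=
    ⟨fun hc => (nonempty_isColimit_of_isNested hD hc).1⟩
  have : PreservesColimit (D ⋙ forget T) (arrFunctor T) :=
    ⟨fun hc => (nonempty_isColimit_of_isNested hD hc).2⟩
  exact preservesColimit_forget _

/-- The left adjoint `F` preserves all colimits. Preservation of monomorphisms keeps the image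
sequence nested in graphs, where the forgetful functor preserves its colimit. -/
lemma preservesColimit_toMonad {F : TGraph T ⥤ TMulticategory T} (adj : F ⊣ forget T)
    [(F ⋙ forget T).PreservesMonomorphisms] {D : ℕ ⥤ TGraph T} (hD : IsNested D) :
    PreservesColimit D (F ⋙ forget T) := by
  have : F.IsLeftAdjoint := ⟨_, ⟨adj⟩⟩
  have : PreservesColimit (D ⋙ F) (forget T) := preservesColimit_forget_of_isNested fun _ _ k => by
    have := hD k
    exact inferInstanceAs (Mono ((F ⋙ forget T).map (D.map k)))
  infer_instance

end

end TMulticategory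

end

/-! ### Cartesian maps of exhausted algebras -/

noncomputable section

variable {T : Monad E} [IsSuitableCategory E] [IsSuitableMonad T]

namespace TGraph

namespace Exhaustion

variable {X Y : TGraph T} {B C : E} {W : Alg X B} {Z : Alg Y C}

/-- An exhausted algebra is the coproduct of its family and its operations, and `h` respects both
summands; extensivity makes this square and the next one pullbacks, whatever `f` and `k` are. -/
lemma isPullback_β (e : Exhaustion W) (e' : Exhaustion Z) {f : X ⟶ Y} {k : B ⟶ C}
    {h : W.pt ⟶ Z.pt} (H : IsAlgMap f k W Z h) : IsPullback W.β k h Z.β :=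
  IsSuitableCategory.isPullback_inl e.nonempty_isColimit.some e'.nonempty_isColimit.some H.β H.σ

lemma isPullback_σ (e : Exhaustion W) (e' : Exhaustion Z) {f : X ⟶ Y} {k : B ⟶ C}
    {h : W.pt ⟶ Z.pt} (H : IsAlgMap f k W Z h) : IsPullback W.σ (actMap f h H.p) h Z.σ :=
  IsSuitableCategory.isPullback_inr e.nonempty_isColimit.some e'.nonempty_isColimit.some H.β H.σ

/-- A square of algebras over a pullback square of `T`-graphs is a pullback if it is the square
of a recursively defined map of exhausted algebras and the structure maps of its targets are
cartesian. -/
lemma isPullback_of_isAlgMap (e : Exhaustion W) (e' : Exhaustion Z) {X' Y' : TGraph T}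
    {B' C' : E} {U : Alg X' B'} {V : Alg Y' C'} {f : X ⟶ Y} {g : X ⟶ X'} {f' : X' ⟶ Y'}
    {g' : Y ⟶ Y'} (h₀ : IsPullback g.onObj f.onObj f'.onObj g'.onObj)
    (h₁ : IsPullback g.onArr f.onArr f'.onArr g'.onArr)
    {k : B ⟶ C} {l : B ⟶ B'} {k' : B' ⟶ C'} {l' : C ⟶ C'} (hB : IsPullback l k k' l')
    {w : W.pt ⟶ Z.pt} {r : W.pt ⟶ U.pt} {u : U.pt ⟶ V.pt} {s : Z.pt ⟶ V.pt}
    (hw : IsAlgMap f k W Z w) (hr : IsAlgMap g l W U r) (hu : IsAlgMap f' k' U V u)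
    (hs : IsAlgMap g' l' Z V s) (hβ : IsPullback U.β k' u V.β)
    (hσ : IsPullback U.σ (actMap f' u hu.p) u V.σ) : IsPullback r w u s := by
  have hfg : f ≫ g' = g ≫ f' := (TGraph.hom_ext h₀.w h₁.w).symm
  have hrw : r ≫ u = w ≫ s := by
    have H := hw.comp hs
    rw [hfg, ← hB.w] at H
    exact e.algMap_unique (hr.comp hu) H
  -- The actual pullback `Q` is given an algebra structure over `X` with family `B`, so that it can
  -- be compared with `W`.
  obtain ⟨Q, x, y, hQ⟩ : ∃ (Q : E) (x : Q ⟶ U.pt) (y : Q ⟶ Z.pt), IsPullback x y u s :=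
    ⟨_, _, _, IsPullback.of_hasPullback u s⟩
  have ep : (x ≫ U.p) ≫ f'.onObj = (y ≫ Z.p) ≫ g'.onObj := by
    rw [Category.assoc, Category.assoc, ← hu.p, ← hs.p, hQ.w_assoc]
  obtain ⟨p, hp₁, hp₂⟩ : ∃ p : Q ⟶ X.obj, p ≫ g.onObj = x ≫ U.p ∧ p ≫ f.onObj = y ≫ Z.p :=
    ⟨h₀.lift _ _ ep, h₀.lift_fst _ _ ep, h₀.lift_snd _ _ ep⟩
  have eb : (l ≫ U.β) ≫ u = (k ≫ Z.β) ≫ s := by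
    rw [Category.assoc, Category.assoc, hu.β, hs.β, hB.w_assoc]
  obtain ⟨b, hb₁, hb₂⟩ : ∃ b : B ⟶ Q, b ≫ x = l ≫ U.β ∧ b ≫ y = k ≫ Z.β :=
    ⟨hQ.lift _ _ eb, hQ.lift_fst _ _ eb, hQ.lift_snd _ _ eb⟩
  have es : (actMap g x hp₁.symm ≫ U.σ) ≫ u = (actMap f y hp₂.symm ≫ Z.σ) ≫ s := by
    rw [Category.assoc, Category.assoc, hu.σ, hs.σ, actMap_comp_assoc, actMap_comp_assoc]
    simp only [hQ.w, hfg]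
  obtain ⟨q, hq₁, hq₂⟩ : ∃ q : X.act p ⟶ Q, q ≫ x = actMap g x hp₁.symm ≫ U.σ ∧
      q ≫ y = actMap f y hp₂.symm ≫ Z.σ :=
    ⟨hQ.lift _ _ es, hQ.lift_fst _ _ es, hQ.lift_snd _ _ es⟩
  let P : Alg X B :=
    { pt := Q
      p := p
      β := b
      σ := q
      σ_p := h₀.hom_ext
        (by rw [Category.assoc, hp₁, reassoc_of% hq₁, U.σ_p, actMap_actSnd_assoc, g.onArr_cod,
          Category.assoc])
        (by rw [Category.assoc, hp₂, reassoc_of% hq₂, Z.σ_p, actMap_actSnd_assoc, f.onArr_cod,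
          Category.assoc]) }
  have hy : IsAlgMap f k P Z y := ⟨hp₂.symm, hb₂, hq₂⟩
  -- The structure squares of `Q` over `Z` are pullbacks because, pasted with `hQ`, they become
  -- pasted pullbacks over `U ⟶ V`. So `Q` is exhausted, and the canonical algebra map from `W` is
  -- invertible.
  obtain ⟨eP⟩ := e'.nonempty_of_isPullback hy
    (IsPullback.of_right (by
      rw [hs.β, show P.β ≫ x = l ≫ U.β from hb₁]
      exact hB.paste_horiz hβ) hb₂ hQ)
    (IsPullback.of_right (by
      rw [hs.σ, show P.σ ≫ x = _ from hq₁]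
      exact (isPullback_actMap h₀ h₁ hQ hp₁.symm hp₂.symm hu.p hs.p).paste_horiz hσ) hq₂ hQ)
  have hz : IsAlgMap (𝟙 X) (𝟙 B) W P (hQ.lift r w hrw) := by
    have hz₁ : hQ.lift r w hrw ≫ x = r := hQ.lift_fst _ _ _
    have hz₂ : hQ.lift r w hrw ≫ y = w := hQ.lift_snd _ _ _
    have hzp : hQ.lift r w hrw ≫ p = W.p ≫ Hom.onObj (𝟙 X) := h₀.hom_ext
      (by rw [Category.assoc, hp₁, reassoc_of% hz₁, hr.p]; simp)
      (by rw [Category.assoc, hp₂, reassoc_of% hz₂, hw.p]; simp)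
    refine ⟨hzp, hQ.hom_ext ?_ ?_, hQ.hom_ext ?_ ?_⟩
    · rw [Category.assoc, hz₁, hr.β, Category.assoc, hb₁, Category.id_comp]
    · rw [Category.assoc, hz₂, hw.β, Category.assoc, hb₂, Category.id_comp]
    · rw [Category.assoc, hz₁, hr.σ, Category.assoc, hq₁, actMap_comp_assoc]
      simp only [hz₁, Category.id_comp]
    · rw [Category.assoc, hz₂, hw.σ, Category.assoc, hq₂, actMap_comp_assoc]
      simp only [hz₂, Category.id_comp]
  have := e.isIso_of_isAlgMap eP hz
  exact hQ.of_iso (asIso (hQ.lift r w hrw)).symm (Iso.refl _) (Iso.refl _) (Iso.refl _)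
    (by simp) (by simp) (by simp) (by simp)

end Exhaustion

section FreeMap

variable {X Y : TGraph T} {f : X ⟶ Y} {h : X.freeAlg.pt ⟶ Y.freeAlg.pt}

/-- The universal property yields algebra maps into the arrows of `Y.free` over its free graph. As
composing with generators is the action of `Y`, they are algebra maps into the free algebra over `f`
itself. -/
lemma isAlgMap_freeAlg_of_freeUnit {B : E} {W : Alg X B} {k : B ⟶ Y.obj} {g : X ⟶ Y.freeGraph}
    {h : W.pt ⟶ Y.freeAlg.pt} (hg : g = f ≫ Y.freeUnit) (H : IsAlgMap g k W Y.free.toAlg h) :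
    IsAlgMap f k W Y.freeAlg h := by
  subst hg
  have Hp : h ≫ Y.freeAlg.p = W.p ≫ f.onObj := H.p.trans (by simp)
  have Hσ : W.σ ≫ h = actMap (z := Y.freeAlg.p) (f ≫ Y.freeUnit) h (Hp.trans (by simp)) ≫
    Y.freeMul := H.σ
  refine ⟨Hp, H.β, ?_⟩
  rw [Hσ, ← actMap_freeUnit_freeMul, actMap_comp_assoc]
  simp only [Category.comp_id]

lemma IsAlgMap.comp_freeDom (H : IsAlgMap f f.onObj X.freeAlg Y.freeAlg h) :
    h ≫ Y.freeDom = X.freeDom ≫ T.map f.onObj := by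
  refine X.freeExhaustion.hom_ext ?_ fun i hi => ?_
  · rw [reassoc_of% H.β, β_freeDom, reassoc_of% X.β_freeDom]
    exact T.η.naturality _
  · have hμ : T.map (T.map f.onObj) ≫ T.μ.app Y.obj = T.μ.app X.obj ≫ T.map f.onObj :=
      T.μ.naturality _
    rw [reassoc_of% H.σ, σ_freeDom, actMap_comp_assoc, reassoc_of% X.σ_freeDom,
      actMap_actFst_assoc, actMap_actFst_assoc, ← hμ, ← T.map_comp_assoc, ← T.map_comp_assoc,
      Category.assoc, hi]
    simp only [T.map_comp, Category.assoc]

/-- The map of graphs of a map of free algebras. -/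
abbrev freeMapGraph (H : IsAlgMap f f.onObj X.freeAlg Y.freeAlg h) : X.freeGraph ⟶ Y.freeGraph where
  onObj := f.onObj
  onArr := h
  onArr_dom := H.comp_freeDom
  onArr_cod := H.p

lemma isAlgMap_actMap_freeMapGraph (H : IsAlgMap f f.onObj X.freeAlg Y.freeAlg h) {B C : E}
    {b : B ⟶ X.obj} {c : C ⟶ Y.obj} (k : B ⟶ C) (hk : k ≫ c = b ≫ f.onObj) :
    IsAlgMap f k (X.compAlg b) (Y.compAlg c) (actMap (freeMapGraph H) k hk) where
  p := by
    simp [H.p]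
  β := by
    apply act_hom_ext
    · simp only [Category.assoc, actMap_actFst, reassoc_of% compβ_actFst, compβ_actFst]
      exact (T.η.naturality k).symm
    · simp [reassoc_of% hk, reassoc_of% compβ_actSnd, H.β]
  σ := by
    have hμ : T.map (T.map k) ≫ T.μ.app C = T.μ.app B ≫ T.map k := T.μ.naturality k
    apply act_hom_ext
    · simp only [Category.assoc, actMap_actFst, reassoc_of% compσ_actFst, compσ_actFst,
        actMap_actFst_assoc, ← hμ, ← T.map_comp_assoc]
    · simp only [Category.assoc, actMap_actSnd, reassoc_of% compσ_actSnd, compσ_actSnd, H.σ]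
      rw [actMap_comp_assoc, actMap_comp_assoc]
      simp only [actMap_actSnd, Category.comp_id, Category.id_comp]

/-- The composition of free `T`-multicategories is cartesian. -/
lemma isPullback_freeMul (H : IsAlgMap f f.onObj X.freeAlg Y.freeAlg h) :
    IsPullback X.freeMul (actMap (w := X.freeAlg.p) (z := Y.freeAlg.p) (freeMapGraph H) h H.p) h
      Y.freeMul :=
  -- Composition is an algebra map over the identity, so the base square is trivial; what remains is
  -- that the operations of the free algebras are cartesian.
  (X.compExhaustion _).isPullback_of_isAlgMap (Y.compExhaustion _) (IsPullback.id_horiz f.onObj)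
    (IsPullback.id_horiz f.onArr) (IsPullback.id_horiz h)
    (isAlgMap_actMap_freeMapGraph H h H.p) X.isAlgMap_freeMul
    (H.reindex (l := 𝟙 _) (l' := 𝟙 _) (k' := h) (by simp)) Y.isAlgMap_freeMul
    (IsPullback.id_horiz h) (X.freeExhaustion.isPullback_σ Y.freeExhaustion H)

/-- The inclusion of generators is cartesian. -/
lemma isPullback_generator (H : IsAlgMap f f.onObj X.freeAlg Y.freeAlg h) :
    IsPullback X.generator f.onArr h Y.generator := by
  -- The generator factors as `X₁ ≅ act 1`, then `act` of the inclusion of identities, then the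
  -- action; each factor has a cartesian square.
  let a (X : TGraph T) : X.arr.apex ⟶ X.act (𝟙 X.obj) :=
    actLift X.arr.dom (𝟙 _) (by rw [T.map_id]; simp)
  have ha (X : TGraph T) : IsIso (a X) := ⟨X.actSnd _, actLift_actSnd _ _ _, by
    apply act_hom_ext
    · rw [Category.assoc, actLift_actFst, ← act_condition, T.map_id]
      simp
    · rw [Category.assoc, actLift_actSnd]
      simp⟩
  let b (X : TGraph T) : X.act (𝟙 X.obj) ⟶ X.act X.freeAlg.p :=
    actMap (𝟙 X) X.freeAlg.β (by rw [freeAlg_β_p]; simp)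
  have hg (X : TGraph T) : X.generator = a X ≫ b X ≫ X.freeAlg.σ := by
    rw [generator, ← Category.assoc]
    refine congrArg (· ≫ X.freeAlg.σ) ?_
    apply act_hom_ext
    · rw [actLift_actFst, Category.assoc, actMap_actFst, actLift_actFst_assoc]
    · rw [actLift_actSnd, Category.assoc, actMap_actSnd, actLift_actSnd_assoc]
      simp
  rw [hg, hg]
  refine IsPullback.paste_horiz (v₁₂ := actMap (w := 𝟙 X.obj) (z := 𝟙 Y.obj) f f.onObj (by simp))
    (IsPullback.of_horiz_isIso ⟨?_⟩) (IsPullback.paste_horiz ?_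
      (X.freeExhaustion.isPullback_σ Y.freeExhaustion H))
  · apply act_hom_ext
    · simp only [Category.assoc, actMap_actFst, a, actLift_actFst, actLift_actFst_assoc,
        f.onArr_dom]
    · simp [a]
  · exact isPullback_actMap (IsPullback.id_horiz f.onObj) (IsPullback.id_horiz f.onArr)
      (X.freeExhaustion.isPullback_β Y.freeExhaustion H) _ _ _ _

end FreeMap

end TGraph

end

/-! ### Suitability of the induced monad -/

noncomputable section

variable {T : Monad E}

section Transfer

variable {C D : Type*} [Category* C] [Category* D] {F₁ F₂ : C ⥤ D} {G : D ⥤ C}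
  (adj₁ : F₁ ⊣ G) (adj₂ : F₂ ⊣ G) {A B : C} (f : A ⟶ B)

-- The theorem concerns an arbitrary left adjoint. Left adjoints are isomorphic compatibly with
-- units and counits, so the cartesian squares of the constructed adjunction transfer, here for the
-- unit and below for the multiplication.
include adj₂ in
lemma CategoryTheory.Adjunction.isPullback_unit
    (h : IsPullback f (adj₁.unit.app A) (adj₁.unit.app B) (G.map (F₁.map f))) :
    IsPullback f (adj₂.unit.app A) (adj₂.unit.app B) (G.map (F₂.map f)) := by
  let e (X : C) : G.obj (F₁.obj X) ≅ G.obj (F₂.obj X) :=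
    G.mapIso ((adj₁.leftAdjointUniq adj₂).app X)
  refine h.of_iso (Iso.refl _) (Iso.refl _) (e A) (e B) (by simp) ?_ ?_ ?_
  · exact (Adjunction.unit_leftAdjointUniq_hom_app adj₁ adj₂ A).trans (Category.id_comp _).symm
  · exact (Adjunction.unit_leftAdjointUniq_hom_app adj₁ adj₂ B).trans (Category.id_comp _).symm
  · exact (G.map_comp _ _).symm.trans ((congrArg G.map
      ((adj₁.leftAdjointUniq adj₂).hom.naturality f)).trans (G.map_comp _ _))

include adj₂ in
lemma CategoryTheory.Adjunction.isPullback_counit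
    (h : IsPullback (G.map (F₁.map (G.map (F₁.map f)))) (G.map (adj₁.counit.app (F₁.obj A)))
      (G.map (adj₁.counit.app (F₁.obj B))) (G.map (F₁.map f))) :
    IsPullback (G.map (F₂.map (G.map (F₂.map f)))) (G.map (adj₂.counit.app (F₂.obj A)))
      (G.map (adj₂.counit.app (F₂.obj B))) (G.map (F₂.map f)) := by
  let e := adj₁.leftAdjointUniq adj₂
  have hn {X Y : C} (g : X ⟶ Y) : F₁.map g ≫ e.hom.app Y = e.hom.app X ≫ F₂.map g :=
    e.hom.naturality g
  have hc (X : D) : e.hom.app (G.obj X) ≫ adj₂.counit.app X = adj₁.counit.app X :=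
    Adjunction.leftAdjointUniq_hom_app_counit adj₁ adj₂ X
  let e₁ (X : C) : F₁.obj X ≅ F₂.obj X := e.app X
  have he₁ (X : C) : (e₁ X).hom = e.hom.app X := rfl
  let e₂ (X : C) : F₁.obj (G.obj (F₁.obj X)) ≅ F₂.obj (G.obj (F₂.obj X)) :=
    F₁.mapIso (G.mapIso (e₁ X)) ≪≫ e₁ _
  have he₂ (X : C) : (e₂ X).hom = F₁.map (G.map (e.hom.app X)) ≫ e.hom.app _ := rfl
  have w (X : C) : adj₁.counit.app (F₁.obj X) ≫ (e₁ X).hom =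
      (e₂ X).hom ≫ adj₂.counit.app (F₂.obj X) := by
    rw [he₂, Category.assoc, hc, he₁]
    exact (adj₁.counit_naturality _).symm
  refine h.of_iso (G.mapIso (e₂ A)) (G.mapIso (e₂ B)) (G.mapIso (e₁ A)) (G.mapIso (e₁ B))
    ?_ ?_ ?_ ?_
  · simp only [Functor.mapIso_hom, ← G.map_comp]
    congr 1
    rw [he₂, he₂, Category.assoc, ← hn (G.map (F₂.map f)), ← F₁.map_comp_assoc,
      ← F₁.map_comp_assoc, ← G.map_comp, ← G.map_comp, hn f]
  · simp only [Functor.mapIso_hom, ← G.map_comp, w]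
  · simp only [Functor.mapIso_hom, ← G.map_comp, w]
  · simp only [Functor.mapIso_hom, ← G.map_comp, he₁, hn]

end Transfer

namespace TGraph

open TMulticategory

variable [IsSuitableCategory E] [IsSuitableMonad T]

lemma isAlgMap_freeHomEquiv_symm {X : TGraph T} {C : TMulticategory T} (f : X ⟶ C.toTGraph) :
    IsAlgMap f f.onObj X.freeAlg C.toAlg ((freeHomEquiv X C).symm f).toGraphHom.onArr :=
  (exists_freeLift f).choose_spec

lemma freeHomEquiv_id (X : TGraph T) : freeHomEquiv X X.free (𝟙 _) = X.freeUnit :=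
  Category.comp_id X.freeUnit

variable {X Y Z V : TGraph T} (f : X ⟶ Y)

lemma freeFunctor_map_onObj : ((freeFunctor T).map f).toGraphHom.onObj = f.onObj := by
  change (f ≫ freeHomEquiv Y Y.free (𝟙 _)).onObj = f.onObj
  rw [freeHomEquiv_id]
  exact Category.comp_id _

lemma isAlgMap_freeFunctor_map :
    IsAlgMap f f.onObj X.freeAlg Y.freeAlg ((freeFunctor T).map f).toGraphHom.onArr := by
  have h := isAlgMap_freeHomEquiv_symm (C := Y.free) (f ≫ freeHomEquiv Y Y.free (𝟙 _))
  refine isAlgMap_freeAlg_of_freeUnit (congrArg (f ≫ ·) Y.freeHomEquiv_id) ?_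
  rw [show (f ≫ freeHomEquiv Y Y.free (𝟙 _)).onObj = f.onObj from freeFunctor_map_onObj f] at h
  exact h

lemma freeFunctor_map_toGraphHom :
    ((freeFunctor T).map f).toGraphHom = freeMapGraph (isAlgMap_freeFunctor_map f) :=
  TGraph.hom_ext (freeFunctor_map_onObj f) rfl

lemma freeAdjunction_unit_app : (freeAdjunction T).unit.app X = X.freeUnit :=
  (Adjunction.adjunctionOfEquivLeft_unit_app _ _ _).trans X.freeHomEquiv_id

lemma freeAdjunction_counit_app (C : TMulticategory T) :
    (freeAdjunction T).counit.app C = (freeHomEquiv C.toTGraph C).symm (𝟙 _) :=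
  Adjunction.adjunctionOfEquivLeft_counit_app _ _ _

/-- On objects the functor is the identity. On arrows all four maps are recursively defined between
exhausted algebras, hence cartesian, and the pullback criterion applies. -/
instance preservesPullbacks_freeFunctor_comp_forget :
    PreservesLimitsOfShape WalkingCospan (freeFunctor T ⋙ forget T) :=
  preservesLimitsOfShape_walkingCospan_of_forall_isPullback fun Y Z V h k _ => by
    obtain ⟨X, f, g, h₀, h₁⟩ := exists_isPullback h k
    refine ⟨X, f, g, isPullback_of_components h₀ h₁, isPullback_of_components ?_ ?_⟩
    · change IsPullback ((freeFunctor T).map f).toGraphHom.onObj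
        ((freeFunctor T).map g).toGraphHom.onObj ((freeFunctor T).map h).toGraphHom.onObj
        ((freeFunctor T).map k).toGraphHom.onObj
      simp only [freeFunctor_map_onObj]
      exact h₀
    · have hh := isAlgMap_freeFunctor_map h
      exact X.freeExhaustion.isPullback_of_isAlgMap Z.freeExhaustion h₀ h₁ h₀
        (isAlgMap_freeFunctor_map g) (isAlgMap_freeFunctor_map f) hh
        (isAlgMap_freeFunctor_map k) (Y.freeExhaustion.isPullback_β V.freeExhaustion hh)
        (Y.freeExhaustion.isPullback_σ V.freeExhaustion hh)

lemma isPullback_freeUnit : IsPullback f X.freeUnit Y.freeUnit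
    (freeMapGraph (isAlgMap_freeFunctor_map f)) :=
  isPullback_of_components (IsPullback.id_vert f.onObj)
    (isPullback_generator (isAlgMap_freeFunctor_map f)).flip

/-- On objects the counit is an identity. On arrows it is the recursively defined map from trees of
trees to trees over the identity of the free graph, so the base square is trivial; the target's
structure maps `β` and `freeMul` are already known to be cartesian. -/
lemma isPullback_counit_freeFunctor :
    IsPullback ((forget T).map ((freeFunctor T).map ((forget T).map ((freeFunctor T).map f))))
      ((forget T).map ((freeAdjunction T).counit.app ((freeFunctor T).obj X)))
      ((forget T).map ((freeAdjunction T).counit.app ((freeFunctor T).obj Y)))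
      ((forget T).map ((freeFunctor T).map f)) := by
  let f' : X.freeGraph ⟶ Y.freeGraph := freeMapGraph (isAlgMap_freeFunctor_map f)
  have hf' : (forget T).map ((freeFunctor T).map f) = f' := freeFunctor_map_toGraphHom f
  rw [freeAdjunction_counit_app, freeAdjunction_counit_app, hf']
  have H := isAlgMap_freeFunctor_map f
  have H' := isAlgMap_freeFunctor_map f'
  have hr := isAlgMap_freeHomEquiv_symm (X := X.freeGraph) (C := X.free) (𝟙 _)
  have hs := isAlgMap_freeHomEquiv_symm (X := Y.freeGraph) (C := Y.free) (𝟙 _)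
  have hu : IsAlgMap f' f.onObj X.free.toAlg Y.free.toAlg f'.onArr :=
    ⟨H.p, H.β, (isPullback_freeMul H).w⟩
  refine isPullback_of_components ?_ (IsPullback.flip ?_)
  · change IsPullback ((freeFunctor T).map f').toGraphHom.onObj (𝟙 _) (𝟙 _) f.onObj
    rw [freeFunctor_map_onObj]
    exact IsPullback.id_vert f.onObj
  · exact X.freeGraph.freeExhaustion.isPullback_of_isAlgMap Y.freeGraph.freeExhaustion
      (IsPullback.id_horiz f'.onObj) (IsPullback.id_horiz f'.onArr) (IsPullback.id_horiz f'.onObj)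
      (U := X.free.toAlg) (V := Y.free.toAlg) H' hr hu hs
      (X.freeExhaustion.isPullback_β Y.freeExhaustion H) (isPullback_freeMul H)

variable {F : TGraph T ⥤ TMulticategory T} (adj : F ⊣ forget T)

/-- The free `T`-multicategory monad is suitable. -/
lemma isSuitableMonad : IsSuitableMonad adj.toMonad := by
  have hp : PreservesLimitsOfShape WalkingCospan (F ⋙ forget T) :=
    preservesLimitsOfShape_of_natIso
      (Functor.isoWhiskerRight ((freeAdjunction T).leftAdjointUniq adj) (forget T))
  -- Preservation of monomorphisms, needed for nested colimits, follows from `hp`.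
  refine ⟨hp, fun {X Y} f => ?_, fun f => ?_, fun D hD => preservesColimit_toMonad adj hD⟩
  · refine (freeAdjunction T).isPullback_unit adj f ?_
    rw [freeAdjunction_unit_app, freeAdjunction_unit_app]
    have h : (forget T).map ((freeFunctor T).map f) =
      freeMapGraph (isAlgMap_freeFunctor_map f) := freeFunctor_map_toGraphHom f
    rw [h]
    exact isPullback_freeUnit f
  · exact (freeAdjunction T).isPullback_counit adj f (isPullback_counit_freeFunctor f)

end TGraph

end

theorem theorem1p2p1 (E : Type u) [Category.{v} E] [IsSuitableCategory E]
    (T : Monad E) [IsSuitableMonad T] :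
    (TMulticategory.forget T).IsRightAdjoint ∧
    ∀ (F : TGraph T ⥤ TMulticategory T) (adj : F ⊣ TMulticategory.forget T),
      (Monad.comparison adj).IsEquivalence ∧
      IsSuitableCategory (TGraph T) ∧
      IsSuitableMonad adj.toMonad :=
  ⟨⟨_, ⟨TGraph.freeAdjunction T⟩⟩, fun _ adj => ⟨TMulticategory.isEquivalence_comparison adj,
    TGraph.isSuitableCategory T, TGraph.isSuitableMonad adj⟩⟩
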